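/- **Setting.** Let $G=(V,E)$ be an undirected graph with $n=|V|\ge 3$ vertices and edge weights in $[1,W]$, such that shortest paths between two vertices in induced subgraphs of $G$ are unique. Let $d\ge 2$, $c\ge 1$, $0<\epsilon<1$, $k=\ln n$, $\epsilon_1=\epsilon/(2+\epsilon)$, $\epsilon_5=\epsilon_1/(4k-2)$, $B=\lceil\log_{1+\epsilon_5}(nW)\rceil$, $s=4e\,d^{c+1}\ln^2 n+1$. Write $|P|$ for the weighted length of a path $P$, $P[x,y]$ for its portion from $x$ to $y$, $\pi_F(x,y)$ for the shortest $x$-$y$ path in $F$ ($|\pi_F(x,y)|=\infty$ if there is none), and $\log=\log_2$. **Hierarchy.** For disjoint $S,R\subseteq V$, an $S$-restricted tree cover of $G-R$ consists of one tree $T(r)\subseteq G-R$ rooted at $r$ for each $r\in S$, such that (i) any $a\in S$ and $b\in V\setminus R$ that are connected in $G-R$ lie in a common tree in which the sum of their depths is at most $(2k-1)|\pi_{G-R}(a,b)|$, and (ii) every vertex lies in at most $kn^{1/k}(\ln n+1)$ trees. Fix such a cover for all $S,R$ and let $\mathcal T_R(U)$ be the one with sources $U\setminus R$ in $G-R$.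 A trunk vertex of a tree is one on the tree path between two sources; the pseudo-degree of a vertex is its degree in the subtree of trunk vertices ($0$ for non-trunk vertices); $\mathrm{Hi}(\mathcal T_R(U))$ is the set of vertices of pseudo-degree $>s$ in some tree of $\mathcal T_R(U)$. The hierarchy tree has root $V$; a node $U$ is a leaf if $\mathrm{Hi}(\mathcal T_\varnothing(U))=\varnothing$, and otherwise its children are $W_1,\dots,W_d$, where $W_0=\varnothing$ and $W_{j+1}=W_j\cup\mathrm{Hi}(\mathcal T_{W_j}(U))$. The oracle has one structure for each root-to-node path $V=U_1,\dots,U_p$ (put $U_{p+1}=\varnothing$). Relative to this path, the level $l(x)$ is the largest $i\le p$ with $x\in U_i$, and $G_i$ is the subgraph induced by the vertices of level at most $i$. **Bipaths and segments.** A path $P$ from $x$ to $y$ is an $\epsilon_5$-bipath if it is a concatenation $e_0,P_0,e_1,\dots,P_{2B+1},e_{2B+2}$, each $e_i$ being an edge or empty, where every $P_j=P[u_j,v_j]$ (possibly a single vertex) is of the form $\pi_{G_i}(u_j,z)\circ\pi_{G_{i'}}(z,v_j)$ with $1\le i,i'\le p$, and $|P[x,v_j]|\le(1+\epsilon_5)^j$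 for $j<B+1$, $|P[u_j,y]|\le(1+\epsilon_5)^{2B+1-j}$ for $j\ge B+1$. It is stored as the $2B+2$ tuples $(u_j,z,v_j,i,i')$. Two interior vertices $q,q'$ of $P$ are in the same segment if either $|P[x,q]|,|P[x,q']|\le|P|/2$ and $\lfloor\log_{1+\epsilon_5}|P[x,q]|\rfloor=\lfloor\log_{1+\epsilon_5}|P[x,q']|\rfloor$, or $|P[q,y]|,|P[q',y]|<|P|/2$ and $\lfloor\log_{1+\epsilon_5}|P[q,y]|\rfloor=\lfloor\log_{1+\epsilon_5}|P[q',y]|\rfloor$. **Decision trees.** For all $x,y\in V$ there is a decision tree $FT(x,y)$ of depth at most $d$. Each node $\alpha$ has a set $\mathrm{avoid}(\alpha)$ (empty at the root) and stores a shortest $\epsilon_5$-bipath $P_\alpha$ from $x$ to $y$ in $G-\mathrm{avoid}(\alpha)$ (of length $\infty$ if there is none). For each segment $X$ of $P_\alpha$ and each $1\le i\le p$, a node $\alpha$ of depth less than $d$ has a child with avoided set $\mathrm{avoid}(\alpha)\cup(X\cap U_i)$. For a set $D$ of failed vertices, $\mathrm{DecTree}(x,y,D)$ starts at the root; while $P_\alpha$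 contains a failed vertex, it takes such a vertex $f$ of highest level (ties broken arbitrarily) and moves to the child given by the segment of $f$ and $i=l(f)$; finally it returns $|P_\alpha|$. **Query.** Given $D\subseteq V$ with $|D|\le d$ and $u_0,v_0\in V\setminus D$, a root-to-node path is found by starting at $V$ and, at a node $U$, taking the least $j\in[0,d]$ with $D\cap(W_{j+1}\setminus W_j)=\varnothing$ (where $W_{d+1}=W_d$), stopping if $U$ is a leaf or $j=0$, and moving to $W_j$ otherwise. For $f\in D$ let $N(f)$ consist of the parent of $f$ and of those children of $f$ that are trunk vertices, in all trees of $\bigcup_{i=1}^p\mathcal T_{U_{i+1}}(U_i)$ that contain $f$. Let $V(H)=(\{u_0,v_0\}\cup\bigcup_{f\in D}N(f))\setminus D$, and let $H$ be the complete graph on $V(H)$ in which the step from $x$ to $y$ has weight $\mathrm{DecTree}(x,y,D)$. The answer is $|\pi_H(u_0,v_0)|$. **Theorem.** There is an absolute constant $C>0$ such that for all $G,W,d,c,\epsilon$ as above the oracle can be built (all required tree covers exist), and, for every admissible choice of the tree covers, of the shortest bipaths and of the tie-breaking: 1. The tuples stored for an $\epsilon_5$-bipath from $x$ to $y$ determine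 it. 2. For every $D\subseteq V$ with $|D|\le d$, the path-finding procedure succeeds. For every root-to-node path of the hierarchy tree (in particular the one found), all $u_0,v_0\in V\setminus D$ and all $u,v\in V(H)$, the search $\mathrm{DecTree}(u,v,D)$ ends, at depth at most $d$, at a node whose path avoids $D$ (or has length $\infty$), and $$|\pi_{G-D}(u,v)|\le|\pi_H(u,v)|\le(1+\epsilon)\,|\pi_{G-D}(u,v)|.$$ 3. If $d\le n$, the oracle occupies at most $$n^{2+1/c}\cdot\frac{\log d}{\log n}\cdot\left(C\,\epsilon^{-1}\,\frac{\log^2 n\,\log(nW)}{\log d}\right)^{d+1}$$ words. This counts, for every root-to-node path, all nodes, links and tuples of all decision trees, the distance matrices of $G_1,\dots,G_p$, the vertex tables (level, and first child containing the vertex), and the tree covers $\mathcal T_{U_{i+1}}(U_i)$. Consequently, for fixed $c$ and $\epsilon$, $d=o(\log n/\log\log n)$ and $W=\mathrm{poly}(n)$, the oracle has stretch $1+\epsilon$ and occupies $n^{2+1/c+o(1)}$ words. -/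

import Mathlib

open scoped ENNReal Topology

universe u

namespace VSDO

/-! ### Weighted graphs: lengths, distances, shortest paths -/

/-- The weighted length `|p|` of a walk. -/
noncomputable def wlen {V : Type u} {G : SimpleGraph V} (w : Sym2 V → ℝ) {a b : V}
    (p : G.Walk a b) : ℝ :=
  (p.edges.map w).sum

/-- The walk `p` stays inside the vertex set `S`, i.e. it is a walk of the induced subgraph
`G[S]`. -/
def Inside {V : Type u} {G : SimpleGraph V} (S : Set V) {a b : V} (p : G.Walk a b) : Prop :=
  ∀ x ∈ p.support, x ∈ S

/-- The distance from `a` to `b` in the induced subgraph `G[S]` (`⊤` if they are not connected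
there). -/
noncomputable def distIn {V : Type u} (G : SimpleGraph V) (w : Sym2 V → ℝ) (S : Set V)
    (a b : V) : ℝ≥0∞ :=
  ⨅ (p : G.Walk a b) (_ : Inside S p), ENNReal.ofReal (wlen w p)

/-- `p` is a shortest path of the induced subgraph `G[S]`. -/
def IsShortestIn {V : Type u} {G : SimpleGraph V} (w : Sym2 V → ℝ) (S : Set V) {a b : V}
    (p : G.Walk a b) : Prop :=
  p.IsPath ∧ Inside S p ∧ ∀ q : G.Walk a b, Inside S q → wlen w p ≤ wlen w q

/-- The portion of `p` between its `i`-th and its `j`-th vertex (`i ≤ j`). -/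
def portion {V : Type u} {G : SimpleGraph V} {a b : V} (p : G.Walk a b) (i j : ℕ) :
    G.Walk (p.getVert i) ((p.drop i).getVert (j - i)) :=
  (p.drop i).take (j - i)

/-! ### The input and the parameters -/

/-- A weighted graph, the bound `W` on its weights, the bound `d` on the number of failures, the
hierarchy parameter `c` and the accuracy `ε`. -/
structure Input (V : Type u) where
  G : SimpleGraph V
  w : Sym2 V → ℝ
  W : ℝ
  d : ℕ
  c : ℝ
  ε : ℝ

/-- The standing assumptions: at least three vertices, edge weights in `[1, W]`, unique shortest
paths in subgraphs, `d ≥ 2`, `c ≥ 1` and `0 < ε < 1`. -/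
structure Input.Admissible {V : Type u} [Fintype V] (I : Input V) : Prop where
  three_le_card : 3 ≤ Fintype.card V
  one_le_W : 1 ≤ I.W
  weight_mem : ∀ e ∈ I.G.edgeSet, 1 ≤ I.w e ∧ I.w e ≤ I.W
  unique_shortest : ∀ (S : Set V) (a b : V) (p q : I.G.Walk a b),
    IsShortestIn I.w S p → IsShortestIn I.w S q → p = q
  two_le_d : 2 ≤ I.d
  one_le_c : 1 ≤ I.c
  ε_pos : 0 < I.ε
  ε_lt_one : I.ε < 1

/-- The number of vertices, as a real number. -/
noncomputable def Input.n {V : Type u} [Fintype V] (_I : Input V) : ℝ := Fintype.card V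

/-- `k = ln n`. -/
noncomputable def Input.k {V : Type u} [Fintype V] (I : Input V) : ℝ := Real.log I.n

/-- `ε₁ = ε / (2 + ε)`. -/
noncomputable def Input.ε₁ {V : Type u} (I : Input V) : ℝ := I.ε / (2 + I.ε)

/-- `ε₅ = ε₁ / (4k - 2)`. -/
noncomputable def Input.ε₅ {V : Type u} [Fintype V] (I : Input V) : ℝ := I.ε₁ / (4 * I.k - 2)

/-- `B = ⌈log_{1+ε₅} (nW)⌉`. -/
noncomputable def Input.B {V : Type u} [Fintype V] (I : Input V) : ℕ :=
  ⌈Real.logb (1 + I.ε₅) (I.n * I.W)⌉₊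

/-- The degree threshold `s = 4 e d^{c+1} ln² n + 1`. -/
noncomputable def Input.s {V : Type u} [Fintype V] (I : Input V) : ℝ :=
  4 * Real.exp 1 * (I.d : ℝ) ^ (I.c + 1) * Real.log I.n ^ 2 + 1

/-! ### Source-restricted tree covers, trunks, pseudo-degrees -/

/-- `T r` (`r ∈ S`) is an `S`-restricted tree cover of `G - R`, where `S` and `R` are disjoint:
`T r` is a tree of `G - R` rooted at `r`; all `a ∈ S` and `b` that are connected in `G - R` lie in
a common tree in which the sum of their depths is at most `2k - 1` times their distance in `G - R`;
and every vertex lies in at most `k n^{1/k} (ln n + 1)` of the trees. -/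
def IsTreeCover {V : Type u} [Fintype V] (I : Input V) (R S : Finset V)
    (T : V → I.G.Subgraph) : Prop :=
  (∀ r ∈ S, r ∈ (T r).verts ∧ (T r).coe.IsTree ∧ ∀ x ∈ (T r).verts, x ∉ R) ∧
  (∀ a ∈ S, ∀ b, b ∉ R → distIn I.G I.w {x | x ∉ R} a b ≠ ⊤ →
    ∃ r ∈ S, a ∈ (T r).verts ∧ b ∈ (T r).verts ∧
      distIn (T r).spanningCoe I.w Set.univ r a + distIn (T r).spanningCoe I.w Set.univ r b ≤
        ENNReal.ofReal (2 * I.k - 1) * distIn I.G I.w {x | x ∉ R} a b) ∧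
  (∀ x, (({r | r ∈ S ∧ x ∈ (T r).verts} : Set V).ncard : ℝ) ≤
    I.k * I.n ^ (1 / I.k) * (Real.log I.n + 1))

/-- The trunk vertices of a tree `T`: those on the `T`-path between two vertices of `S`. -/
def trunk {V : Type u} {G : SimpleGraph V} (S : Finset V) (T : G.Subgraph) : Set V :=
  {x | ∃ a ∈ S, ∃ b ∈ S, a ∈ T.verts ∧ b ∈ T.verts ∧
    ∃ q : T.spanningCoe.Walk a b, q.IsPath ∧ x ∈ q.support}

open scoped Classical in
/-- The pseudo-degree of `x` in `T`: its degree in the subtree induced by the trunk vertices, and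
`0` if `x` is not a trunk vertex. -/
noncomputable def pdeg {V : Type u} {G : SimpleGraph V} (S : Finset V) (T : G.Subgraph)
    (x : V) : ℕ :=
  if x ∈ trunk S T then ({y | y ∈ trunk S T ∧ T.Adj x y} : Set V).ncard else 0

/-- In the tree `T` rooted at `r`, the vertex `x` is the parent of `f`: it is adjacent to `f` and
lies on the `T`-path from `f` to the root. -/
def IsParent {V : Type u} {G : SimpleGraph V} (T : G.Subgraph) (r x f : V) : Prop :=
  T.Adj x f ∧ ∃ q : T.spanningCoe.Walk f r, q.IsPath ∧ x ∈ q.support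

/-! ### The high-degree hierarchy

`cov R S` stands for a tree cover with sources `S` in `G - R`; thus `cov R (U \ R)` is the cover
`𝒯_R(U)`. -/

open scoped Classical in
/-- `Hi(𝒯_R(U))`: the vertices of pseudo-degree larger than `s` in some tree of `𝒯_R(U)`. -/
noncomputable def Hi {V : Type u} [Fintype V] (I : Input V)
    (cov : Finset V → Finset V → V → I.G.Subgraph) (U R : Finset V) : Finset V :=
  Finset.univ.filter fun x => ∃ r ∈ U \ R, I.s < pdeg (U \ R) (cov R (U \ R) r) x

open scoped Classical in
/-- The sets `W_0 = ∅` and `W_{j+1} = W_j ∪ Hi(𝒯_{W_j}(U))`; the children of a non-leaf node `U`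
of the hierarchy tree are `W_1, …, W_d`. -/
noncomputable def childSet {V : Type u} [Fintype V] (I : Input V)
    (cov : Finset V → Finset V → V → I.G.Subgraph) (U : Finset V) : ℕ → Finset V
  | 0 => ∅
  | j + 1 => childSet I cov U j ∪ Hi I cov U (childSet I cov U j)

/-- Starting from the node `U` of the hierarchy tree and going down to child number `j₁`, then
child number `j₂`, …, one always stays in the tree. A node is a leaf iff `Hi(𝒯(U)) = ∅`. -/
def AddressFrom {V : Type u} [Fintype V] (I : Input V)
    (cov : Finset V → Finset V → V → I.G.Subgraph) : Finset V → List ℕ → Prop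
  | _, [] => True
  | U, j :: a => Hi I cov U ∅ ≠ ∅ ∧ 1 ≤ j ∧ j ≤ I.d ∧ AddressFrom I cov (childSet I cov U j) a

/-- The sets met on the way described by an address. -/
noncomputable def chainFrom {V : Type u} [Fintype V] (I : Input V)
    (cov : Finset V → Finset V → V → I.G.Subgraph) : Finset V → List ℕ → List (Finset V)
  | U, [] => [U]
  | U, j :: a => U :: chainFrom I cov (childSet I cov U j) a

open scoped Classical in
/-- The path-finding algorithm, given the failed set `D` and standing at `U`, makes the choices
`j₁, j₂, …` and then halts: at each node it takes the least `j ∈ [0, d]` such that `D` does not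
meet `W_{j+1} \ W_j` (with `W_{d+1} = W_d`) and it halts if the node is a leaf or `j = 0`. -/
def PathFinding {V : Type u} [Fintype V] (I : Input V)
    (cov : Finset V → Finset V → V → I.G.Subgraph) (D : Finset V) : Finset V → List ℕ → Prop
  | U, [] => Hi I cov U ∅ = ∅ ∨ Disjoint D (childSet I cov U 1)
  | U, j :: a => Hi I cov U ∅ ≠ ∅ ∧ 1 ≤ j ∧ j ≤ I.d ∧
      (∀ i < j, ¬ Disjoint D (childSet I cov U (i + 1) \ childSet I cov U i)) ∧
      (j < I.d → Disjoint D (childSet I cov U (j + 1) \ childSet I cov U j)) ∧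
      PathFinding I cov D (childSet I cov U j) a

/-! ### Levels, with respect to a list `[U_1, …, U_p]` of vertex sets -/

/-- `U_i` for `i ≥ 1`; in particular `U_{p+1} = ∅`. -/
def nth {V : Type u} (L : List (Finset V)) (i : ℕ) : Finset V := L.getD (i - 1) ∅

open scoped Classical in
/-- The level of `x`: the largest `i ∈ [1, p]` with `x ∈ U_i`. -/
noncomputable def level {V : Type u} (L : List (Finset V)) (x : V) : ℕ :=
  ((Finset.Icc 1 L.length).filter fun i => x ∈ nth L i).sup id

/-- The vertex set of `G_i`: all vertices of level at most `i`. -/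
def upTo {V : Type u} (L : List (Finset V)) (i : ℕ) : Set V := {x | level L x ≤ i}

/-! ### Segments -/

/-- The `i`-th and the `j`-th vertex of `p` (both different from the endpoints) are in the same
`δ`-segment of `p`. -/
def SameSegment {V : Type u} {G : SimpleGraph V} (w : Sym2 V → ℝ) (δ : ℝ) {a b : V}
    (p : G.Walk a b) (i j : ℕ) : Prop :=
  (0 < i ∧ i < p.length) ∧ (0 < j ∧ j < p.length) ∧
  ((wlen w (p.take i) ≤ wlen w p / 2 ∧ wlen w (p.take j) ≤ wlen w p / 2 ∧
      ⌊Real.logb (1 + δ) (wlen w (p.take i))⌋ = ⌊Real.logb (1 + δ) (wlen w (p.take j))⌋) ∨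
    (wlen w (p.drop i) < wlen w p / 2 ∧ wlen w (p.drop j) < wlen w p / 2 ∧
      ⌊Real.logb (1 + δ) (wlen w (p.drop i))⌋ = ⌊Real.logb (1 + δ) (wlen w (p.drop j))⌋))

open scoped Classical in
/-- The vertices of the `δ`-segment of the path `p` that contains `x`. -/
noncomputable def seg {V : Type u} [Fintype V] {G : SimpleGraph V} (w : Sym2 V → ℝ) (δ : ℝ)
    {a b : V} (p : G.Walk a b) (x : V) : Finset V :=
  Finset.univ.filter fun y =>
    ∃ i j, SameSegment w δ p i j ∧ p.getVert i = x ∧ p.getVert j = y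

open scoped Classical in
/-- The set of all `δ`-segments of the path `p`. -/
noncomputable def segs {V : Type u} [Fintype V] {G : SimpleGraph V} (w : Sym2 V → ℝ) (δ : ℝ)
    {a b : V} (p : G.Walk a b) : Finset (Finset V) :=
  (Finset.univ.filter fun x => x ∈ p.support ∧ x ≠ a ∧ x ≠ b).image (seg w δ p)

/-! ### Bipaths and the words that store them -/

/-- The five words `(u_k, z_k, v_k, i_k, j_k)` that stand for the path
`π_{G_i}(u_k, z_k) ∘ π_{G_j}(z_k, v_k)`. -/
structure Piece (V : Type u) where
  first : V
  mid : V
  last : V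
  lev₁ : ℕ
  lev₂ : ℕ

/-- The path `p` is a concatenation `e_0, P_0, e_1, P_1, …, P_{2B+1}, e_{2B+2}`, where each `e_k`
is an edge or empty and `P_k` (`0 ≤ k ≤ 2B+1`) is the path `π_{G_i}(u_k, z_k) ∘ π_{G_j}(z_k, v_k)`
described by the `k`-th entry of `code`, with levels `1 ≤ i, j ≤ p`; moreover `|p[u, v_k]|` is at
most `(1 + ε₅)^k` if `k < B + 1`, and `|p[u_k, v]|` is at most `(1 + ε₅)^{2B+1-k}` if `k ≥ B + 1`.
The numbers `s k ≤ m k ≤ t k` are the positions of `u_k, z_k, v_k` on `p`; an empty `P_k` is one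
with `s k = t k`. -/
def IsCodeOf {V : Type u} [Fintype V] (I : Input V) (L : List (Finset V))
    (code : List (Piece V)) {a b : V} (p : I.G.Walk a b) : Prop :=
  p.IsPath ∧ code.length = 2 * I.B + 2 ∧ ∃ s m t : ℕ → ℕ,
    s 0 ≤ 1 ∧ (∀ k < 2 * I.B + 1, t k ≤ s (k + 1) ∧ s (k + 1) ≤ t k + 1) ∧
    p.length ≤ t (2 * I.B + 1) + 1 ∧
    ∀ (k : ℕ) (hk : k < code.length),
      (s k ≤ m k ∧ m k ≤ t k ∧ t k ≤ p.length) ∧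
      (p.getVert (s k) = code[k].first ∧ p.getVert (m k) = code[k].mid ∧
        p.getVert (t k) = code[k].last) ∧
      (1 ≤ code[k].lev₁ ∧ code[k].lev₁ ≤ L.length ∧ 1 ≤ code[k].lev₂ ∧
        code[k].lev₂ ≤ L.length) ∧
      IsShortestIn I.w (upTo L code[k].lev₁) (portion p (s k) (m k)) ∧
      IsShortestIn I.w (upTo L code[k].lev₂) (portion p (m k) (t k)) ∧
      (k < I.B + 1 → wlen I.w (p.take (t k)) ≤ (1 + I.ε₅) ^ k) ∧
      (I.B + 1 ≤ k → wlen I.w (p.drop (s k)) ≤ (1 + I.ε₅) ^ (2 * I.B + 1 - k))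

/-- `p` is an `ε₅`-bipath. -/
def IsBipath {V : Type u} [Fintype V] (I : Input V) (L : List (Finset V)) {a b : V}
    (p : I.G.Walk a b) : Prop :=
  ∃ code, IsCodeOf I L code p

/-! ### The oracle -/

/-- The choices that pin the oracle down: the tree covers; for each root-to-node path `a` of the
hierarchy tree, each pair `x, y` and each avoided set `A`, a shortest `ε₅`-bipath from `x` to `y`
in `G - A` together with its code (`none`, a path of length `+∞`, if there is no such bipath); and
the way in which the query breaks ties between failed vertices of the highest level. -/
structure Oracle {V : Type u} [Fintype V] (I : Input V) where
  cov : Finset V → Finset V → V → I.G.Subgraph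
  cov_spec : ∀ R S, Disjoint R S → IsTreeCover I R S (cov R S)
  stored : (a : List ℕ) → (x y : V) → (A : Finset V) → Option (I.G.Walk x y × List (Piece V))
  stored_none : ∀ a x y A, stored a x y A = none →
    ∀ q : I.G.Walk x y, Inside {z | z ∉ A} q → ¬ IsBipath I (chainFrom I cov Finset.univ a) q
  stored_some : ∀ a x y A p code, stored a x y A = some (p, code) →
    IsCodeOf I (chainFrom I cov Finset.univ a) code p ∧ Inside {z | z ∉ A} p ∧
    ∀ q : I.G.Walk x y, Inside {z | z ∉ A} q → IsBipath I (chainFrom I cov Finset.univ a) q →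
      wlen I.w p ≤ wlen I.w q
  pick : List ℕ → V → V → Finset V → Finset V → V
  pick_spec : ∀ a x y D A p code, stored a x y A = some (p, code) →
    (∃ f ∈ D, f ∈ p.support) →
      pick a x y D A ∈ D ∧ pick a x y D A ∈ p.support ∧
      ∀ g ∈ D, g ∈ p.support → level (chainFrom I cov Finset.univ a) g ≤
        level (chainFrom I cov Finset.univ a) (pick a x y D A)

namespace Oracle

/-- `a` is the address of a node of the hierarchy tree, i.e. a path from the root `V`. -/
def IsNode {V : Type u} [Fintype V] {I : Input V} (O : Oracle I) (a : List ℕ) : Prop :=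
  AddressFrom I O.cov Finset.univ a

/-- The sets `U_1 = V, U_2, …, U_p` on the path with address `a`. -/
noncomputable def chain {V : Type u} [Fintype V] {I : Input V} (O : Oracle I) (a : List ℕ) :
    List (Finset V) :=
  chainFrom I O.cov Finset.univ a

open scoped Classical in
/-- The set of roots of the trees of `𝒯_{U_{i+1}}(U_i)`. -/
noncomputable def roots {V : Type u} [Fintype V] {I : Input V} (O : Oracle I) (a : List ℕ)
    (i : ℕ) : Finset V :=
  nth (O.chain a) i \ nth (O.chain a) (i + 1)

/-- The tree of `𝒯_{U_{i+1}}(U_i)` that is rooted at `r`. -/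
noncomputable def tree {V : Type u} [Fintype V] {I : Input V} (O : Oracle I) (a : List ℕ)
    (i : ℕ) (r : V) : I.G.Subgraph :=
  O.cov (nth (O.chain a) (i + 1)) (O.roots a i) r

open scoped Classical in
/-- `avoid(ch(α, X, i)) = avoid(α) ∪ (X ∩ U_i)`, where `avoid(α) = A`. -/
noncomputable def childAvoid {V : Type u} [Fintype V] {I : Input V} (O : Oracle I) (a : List ℕ)
    (A X : Finset V) (i : ℕ) : Finset V :=
  A ∪ (X ∩ nth (O.chain a) i)

open scoped Classical in
/-- The loop of `DecTree`: from a node of `FT(x, y)` with avoided set `A` and at least `t` levels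
of the decision tree below it, go down while the stored path contains a failed vertex; the value is
the avoided set of the node where the loop ends. -/
noncomputable def descend {V : Type u} [Fintype V] {I : Input V} (O : Oracle I) (a : List ℕ)
    (x y : V) (D : Finset V) : ℕ → Finset V → Finset V
  | 0, A => A
  | t + 1, A =>
    match O.stored a x y A with
    | none => A
    | some (p, _) =>
      if ∃ f ∈ D, f ∈ p.support then
        descend O a x y D t (O.childAvoid a A (seg I.w I.ε₅ p (O.pick a x y D A))
          (level (O.chain a) (O.pick a x y D A)))
      else A

/-- The avoided set of the node of `FT(x, y)`, a tree of depth `d`, where `DecTree(x, y, D)`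
ends. -/
noncomputable def finalNode {V : Type u} [Fintype V] {I : Input V} (O : Oracle I) (a : List ℕ)
    (x y : V) (D : Finset V) : Finset V :=
  O.descend a x y D I.d ∅

/-- `DecTree(x, y, D)`: the length of the path stored in the final node. -/
noncomputable def decTree {V : Type u} [Fintype V] {I : Input V} (O : Oracle I) (a : List ℕ)
    (D : Finset V) (x y : V) : ℝ≥0∞ :=
  match O.stored a x y (O.finalNode a x y D) with
  | none => ⊤
  | some (p, _) => ENNReal.ofReal (wlen I.w p)

/-- `z ∈ N(f)`: in some tree of some cover `𝒯_{U_{i+1}}(U_i)` (`1 ≤ i ≤ p`) that contains `f`, the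
vertex `z` is the parent of `f`, or a trunk vertex which is a child of `f`. -/
def IsNear {V : Type u} [Fintype V] {I : Input V} (O : Oracle I) (a : List ℕ) (f z : V) : Prop :=
  ∃ i, 1 ≤ i ∧ i ≤ (O.chain a).length ∧ ∃ r ∈ O.roots a i, f ∈ (O.tree a i r).verts ∧
    (IsParent (O.tree a i r) r z f ∨
      (IsParent (O.tree a i r) r f z ∧ z ∈ trunk (O.roots a i) (O.tree a i r)))

open scoped Classical in
/-- The vertex set `V(H)` of the auxiliary graph of the query `(x, y, D)`. -/
noncomputable def vertsH {V : Type u} [Fintype V] {I : Input V} (O : Oracle I) (a : List ℕ)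
    (D : Finset V) (x y : V) : Finset V :=
  ({x, y} ∪ Finset.univ.filter fun z => ∃ f ∈ D, O.IsNear a f z) \ D

/-- `|π_H(x, y)|`, where `H` is the complete graph on the vertex set `Q` in which the step from
`x'` to `y'` costs `DecTree(x', y', D)`. -/
noncomputable def distH {V : Type u} [Fintype V] {I : Input V} (O : Oracle I) (a : List ℕ)
    (D Q : Finset V) (x y : {z // z ∈ Q}) : ℝ≥0∞ :=
  ⨅ p : (⊤ : SimpleGraph {z // z ∈ Q}).Walk x y,
    (p.darts.map fun e => O.decTree a D e.fst e.snd).sum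

/-! ### Space, in words -/

/-- The words used by the part of `FT(x, y)` below a node with avoided set `A` that has `t` levels
below it: one word for the node, five words for each entry of the code of its path, and one word for
the link to each of the children `ch(α, X, i)`. -/
noncomputable def treeWords {V : Type u} [Fintype V] {I : Input V} (O : Oracle I) (a : List ℕ)
    (x y : V) : ℕ → Finset V → ℕ
  | 0, A =>
    match O.stored a x y A with
    | none => 1
    | some (_, code) => 1 + 5 * code.length
  | t + 1, A =>
    match O.stored a x y A with
    | none => 1
    | some (p, code) => 1 + 5 * code.length +
        ∑ X ∈ segs I.w I.ε₅ p, ∑ i ∈ Finset.Icc 1 (O.chain a).length,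
          (1 + treeWords O a x y t (O.childAvoid a A X i))

/-- The words used by the structure that belongs to one node of the hierarchy tree: the decision
trees `FT(x, y)` of depth `d`, the distance matrices of `G_1, …, G_p`, the level of each vertex and
the first child of the node that contains it, and the tree covers (four words for each vertex of
each tree: the vertex, its parent, its depth, and whether it is a trunk vertex). -/
noncomputable def nodeWords {V : Type u} [Fintype V] {I : Input V} (O : Oracle I)
    (a : List ℕ) : ℕ :=
  (∑ x : V, ∑ y : V, O.treeWords a x y I.d ∅) +
    (O.chain a).length * Fintype.card V ^ 2 + 2 * Fintype.card V +
    ∑ i ∈ Finset.Icc 1 (O.chain a).length, ∑ r ∈ O.roots a i, 4 * (O.tree a i r).verts.ncard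

/-- The space of the oracle: the words used by all nodes of the hierarchy tree together. -/
noncomputable def space {V : Type u} [Fintype V] {I : Input V} (O : Oracle I) : ℝ≥0∞ :=
  ∑' a : {a : List ℕ // O.IsNode a}, (O.nodeWords a.1 : ℝ≥0∞)

end Oracle

end VSDO

namespace VSDO
/-! ### Lengths of walks -/

section Walks

variable {V : Type u} {G : SimpleGraph V} {w : Sym2 V → ℝ}

/-! Fix a failed set `D` and a root-to-node path of the hierarchy.

The lower bound on distances in `H` is soft. Every step down a decision tree puts a new failed
vertex into the avoided set, so a tree of depth `d` ends at a path that avoids `D`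
(`descend_avoids`), and each step in `H` costs at least a distance in `G - D`.

The upper bound has one source of query vertices, `exists_near`. Suppose a walk from an unfailed
vertex q reaches a failed vertex and its failed vertices have level at most that of q. After moving
q along the walk to a vertex of highest level i before the first failure, the walk up to that
failure runs in `G - U_{i+1}` and q is a source of the cover of `U_i` there. A tree of this cover
joins q to the failed vertex, and the vertex just before the tree path first enters `D` belongs to
`V(H)`. It is within `2k - 1` times the length of the walk.

Call a path free if no interior vertex has a query vertex within `ε₁` times its distance to the
nearer end. A free path N made of two shortest paths of `G - D` is a bipath
(`Free.exists_canonBip`): cut it at powers of `1 + ε₅`; a shortcut for a block in the graph `G_i` of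
its highest level would use a failed vertex, hence yield a query vertex too close to the block. A
query also never discards N (`inside_childAvoid`). If v on N lay in the discarded part of the
segment of f, the stored path would join v to f by a short piece on which all failures have level at
most that of v, and again a query vertex would be too close. Here "short" refers to the position of
v on the stored path. That this is at most twice its position on N is the exchange argument
`CanonBip.pos_le`. Hence the decision tree returns at most |N| (`decTree_le`).

To apply this, follow the shortest path of `G - D` from x to y up to the first vertex with a query
vertex within `ε₁` times its distance to the nearer end, then go to the nearest query vertex z. This
path is free, z is closer to y than x is, and the detour is paid for by `ε` (`exists_step`).
Iterating gives stretch `1 + ε` (`distH_le`). Of `V(H)` only two facts matter: it misses `D` and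
contains all unfailed vertices near failures.

For the space, the trunk of a tree is a tree whose leaves are sources, so vertices of large
pseudo-degree are few compared with the sources (`mul_card_lt_pdeg_le`). Each level of the hierarchy
therefore shrinks by `d^c`, and there are at most `2 n^{1/c}` nodes. A node of a decision tree has
about `p · log_{1+ε₅}(nW)` children because a path has few segments (`card_segs_le`).

The tree covers are shortest path trees of Thorup–Zwick clusters, with the random samples replaced
by greedy hitting sets (`exists_levels`, `exists_isTreeCover`). -/

@[simp] theorem wlen_nil (a : V) : wlen w (SimpleGraph.Walk.nil : G.Walk a a) = 0 := by
  simp [wlen]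

@[simp] theorem wlen_cons {a b c : V} (h : G.Adj a b) (p : G.Walk b c) :
    wlen w (SimpleGraph.Walk.cons h p) = w s(a, b) + wlen w p := by
  simp [wlen]

@[simp] theorem wlen_append {a b c : V} (p : G.Walk a b) (q : G.Walk b c) :
    wlen w (p.append q) = wlen w p + wlen w q := by
  simp [wlen]

@[simp] theorem wlen_reverse {a b : V} (p : G.Walk a b) : wlen w p.reverse = wlen w p := by
  simp [wlen, List.sum_reverse]

@[simp] theorem wlen_copy {a b a' b' : V} (p : G.Walk a b) (ha : a = a') (hb : b = b') :
    wlen w (p.copy ha hb) = wlen w p := by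
  subst ha hb; rfl

theorem wlen_nonneg (hw : ∀ e ∈ G.edgeSet, 1 ≤ w e) {a b : V} (p : G.Walk a b) :
    0 ≤ wlen w p := by
  refine List.sum_nonneg fun x hx => ?_
  obtain ⟨e, he, rfl⟩ := List.mem_map.1 hx
  exact zero_le_one.trans (hw e (p.edges_subset_edgeSet he))

theorem length_le_wlen (hw : ∀ e ∈ G.edgeSet, 1 ≤ w e) {a b : V} (p : G.Walk a b) :
    (p.length : ℝ) ≤ wlen w p := by
  induction p with
  | nil => simp
  | cons h p ih =>
    have := hw s(_, _) h
    simp only [SimpleGraph.Walk.length_cons, Nat.cast_add, Nat.cast_one, wlen_cons]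
    linarith

theorem wlen_le_length_mul {W : ℝ} (hw : ∀ e ∈ G.edgeSet, w e ≤ W) {a b : V} (p : G.Walk a b) :
    wlen w p ≤ p.length * W := by
  induction p with
  | nil => simp
  | cons h p ih =>
    have := hw s(_, _) h
    simp only [SimpleGraph.Walk.length_cons, Nat.cast_add, Nat.cast_one, wlen_cons]
    linarith

theorem wlen_bypass_le [DecidableEq V] (hw : ∀ e ∈ G.edgeSet, 1 ≤ w e) {a b : V}
    (p : G.Walk a b) : wlen w p.bypass ≤ wlen w p := by
  refine List.Sublist.sum_le_sum (p.edges_bypass_sublist_edges.map w) fun x hx => ?_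
  obtain ⟨e, he, rfl⟩ := List.mem_map.1 hx
  exact zero_le_one.trans (hw e (p.edges_subset_edgeSet he))

/-- The length of the part of `p` before its `j`-th vertex. -/
noncomputable def pos (w : Sym2 V → ℝ) {a b : V} (p : G.Walk a b) (j : ℕ) : ℝ := wlen w (p.take j)

@[simp] theorem pos_zero {a b : V} (p : G.Walk a b) : pos w p 0 = 0 := by simp [pos]

theorem pos_add_wlen_drop {a b : V} (p : G.Walk a b) (j : ℕ) :
    pos w p j + wlen w (p.drop j) = wlen w p := by
  conv_rhs => rw [← p.append_take_drop_eq j]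
  rw [wlen_append, pos]

theorem pos_succ {a b : V} (p : G.Walk a b) {j : ℕ} (hj : j < p.length) :
    pos w p (j + 1) = pos w p j + w s(p.getVert j, p.getVert (j + 1)) := by
  induction p generalizing j with
  | nil => simp at hj
  | cons h p ih =>
    cases j with
    | zero => simp [pos, SimpleGraph.Walk.take]
    | succ j =>
      have := @ih j (by simpa using hj)
      simp only [pos, SimpleGraph.Walk.take, wlen_cons, SimpleGraph.Walk.getVert_cons_succ] at this ⊢
      rw [this]; ring

theorem pos_of_length_le {a b : V} (p : G.Walk a b) {j : ℕ} (hj : p.length ≤ j) :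
    pos w p j = wlen w p := by
  have := pos_add_wlen_drop (w := w) p j
  rw [SimpleGraph.Walk.drop_of_length_le hj] at this
  simpa using this

theorem pos_length {a b : V} (p : G.Walk a b) : pos w p p.length = wlen w p :=
  pos_of_length_le p le_rfl

/-- Walks with different endpoints have different types. They are therefore compared through their
vertex sequences and the positions `pos`, here and in everything that splices or reverses. -/
theorem pos_sub_congr {a b a' b' : V} (p : G.Walk a b) (q : G.Walk a' b') {i j m : ℕ}
    (hi : i + m ≤ p.length) (hj : j + m ≤ q.length)
    (h : ∀ l ≤ m, p.getVert (i + l) = q.getVert (j + l)) :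
    pos w p (i + m) - pos w p i = pos w q (j + m) - pos w q j := by
  induction m with
  | zero => simp
  | succ m ih =>
    have h1 := h m (by omega)
    have h2 := h (m + 1) le_rfl
    have := ih (by omega) (by omega) fun l hl => h l (by omega)
    rw [← add_assoc, ← add_assoc, pos_succ p (by omega), pos_succ q (by omega), add_assoc i m 1,
      add_assoc j m 1, h1, h2]
    linarith

theorem pos_congr {a b a' b' : V} (p : G.Walk a b) (q : G.Walk a' b') {m : ℕ}
    (hi : m ≤ p.length) (hj : m ≤ q.length) (h : ∀ l ≤ m, p.getVert l = q.getVert l) :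
    pos w p m = pos w q m := by
  have := pos_sub_congr (w := w) p q (i := 0) (j := 0) (m := m) (by omega) (by omega)
    (by simpa using h)
  simpa using this

theorem pos_reverse {a b : V} (p : G.Walk a b) {j : ℕ} (hj : j ≤ p.length) :
    pos w p.reverse j = wlen w p - pos w p (p.length - j) := by
  induction j with
  | zero => simp [pos_length]
  | succ j ih =>
    have h1 : p.length - j = p.length - (j + 1) + 1 := by omega
    rw [pos_succ p.reverse (by simpa using hj), ih (by omega), h1,
      pos_succ p (j := p.length - (j + 1)) (by omega), SimpleGraph.Walk.getVert_reverse,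
      SimpleGraph.Walk.getVert_reverse, ← h1, Sym2.eq_swap]
    ring

theorem sub_le_pos_sub (hw : ∀ e ∈ G.edgeSet, 1 ≤ w e) {a b : V} (p : G.Walk a b) {i j : ℕ}
    (hij : i ≤ j) (hj : j ≤ p.length) : (j : ℝ) - i ≤ pos w p j - pos w p i := by
  induction j, hij using Nat.le_induction with
  | base => simp
  | succ j hij ih =>
    have := hw s(_, _) (p.adj_getVert_succ (i := j) (by omega))
    rw [pos_succ p (by omega)]
    push_cast
    linarith [ih (by omega)]

theorem pos_mono (hw : ∀ e ∈ G.edgeSet, 1 ≤ w e) {a b : V} (p : G.Walk a b) {i j : ℕ}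
    (hij : i ≤ j) : pos w p i ≤ pos w p j := by
  rcases le_total j p.length with hj | hj
  · have := sub_le_pos_sub hw p hij hj
    have : (i : ℝ) ≤ j := by exact_mod_cast hij
    linarith
  · rw [pos_of_length_le p hj]
    have := pos_add_wlen_drop (w := w) p i
    linarith [wlen_nonneg hw (p.drop i)]

theorem pos_strictMono (hw : ∀ e ∈ G.edgeSet, 1 ≤ w e) {a b : V} (p : G.Walk a b) {i j : ℕ}
    (hij : i < j) (hj : j ≤ p.length) : pos w p i < pos w p j := by
  have := sub_le_pos_sub hw p hij.le hj
  have : (i : ℝ) < j := by exact_mod_cast hij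
  linarith

theorem pos_nonneg (hw : ∀ e ∈ G.edgeSet, 1 ≤ w e) {a b : V} (p : G.Walk a b) (i : ℕ) :
    0 ≤ pos w p i := wlen_nonneg hw _

theorem pos_le_wlen (hw : ∀ e ∈ G.edgeSet, 1 ≤ w e) {a b : V} (p : G.Walk a b) (i : ℕ) :
    pos w p i ≤ wlen w p := by
  have := pos_add_wlen_drop (w := w) p i
  linarith [wlen_nonneg hw (p.drop i)]

theorem mem_support_iff_getVert {a b x : V} (p : G.Walk a b) :
    x ∈ p.support ↔ ∃ l ≤ p.length, p.getVert l = x := by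
  rw [SimpleGraph.Walk.mem_support_iff_exists_getVert]
  exact exists_congr fun _ => and_comm

/-- The part of a walk between two of its vertices. -/
theorem exists_between {a b : V} (p : G.Walk a b) {i j : ℕ} (hij : i ≤ j) (hj : j ≤ p.length) :
    ∃ g : G.Walk (p.getVert i) (p.getVert j), wlen w g = pos w p j - pos w p i ∧
      g.length = j - i ∧ (∀ l ≤ j - i, g.getVert l = p.getVert (i + l)) ∧
      ∀ x ∈ g.support, ∃ l, i ≤ l ∧ l ≤ j ∧ x = p.getVert l := by
  have he : (p.drop i).getVert (j - i) = p.getVert j := by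
    rw [SimpleGraph.Walk.drop_getVert]; congr 1; omega
  have hl : (((p.drop i).take (j - i)).copy rfl he).length = j - i := by
    simp; omega
  have hv : ∀ l ≤ j - i, (((p.drop i).take (j - i)).copy rfl he).getVert l = p.getVert (i + l) := by
    intro l hl
    simp [min_eq_right hl]
  refine ⟨((p.drop i).take (j - i)).copy rfl he, ?_, hl, hv, ?_⟩
  · rw [← pos_length, hl]
    have := pos_sub_congr (w := w) (((p.drop i).take (j - i)).copy rfl he) p (i := 0) (j := i)
      (m := j - i) (by rw [hl]; omega) (by omega) (by simpa using hv)
    rw [zero_add, pos_zero, show i + (j - i) = j by omega] at this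
    linarith
  · intro x hx
    obtain ⟨l, hl', rfl⟩ := (mem_support_iff_getVert _).1 hx
    rw [hl] at hl'
    exact ⟨i + l, by omega, by omega, hv l hl'⟩

/-- Following `p` up to its `i`-th vertex and then `q` from its `j`-th vertex on. -/
theorem exists_splice {a b a' c : V} (p : G.Walk a b) (q : G.Walk a' c) {i j : ℕ}
    (hi : i ≤ p.length) (h : p.getVert i = q.getVert j) :
    ∃ N : G.Walk a c, N.length = i + (q.length - j) ∧ (∀ l ≤ i, N.getVert l = p.getVert l) ∧
      ∀ l, N.getVert (i + l) = q.getVert (j + l) := by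
  refine ⟨(p.take i).append ((q.drop j).copy h.symm rfl), ?_, ?_, ?_⟩
  · simp [min_eq_left hi]
  · intro l hl
    rw [SimpleGraph.Walk.getVert_append']
    simp [min_eq_left hi, hl]
  · intro l
    rw [SimpleGraph.Walk.getVert_append]
    simp [min_eq_left hi]

theorem isPath_iff_getVert {a b : V} (p : G.Walk a b) :
    p.IsPath ↔ ∀ i j, i < j → j ≤ p.length → p.getVert i ≠ p.getVert j := by
  rw [← SimpleGraph.Walk.IsPath.getVert_injOn_iff]
  constructor
  · intro h i j hij hj he
    have := h (show i ∈ {i | i ≤ p.length} from by simp; omega) hj he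
    omega
  · intro h i hi j hj he
    rcases lt_trichotomy i j with hl | hl | hl
    · exact absurd he (h i j hl hj)
    · exact hl
    · exact absurd he.symm (h j i hl hi)

theorem Inside.append {S : Set V} {a b c : V} {p : G.Walk a b} {q : G.Walk b c}
    (hp : Inside S p) (hq : Inside S q) : Inside S (p.append q) := by
  intro x hx
  rcases SimpleGraph.Walk.mem_support_append_iff _ _ |>.1 hx with h | h
  exacts [hp x h, hq x h]

theorem Inside.reverse {S : Set V} {a b : V} {p : G.Walk a b}
    (hp : Inside S p) : Inside S p.reverse := by
  intro x hx
  exact hp x (by simpa using hx)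

theorem inside_iff_getVert {S : Set V} {a b : V} (p : G.Walk a b) :
    Inside S p ↔ ∀ l ≤ p.length, p.getVert l ∈ S := by
  constructor
  · exact fun h l _ => h _ (p.getVert_mem_support l)
  · intro h x hx
    obtain ⟨l, hl, rfl⟩ := (mem_support_iff_getVert p).1 hx
    exact h l hl

theorem Inside.bypass [DecidableEq V] {S : Set V} {a b : V} {p : G.Walk a b}
    (hp : Inside S p) : Inside S p.bypass :=
  fun x hx => hp x (p.support_bypass_subset_support hx)

theorem finite_setOf_isPath [Finite V] (a b : V) : {p : G.Walk a b | p.IsPath}.Finite := by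
  classical
  have := Fintype.ofFinite V
  exact Set.finite_coe_iff.1 (show Finite (G.Path a b) from inferInstance)

theorem exists_shortest [Finite V] (hw : ∀ e ∈ G.edgeSet, 1 ≤ w e) {S : Set V} {a b : V}
    (p : G.Walk a b) (hp : Inside S p) : ∃ q : G.Walk a b, IsShortestIn w S q := by
  classical
  obtain ⟨q, hq, hmin⟩ := Set.exists_min_image {q : G.Walk a b | q.IsPath ∧ Inside S q} (wlen w)
    ((finite_setOf_isPath a b).subset fun q hq => hq.1) ⟨p.bypass, p.bypass_isPath, hp.bypass⟩
  exact ⟨q, hq.1, hq.2, fun r hr =>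
    (hmin r.bypass ⟨r.bypass_isPath, hr.bypass⟩).trans (wlen_bypass_le hw r)⟩

theorem distIn_le {S : Set V} {a b : V} (p : G.Walk a b) (hp : Inside S p) :
    distIn G w S a b ≤ ENNReal.ofReal (wlen w p) := iInf₂_le p hp

theorem distIn_eq {S : Set V} {a b : V} {p : G.Walk a b} (hp : IsShortestIn w S p) :
    distIn G w S a b = ENNReal.ofReal (wlen w p) :=
  le_antisymm (distIn_le p hp.2.1)
    (le_iInf₂ fun q hq => ENNReal.ofReal_le_ofReal (hp.2.2 q hq))

theorem exists_shortest_of_distIn_ne_top [Finite V] (hw : ∀ e ∈ G.edgeSet, 1 ≤ w e) {S : Set V}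
    {a b : V} (h : distIn G w S a b ≠ ⊤) : ∃ q : G.Walk a b, IsShortestIn w S q := by
  by_contra hc
  refine h ?_
  simp only [distIn, iInf_eq_top]
  exact fun p hp => absurd (exists_shortest hw p hp) hc

theorem distIn_triangle (hw : ∀ e ∈ G.edgeSet, 1 ≤ w e) (S : Set V) (a b c : V) :
    distIn G w S a c ≤ distIn G w S a b + distIn G w S b c := by
  rw [distIn, distIn, distIn, ENNReal.iInf_add]
  refine le_iInf fun p => ?_
  rw [ENNReal.iInf_add]
  refine le_iInf fun hp => ?_
  rw [ENNReal.add_iInf]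
  refine le_iInf fun q => ?_
  rw [ENNReal.add_iInf]
  refine le_iInf fun hq => ?_
  rw [← ENNReal.ofReal_add (wlen_nonneg hw p) (wlen_nonneg hw q), ← wlen_append]
  exact iInf₂_le (p.append q) (hp.append hq)

theorem distIn_comm (S : Set V) (a b : V) : distIn G w S a b = distIn G w S b a := by
  have : ∀ a b, distIn G w S a b ≤ distIn G w S b a := fun a b =>
    le_iInf₂ fun p hp => by
      rw [← wlen_reverse]
      exact iInf₂_le p.reverse hp.reverse
  exact le_antisymm (this a b) (this b a)

end Walks

end VSDO

namespace VSDO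

/-! ### Codes of bipaths -/

section Shortest

variable {V : Type u} {G : SimpleGraph V} {w : Sym2 V → ℝ}

/-- The part of `p` between its `i`-th and its `j`-th vertex is a shortest path inside `S`. -/
def ShortBetween (w : Sym2 V → ℝ) (S : Set V) {a b : V} (p : G.Walk a b) (i j : ℕ) : Prop :=
  (∀ l, i ≤ l → l ≤ j → p.getVert l ∈ S) ∧
    ∀ g : G.Walk (p.getVert i) (p.getVert j), Inside S g → pos w p j - pos w p i ≤ wlen w g

theorem ShortBetween.refl {S : Set V} (hw : ∀ e ∈ G.edgeSet, 1 ≤ w e) {a b : V}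
    {p : G.Walk a b} {i : ℕ} (h : p.getVert i ∈ S) : ShortBetween w S p i i :=
  ⟨fun l h1 h2 => by rwa [le_antisymm h2 h1], fun g _ => by simpa using wlen_nonneg hw g⟩

/-- A shortcut for the inner portion, completed by the two outer bits of `p`, would be a shortcut
for the outer portion. -/
theorem ShortBetween.mono {S : Set V} {a b : V} {p : G.Walk a b} {i j i' j' : ℕ}
    (h : ShortBetween w S p i j) (hi : i ≤ i') (hij : i' ≤ j') (hj : j' ≤ j)
    (hjl : j ≤ p.length) : ShortBetween w S p i' j' := by
  refine ⟨fun l h1 h2 => h.1 l (by omega) (by omega), fun g hg => ?_⟩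
  obtain ⟨g₁, hw₁, -, -, hs₁⟩ := exists_between (w := w) p hi (by omega)
  obtain ⟨g₂, hw₂, -, -, hs₂⟩ := exists_between (w := w) p hj hjl
  have := h.2 ((g₁.append g).append g₂) (Inside.append (Inside.append ?_ hg) ?_)
  · simp only [wlen_append] at this
    linarith
  · intro x hx
    obtain ⟨l, h1, h2, rfl⟩ := hs₁ x hx
    exact h.1 l h1 (by omega)
  · intro x hx
    obtain ⟨l, h1, h2, rfl⟩ := hs₂ x hx
    exact h.1 l (by omega) h2

theorem ShortBetween.congr {S : Set V} {a b a' b' : V} {p : G.Walk a b} {q : G.Walk a' b'}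
    {i j i' j' : ℕ} (h : ShortBetween w S p i j) (hij : i ≤ j) (hjl : j ≤ p.length)
    (hj' : j' ≤ q.length) (hlen : j + i' = j' + i)
    (hv : ∀ l, i + l ≤ j → p.getVert (i + l) = q.getVert (i' + l)) : ShortBetween w S q i' j' := by
  obtain ⟨m, rfl⟩ := Nat.exists_eq_add_of_le hij
  obtain rfl : j' = i' + m := by omega
  have hpos := pos_sub_congr (w := w) p q hjl hj' fun l hl => hv l (by omega)
  refine ⟨fun l h1 h2 => ?_, fun g hg => ?_⟩
  · obtain ⟨l, rfl⟩ := Nat.exists_eq_add_of_le h1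
    rw [← hv l (by omega)]
    exact h.1 _ (by omega) (by omega)
  · have h0 := hv 0 (by omega)
    have h1 := hv m le_rfl
    have := h.2 (g.copy h0.symm h1.symm) (fun x hx => hg x (by simpa using hx))
    rw [wlen_copy] at this
    linarith

theorem ShortBetween.reverse {S : Set V} {a b : V} {p : G.Walk a b} {i j : ℕ}
    (h : ShortBetween w S p i j) (hij : i ≤ j) (hjl : j ≤ p.length) :
    ShortBetween w S p.reverse (p.length - j) (p.length - i) := by
  refine ⟨fun l h1 h2 => ?_, fun g hg => ?_⟩
  · rw [SimpleGraph.Walk.getVert_reverse]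
    exact h.1 _ (by omega) (by omega)
  · have hi : p.reverse.getVert (p.length - i) = p.getVert i := by
      rw [SimpleGraph.Walk.getVert_reverse]; congr 1; omega
    have hj : p.reverse.getVert (p.length - j) = p.getVert j := by
      rw [SimpleGraph.Walk.getVert_reverse]; congr 1; omega
    have := h.2 (g.reverse.copy hi hj) (fun x hx => hg x (by simpa using hx))
    rw [wlen_copy, wlen_reverse] at this
    rw [pos_reverse p (by omega), pos_reverse p (by omega),
      show p.length - (p.length - i) = i by omega, show p.length - (p.length - j) = j by omega]
    linarith

theorem portion_length {a b : V} (p : G.Walk a b) {i j : ℕ} (hj : j ≤ p.length) :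
    (portion p i j).length = j - i := by
  simp [portion]; omega

theorem portion_getVert {a b : V} (p : G.Walk a b) {i j l : ℕ} (hl : l ≤ j - i) :
    (portion p i j).getVert l = p.getVert (i + l) := by
  simp [portion, min_eq_right hl]

theorem wlen_portion {a b : V} (p : G.Walk a b) {i j : ℕ} (hij : i ≤ j) (hj : j ≤ p.length) :
    wlen w (portion p i j) = pos w p j - pos w p i := by
  rw [← pos_length, portion_length p hj]
  have := pos_sub_congr (w := w) (portion p i j) p (i := 0) (j := i) (m := j - i)
    (by rw [portion_length p hj]; omega) (by omega)
    (fun l hl => by rw [zero_add, portion_getVert p hl])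
  rw [zero_add, pos_zero, show i + (j - i) = j by omega] at this
  linarith

theorem isShortestIn_portion_iff {S : Set V} {a b : V} {p : G.Walk a b} (hp : p.IsPath)
    {i j : ℕ} (hij : i ≤ j) (hj : j ≤ p.length) :
    IsShortestIn w S (portion p i j) ↔ ShortBetween w S p i j := by
  have he : (p.drop i).getVert (j - i) = p.getVert j := by
    rw [SimpleGraph.Walk.drop_getVert]; congr 1; omega
  rw [IsShortestIn, ShortBetween, inside_iff_getVert, portion_length p hj, wlen_portion p hij hj]
  constructor
  · rintro ⟨-, h1, h2⟩
    refine ⟨fun l hl hl' => ?_, fun g hg => ?_⟩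
    · have := h1 (l - i) (by omega)
      rwa [portion_getVert p (by omega), show i + (l - i) = l by omega] at this
    · have := h2 (g.copy rfl he.symm) (fun x hx => hg x (by simpa using hx))
      rwa [wlen_copy] at this
  · rintro ⟨h1, h2⟩
    refine ⟨?_, fun l hl => ?_, fun g hg => ?_⟩
    · exact (hp.drop i).take (j - i)
    · rw [portion_getVert p hl]
      exact h1 _ (by omega) (by omega)
    · have := h2 (g.copy rfl he) (fun x hx => hg x (by simpa using hx))
      rwa [wlen_copy] at this

theorem ShortBetween.eq_of_unique
    (hu : ∀ (S : Set V) (a b : V) (p q : G.Walk a b), IsShortestIn w S p → IsShortestIn w S q →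
      p = q) {S : Set V} {a b a' b' : V} {p : G.Walk a b} {q : G.Walk a' b'} {i j i' j' : ℕ}
    (hp : p.IsPath) (hq : q.IsPath) (h : ShortBetween w S p i j) (h' : ShortBetween w S q i' j')
    (hij : i ≤ j) (hjl : j ≤ p.length) (hij' : i' ≤ j') (hjl' : j' ≤ q.length)
    (hi : p.getVert i = q.getVert i') (hj : p.getVert j = q.getVert j') :
    j + i' = j' + i ∧ ∀ l, i + l ≤ j → p.getVert (i + l) = q.getVert (i' + l) := by
  have e1 : (p.drop i).getVert (j - i) = p.getVert j := by
    rw [SimpleGraph.Walk.drop_getVert]; congr 1; omega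
  have e2 : (q.drop i').getVert (j' - i') = q.getVert j' := by
    rw [SimpleGraph.Walk.drop_getVert]; congr 1; omega
  have h1 := (isShortestIn_portion_iff hp hij hjl).2 h
  have h2 := (isShortestIn_portion_iff hq hij' hjl').2 h'
  have key : ∀ {x y x' y' : V} (g : G.Walk x y) (g' : G.Walk x' y'), IsShortestIn w S g →
      IsShortestIn w S g' → x = x' → y = y' →
      g.length = g'.length ∧ ∀ l, g.getVert l = g'.getVert l := by
    rintro x y x' y' g g' hg hg' rfl rfl
    rw [hu S _ _ g g' hg hg']
    exact ⟨rfl, fun _ => rfl⟩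
  obtain ⟨hlen, hv⟩ := key _ _ h1 h2 hi (e1.trans (hj.trans e2.symm))
  rw [portion_length p hjl, portion_length q hjl'] at hlen
  refine ⟨by omega, fun l hl => ?_⟩
  have := hv l
  rwa [portion_getVert p (by omega), portion_getVert q (by omega)] at this

end Shortest

/-! ### Uniqueness of codes, bipaths in terms of positions, reversal -/

section Codes

variable {V : Type u} [Fintype V] {I : Input V}

/-- A code of a path determines it. -/
theorem IsCodeOf.unique (hI : I.Admissible) {L : List (Finset V)} {a b : V}
    {code : List (Piece V)} {p q : I.G.Walk a b} (hp : IsCodeOf I L code p)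
    (hq : IsCodeOf I L code q) : p = q := by
  obtain ⟨hpp, hlen, s, m, t, hs0, hst, hlast, h⟩ := hp
  obtain ⟨hqp, -, s', m', t', hs0', hst', hlast', h'⟩ := hq
  -- The connecting part is an edge or empty. Which of the two is visible from the vertices alone:
  -- on a simple path the next vertex differs from the present one exactly if the position has
  -- advanced.
  have extend : ∀ x y y', y ≤ p.length → y' ≤ q.length → (x ≤ y ∧ y ≤ x + 1) →
      (x ≤ y' ∧ y' ≤ x + 1) → (∀ l ≤ x, p.getVert l = q.getVert l) → p.getVert y = q.getVert y' →
      y = y' ∧ ∀ l ≤ y, p.getVert l = q.getVert l := by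
    intro x y y' hy hy' hxy hxy' hag he
    have hx := hag x le_rfl
    have hyy : y = y' := by
      rcases Nat.lt_or_ge x y with h1 | h1 <;> rcases Nat.lt_or_ge x y' with h2 | h2
      · omega
      · obtain rfl : y' = x := by omega
        exact absurd (hx.trans he.symm) ((isPath_iff_getVert p).1 hpp _ _ h1 hy)
      · obtain rfl : y = x := by omega
        exact absurd (hx.symm.trans he) ((isPath_iff_getVert q).1 hqp _ _ h2 hy')
      · omega
    refine ⟨hyy, fun l hl => ?_⟩
    rcases Nat.lt_or_ge x l with h1 | h1
    · obtain rfl : l = y := by omega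
      rw [he, hyy]
    · exact hag l h1
  have piece : ∀ k < 2 * I.B + 2, s k = s' k → (∀ l ≤ s k, p.getVert l = q.getVert l) →
      t k = t' k ∧ ∀ l ≤ t k, p.getVert l = q.getVert l := by
    intro k hk hsk hag
    obtain ⟨⟨h1, h2, h3⟩, ⟨v1, v2, v3⟩, -, c1, c2, -⟩ := h k (by omega)
    obtain ⟨⟨h1', h2', h3'⟩, ⟨v1', v2', v3'⟩, -, c1', c2', -⟩ := h' k (by omega)
    rw [isShortestIn_portion_iff hpp (by omega) (by omega)] at c1 c2
    rw [isShortestIn_portion_iff hqp (by omega) (by omega)] at c1' c2'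
    obtain ⟨e1, a1⟩ := c1.eq_of_unique hI.unique_shortest hpp hqp c1' h1 (by omega) h1' (by omega)
      (v1.trans v1'.symm) (v2.trans v2'.symm)
    obtain ⟨e2, a2⟩ := c2.eq_of_unique hI.unique_shortest hpp hqp c2' h2 (by omega) h2' (by omega)
      (v2.trans v2'.symm) (v3.trans v3'.symm)
    have hm : m k = m' k := by omega
    refine ⟨by omega, fun l hl => ?_⟩
    rcases le_total l (s k) with hls | hls
    · exact hag l hls
    · rcases le_total l (m k) with hlm | hlm
      · have := a1 (l - s k) (by omega)
        rwa [← hsk, show s k + (l - s k) = l by omega] at this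
      · have := a2 (l - m k) (by omega)
        rwa [← hm, show m k + (l - m k) = l by omega] at this
  have main : ∀ k < 2 * I.B + 2, t k = t' k ∧ ∀ l ≤ t k, p.getVert l = q.getVert l := by
    intro k hk
    induction k with
    | zero =>
      obtain ⟨⟨h1, h2, h3⟩, ⟨v1, -, -⟩, -⟩ := h 0 (by omega)
      obtain ⟨⟨h1', h2', h3'⟩, ⟨v1', -, -⟩, -⟩ := h' 0 (by omega)
      obtain ⟨e, ag⟩ := extend 0 (s 0) (s' 0) (by omega) (by omega) (by omega) (by omega)
        (fun l hl => by obtain rfl : l = 0 := by omega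
                        simp) (v1.trans v1'.symm)
      exact piece 0 hk e ag
    | succ k ih =>
      obtain ⟨e0, ag0⟩ := ih (by omega)
      obtain ⟨⟨h1, h2, h3⟩, ⟨v1, -, -⟩, -⟩ := h (k + 1) (by omega)
      obtain ⟨⟨h1', h2', h3'⟩, ⟨v1', -, -⟩, -⟩ := h' (k + 1) (by omega)
      have := hst k (by omega)
      have := hst' k (by omega)
      obtain ⟨e, ag⟩ := extend (t k) (s (k + 1)) (s' (k + 1)) (by omega) (by omega) (by omega)
        (by omega) ag0 (v1.trans v1'.symm)
      exact piece (k + 1) hk e ag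
  obtain ⟨e, ag⟩ := main (2 * I.B + 1) (by omega)
  obtain ⟨⟨h1, h2, h3⟩, -⟩ := h (2 * I.B + 1) (by omega)
  obtain ⟨⟨h1', h2', h3'⟩, -⟩ := h' (2 * I.B + 1) (by omega)
  obtain ⟨e, ag⟩ := extend (t (2 * I.B + 1)) p.length q.length le_rfl le_rfl (by omega) (by omega)
    ag (by simp)
  exact SimpleGraph.Walk.ext_getVert_le_length e ag

/-- The positions `s k ≤ m k ≤ t k` exhibit `p` as an `ε₅`-bipath. -/
structure Bip (I : Input V) (L : List (Finset V)) {a b : V} (p : I.G.Walk a b)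
    (s m t : ℕ → ℕ) : Prop where
  isPath : p.IsPath
  first : s 0 ≤ 1
  step : ∀ k < 2 * I.B + 1, t k ≤ s (k + 1) ∧ s (k + 1) ≤ t k + 1
  last : p.length ≤ t (2 * I.B + 1) + 1
  le : ∀ k ≤ 2 * I.B + 1, s k ≤ m k ∧ m k ≤ t k ∧ t k ≤ p.length
  short₁ : ∀ k ≤ 2 * I.B + 1, ∃ e, (1 ≤ e ∧ e ≤ L.length) ∧
    ShortBetween I.w (upTo L e) p (s k) (m k)
  short₂ : ∀ k ≤ 2 * I.B + 1, ∃ e, (1 ≤ e ∧ e ≤ L.length) ∧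
    ShortBetween I.w (upTo L e) p (m k) (t k)
  bound₁ : ∀ k ≤ I.B, pos I.w p (t k) ≤ (1 + I.ε₅) ^ k
  bound₂ : ∀ k ≤ 2 * I.B + 1, I.B + 1 ≤ k →
    wlen I.w p - pos I.w p (s k) ≤ (1 + I.ε₅) ^ (2 * I.B + 1 - k)

/-- The code only records vertices and levels, which can be read off from the positions. Cutting,
splicing and reversing act on positions, so later arguments use `Bip`. -/
theorem isBipath_iff {L : List (Finset V)} {a b : V} {p : I.G.Walk a b} :
    IsBipath I L p ↔ ∃ s m t, Bip I L p s m t := by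
  constructor
  · rintro ⟨code, hp, hlen, s, m, t, h0, hst, hlast, h⟩
    have hd := fun j => pos_add_wlen_drop (w := I.w) p j
    refine ⟨s, m, t, hp, h0, hst, hlast, fun k hk => (h k (by omega)).1, fun k hk => ?_,
      fun k hk => ?_, fun k hk => ?_, fun k hk hB => ?_⟩
    · obtain ⟨⟨h1, h2, h3⟩, -, ⟨l1, l2, l3, l4⟩, c1, c2, -⟩ := h k (by omega)
      exact ⟨_, ⟨l1, l2⟩, (isShortestIn_portion_iff hp (by omega) (by omega)).1 c1⟩
    · obtain ⟨⟨h1, h2, h3⟩, -, ⟨l1, l2, l3, l4⟩, c1, c2, -⟩ := h k (by omega)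
      exact ⟨_, ⟨l3, l4⟩, (isShortestIn_portion_iff hp (by omega) (by omega)).1 c2⟩
    · exact (h k (by omega)).2.2.2.2.2.1 (by omega)
    · have := (h k (by omega)).2.2.2.2.2.2 (by omega)
      linarith [hd (s k)]
  · rintro ⟨s, m, t, hb⟩
    have hd := fun j => pos_add_wlen_drop (w := I.w) p j
    choose! e he hse using hb.short₁
    choose! f hf hsf using hb.short₂
    refine ⟨(List.range (2 * I.B + 2)).map fun k =>
      ⟨p.getVert (s k), p.getVert (m k), p.getVert (t k), e k, f k⟩, hb.isPath, by simp, s, m, t,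
      hb.first, hb.step, hb.last, ?_⟩
    intro k hk
    have hk' : k ≤ 2 * I.B + 1 := by simp at hk; omega
    obtain ⟨h1, h2, h3⟩ := hb.le k hk'
    simp only [List.getElem_map, List.getElem_range]
    refine ⟨⟨h1, h2, h3⟩, by simp, ⟨(he k hk').1, (he k hk').2, (hf k hk').1, (hf k hk').2⟩,
      (isShortestIn_portion_iff hb.isPath (by omega) (by omega)).2 (hse k hk'),
      (isShortestIn_portion_iff hb.isPath (by omega) (by omega)).2 (hsf k hk'),
      fun h => hb.bound₁ k (by omega), fun h => ?_⟩
    have := hb.bound₂ k hk' h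
    linarith [hd (s k)]

/-- The reverse of a bipath is a bipath. -/
theorem Bip.reverse {L : List (Finset V)} {a b : V} {p : I.G.Walk a b} {s m t : ℕ → ℕ}
    (h : Bip I L p s m t) : Bip I L p.reverse (fun k => p.length - t (2 * I.B + 1 - k))
      (fun k => p.length - m (2 * I.B + 1 - k)) (fun k => p.length - s (2 * I.B + 1 - k)) := by
  have hlast := h.last
  have hfirst := h.first
  refine ⟨h.isPath.reverse, ?_, fun k hk => ?_, ?_, fun k hk => ?_, fun k hk => ?_, fun k hk => ?_,
    fun k hk => ?_, fun k hk hB => ?_⟩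
  · simp; omega
  · have h1 := h.step (2 * I.B + 1 - (k + 1)) (by omega)
    have h2 := h.le (2 * I.B + 1 - (k + 1)) (by omega)
    have h3 := h.le (2 * I.B + 1 - k) (by omega)
    rw [show 2 * I.B + 1 - (k + 1) + 1 = 2 * I.B + 1 - k by omega] at h1
    constructor <;> omega
  · simp; omega
  · have h1 := h.le (2 * I.B + 1 - k) (by omega)
    simp only [SimpleGraph.Walk.length_reverse]
    omega
  · obtain ⟨e, he, hs⟩ := h.short₂ (2 * I.B + 1 - k) (by omega)
    have h1 := h.le (2 * I.B + 1 - k) (by omega)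
    exact ⟨e, he, hs.reverse (by omega) (by omega)⟩
  · obtain ⟨e, he, hs⟩ := h.short₁ (2 * I.B + 1 - k) (by omega)
    have h1 := h.le (2 * I.B + 1 - k) (by omega)
    exact ⟨e, he, hs.reverse (by omega) (by omega)⟩
  · have h1 := h.le (2 * I.B + 1 - k) (by omega)
    have := h.bound₂ (2 * I.B + 1 - k) (by omega) (by omega)
    rw [show 2 * I.B + 1 - (2 * I.B + 1 - k) = k by omega] at this
    rwa [pos_reverse p (by omega),
      show p.length - (p.length - s (2 * I.B + 1 - k)) = s (2 * I.B + 1 - k) by omega]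
  · have h1 := h.le (2 * I.B + 1 - k) (by omega)
    have := h.bound₁ (2 * I.B + 1 - k) (by omega)
    rw [pos_reverse p (by omega),
      show p.length - (p.length - t (2 * I.B + 1 - k)) = t (2 * I.B + 1 - k) by omega,
      wlen_reverse]
    linarith

theorem IsBipath.reverse {L : List (Finset V)} {a b : V} {p : I.G.Walk a b}
    (h : IsBipath I L p) : IsBipath I L p.reverse := by
  obtain ⟨s, m, t, hb⟩ := isBipath_iff.1 h
  exact isBipath_iff.2 ⟨_, _, _, hb.reverse⟩

end Codes

end VSDO

namespace VSDO

/-! ### Parameters and levels -/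

section Levels

variable {V : Type u}

theorem level_le_length (L : List (Finset V)) (x : V) : level L x ≤ L.length := by
  classical
  refine Finset.sup_le fun i hi => ?_
  exact (Finset.mem_Icc.1 (Finset.mem_filter.1 hi).1).2

theorem le_level {L : List (Finset V)} {x : V} {i : ℕ} (h1 : 1 ≤ i) (h : x ∈ nth L i) :
    i ≤ level L x := by
  classical
  have hi : i ≤ L.length := by
    by_contra hc
    rw [nth, List.getD_eq_default _ _ (by omega)] at h
    simp at h
  exact Finset.le_sup (f := id) (Finset.mem_filter.2 ⟨Finset.mem_Icc.2 ⟨h1, hi⟩, h⟩)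

end Levels

section Parameters

variable {V : Type u} [Fintype V] {I : Input V}

theorem Input.Admissible.one_le_weight (hI : I.Admissible) : ∀ e ∈ I.G.edgeSet, 1 ≤ I.w e :=
  fun e he => (hI.weight_mem e he).1

theorem Input.Admissible.three_le_n (hI : I.Admissible) : 3 ≤ I.n := by
  simpa [Input.n] using (Nat.cast_le (α := ℝ)).2 hI.three_le_card

theorem Input.Admissible.one_lt_k (hI : I.Admissible) : 1 < I.k := by
  rw [Input.k, Real.lt_log_iff_exp_lt (by linarith [hI.three_le_n])]
  exact Real.exp_one_lt_three.trans_le hI.three_le_n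

theorem Input.Admissible.ε₁_pos (hI : I.Admissible) : 0 < I.ε₁ := by
  have := hI.ε_pos
  unfold Input.ε₁; positivity

theorem Input.Admissible.ε₁_lt_one (hI : I.Admissible) : I.ε₁ < 1 := by
  have := hI.ε_pos
  rw [Input.ε₁, div_lt_one (by positivity)]
  linarith

theorem Input.Admissible.ε₅_pos (hI : I.Admissible) : 0 < I.ε₅ :=
  div_pos hI.ε₁_pos (by linarith [hI.one_lt_k])

/-- The balance of the constants. The tree covers lose a factor `2k - 1`; a further factor 2 is lost
by a detour in a block, or by the exchange argument for stored paths. A relative length `ε₅` thus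
turns into `ε₁`, which `Free` forbids. -/
theorem Input.Admissible.ε₅_mul (hI : I.Admissible) : (2 * I.k - 1) * (2 * I.ε₅) = I.ε₁ := by
  have := hI.one_lt_k
  have h : 4 * I.k - 2 ≠ 0 := by linarith
  rw [Input.ε₅, show (2 * I.k - 1) * (2 * (I.ε₁ / (4 * I.k - 2))) =
    I.ε₁ * ((4 * I.k - 2) / (4 * I.k - 2)) by ring, div_self h, mul_one]

theorem Input.Admissible.ε₅_lt_one (hI : I.Admissible) : I.ε₅ < 1 := by
  have := hI.ε₅_mul
  nlinarith [hI.one_lt_k, hI.ε₁_lt_one, hI.ε₅_pos]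

theorem Input.Admissible.one_le_nW (hI : I.Admissible) : 1 ≤ I.n * I.W := by
  nlinarith [hI.three_le_n, hI.one_le_W]

/-- Simple paths have length at most `nW`, so the bounds with exponent `B` are no restriction and
the blocks of exponents `0, …, B` exhaust half a path. -/
theorem Input.Admissible.nW_le_pow (hI : I.Admissible) : I.n * I.W ≤ (1 + I.ε₅) ^ I.B := by
  have h1 : 1 < 1 + I.ε₅ := by linarith [hI.ε₅_pos]
  rw [← Real.rpow_natCast, ← Real.logb_le_iff_le_rpow h1 (by linarith [hI.one_le_nW])]
  exact Nat.le_ceil _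

theorem Input.Admissible.wlen_le (hI : I.Admissible) {a b : V} {p : I.G.Walk a b}
    (hp : p.IsPath) : wlen I.w p ≤ I.n * I.W := by
  refine (wlen_le_length_mul (fun e he => (hI.weight_mem e he).2) p).trans ?_
  have : (p.length : ℝ) ≤ I.n := Nat.cast_le.2 hp.length_lt.le
  exact mul_le_mul_of_nonneg_right this (by linarith [hI.one_le_W])

variable (O : Oracle I) (a : List ℕ)

theorem chain_eq_cons : ∃ L, O.chain a = Finset.univ :: L := by
  cases a <;> exact ⟨_, rfl⟩

theorem one_le_length_chain : 1 ≤ (O.chain a).length := by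
  obtain ⟨L, hL⟩ := chain_eq_cons O a
  simp [hL]

theorem nth_chain_one : nth (O.chain a) 1 = Finset.univ := by
  obtain ⟨L, hL⟩ := chain_eq_cons O a
  simp [hL, nth]

theorem one_le_level (x : V) : 1 ≤ level (O.chain a) x :=
  le_level le_rfl (by rw [nth_chain_one]; exact Finset.mem_univ x)

theorem mem_nth_level (x : V) : x ∈ nth (O.chain a) (level (O.chain a) x) := by
  classical
  have hne : ((Finset.Icc 1 (O.chain a).length).filter fun i => x ∈ nth (O.chain a) i).Nonempty :=
    ⟨1, Finset.mem_filter.2 ⟨Finset.mem_Icc.2 ⟨le_rfl, one_le_length_chain O a⟩, by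
      rw [nth_chain_one]; exact Finset.mem_univ x⟩⟩
  obtain ⟨i, hi, he⟩ := Finset.exists_mem_eq_sup _ hne id
  have hl : level (O.chain a) x = i := by rw [level]; convert! he
  rw [hl]
  exact (Finset.mem_filter.1 hi).2

end Parameters

/-! ### Query vertices near a failed vertex -/

section Near

theorem exists_first_hit {V : Type u} {G : SimpleGraph V} {D : Finset V} {a b : V}
    (p : G.Walk a b) (ha : a ∉ D) (h : ∃ x ∈ p.support, x ∈ D) :
    ∃ j < p.length, p.getVert (j + 1) ∈ D ∧ ∀ l ≤ j, p.getVert l ∉ D := by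
  classical
  have h' : ∃ l, l ≤ p.length ∧ p.getVert l ∈ D := by
    obtain ⟨x, hx, hD⟩ := h
    obtain ⟨l, hl, rfl⟩ := (mem_support_iff_getVert p).1 hx
    exact ⟨l, hl, hD⟩
  obtain ⟨h1, h2⟩ := Nat.find_spec h'
  have h0 : Nat.find h' ≠ 0 := by
    intro h0
    rw [h0] at h2
    exact ha (by simpa using h2)
  obtain ⟨j, hj⟩ := Nat.exists_eq_succ_of_ne_zero h0
  refine ⟨j, by omega, by rwa [hj] at h2, fun l hl hD => ?_⟩
  exact Nat.find_min h' (m := l) (by omega) ⟨by omega, hD⟩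

variable {V : Type u} [Fintype V] {I : Input V}

/-- A failed vertex that can be reached from `q` without exceeding the level of `q` yields a query
vertex close to `q`. -/
theorem exists_near_of_inside (hI : I.Admissible) (O : Oracle I) (a : List ℕ) {D Q : Finset V}
    (hQ : ∀ f ∈ D, ∀ z ∉ D, O.IsNear a f z → z ∈ Q) {q f : V} (hq : q ∉ D) (hf : f ∈ D)
    (p : I.G.Walk q f) (hp : Inside (upTo (O.chain a) (level (O.chain a) q)) p) :
    ∃ z ∈ Q, ∃ g : I.G.Walk q z, Inside {x | x ∉ D} g ∧
      wlen I.w g ≤ (2 * I.k - 1) * wlen I.w p := by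
  classical
  have hw := hI.one_le_weight
  set i := level (O.chain a) q with hi
  have hdisj : Disjoint (nth (O.chain a) (i + 1)) (O.roots a i) := by
    rw [Oracle.roots]
    exact Finset.disjoint_sdiff
  -- Membership in `U_{i+1}` would force level at least `i + 1`. For `i` equal to the length of the
  -- chain, `U_{i+1}` is the default value `∅`.
  have hout : ∀ x ∈ p.support, x ∉ nth (O.chain a) (i + 1) := by
    intro x hx hx'
    have h1 : level (O.chain a) x ≤ i := hp x hx
    have h2 := le_level (by omega) hx'
    omega
  have hqS : q ∈ O.roots a i := by
    rw [Oracle.roots, Finset.mem_sdiff]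
    exact ⟨mem_nth_level O a q, hout q p.start_mem_support⟩
  obtain ⟨hT, hst, -⟩ := O.cov_spec _ _ hdisj
  have hdle := distIn_le (w := I.w) (S := {x | x ∉ nth (O.chain a) (i + 1)}) p hout
  obtain ⟨r, hr, hqT, hfT, hsum⟩ := hst q hqS f (hout f p.end_mem_support)
    (hdle.trans_lt ENNReal.ofReal_lt_top).ne
  obtain ⟨hrT, -, -⟩ := hT r hr
  change q ∈ (O.tree a i r).verts at hqT
  change f ∈ (O.tree a i r).verts at hfT
  change r ∈ (O.tree a i r).verts at hrT
  change distIn (O.tree a i r).spanningCoe I.w Set.univ r q +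
    distIn (O.tree a i r).spanningCoe I.w Set.univ r f ≤ _ at hsum
  set T := O.tree a i r with hTdef
  have hTle : T.spanningCoe ≤ I.G := T.spanningCoe_le
  have hwT : ∀ e ∈ T.spanningCoe.edgeSet, 1 ≤ I.w e := fun e he =>
    hw e (SimpleGraph.edgeSet_mono hTle he)
  have hk := hI.one_lt_k
  replace hsum := hsum.trans (mul_le_mul_right hdle _)
  rw [← ENNReal.ofReal_mul (by linarith)] at hsum
  have hfin := hsum.trans_lt ENNReal.ofReal_lt_top
  obtain ⟨A, hA⟩ := exists_shortest_of_distIn_ne_top hwT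
    (le_self_add.trans_lt hfin).ne
  obtain ⟨B, hB⟩ := exists_shortest_of_distIn_ne_top hwT
    (le_add_self.trans_lt hfin).ne
  rw [distIn_eq hA, distIn_eq hB, ← ENNReal.ofReal_add (wlen_nonneg hwT A) (wlen_nonneg hwT B),
    ENNReal.ofReal_le_ofReal_iff (mul_nonneg (by linarith) (wlen_nonneg hw p))] at hsum
  have hmap : ∀ {x y : V} (g : T.spanningCoe.Walk x y),
      wlen I.w (g.mapLe hTle) = wlen I.w g := by
    intro x y g
    rw [wlen, wlen, SimpleGraph.Walk.edges_mapLe_eq_edges]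
  have hi1 : 1 ≤ i := one_le_level O a q
  have hi2 : i ≤ (O.chain a).length := level_le_length _ q
  have hA' := wlen_reverse (w := I.w) A
  -- The failure may be met while climbing from `q` to the root. The vertex before it is then its
  -- child, and a trunk vertex because `q` and `r` are both sources.
  by_cases hhit : ∃ x ∈ A.reverse.support, x ∈ D
  · obtain ⟨j, hj, hjD, hjn⟩ := exists_first_hit A.reverse hq hhit
    have hadj : T.Adj (A.reverse.getVert j) (A.reverse.getVert (j + 1)) := by
      simpa using A.reverse.adj_getVert_succ hj
    obtain ⟨g, hg, -, -, hgs⟩ := exists_between (w := I.w) A.reverse (Nat.zero_le j) hj.le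
    refine ⟨A.reverse.getVert j, hQ _ hjD _ (hjn j le_rfl) ⟨i, hi1, hi2, r, hr, hadj.snd_mem,
      Or.inr ⟨⟨hadj.symm, A.reverse.drop j, hA.1.reverse.drop j, ?_⟩, q, hqS, r, hr, hqT, hrT,
        A.reverse, hA.1.reverse, A.reverse.getVert_mem_support j⟩⟩,
      (g.mapLe hTle).copy (by simp) rfl, ?_, ?_⟩
    · rw [SimpleGraph.Walk.mem_support_iff_exists_getVert]
      exact ⟨1, by simp [SimpleGraph.Walk.drop_getVert], by simp at hj ⊢; omega⟩
    · intro x hx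
      rw [SimpleGraph.Walk.support_copy, SimpleGraph.Walk.support_mapLe_eq_support] at hx
      obtain ⟨l, -, hl, rfl⟩ := hgs x hx
      exact hjn l hl
    · rw [wlen_copy, hmap, hg, pos_zero, sub_zero]
      have := pos_le_wlen hwT A.reverse j
      linarith [wlen_nonneg hwT B]
  -- Otherwise the climb is free of failures, and on the way down from `r` to `f` the vertex before
  -- the first failure is its parent.
  · push Not at hhit
    have hrD : r ∉ D := hhit r (by simp)
    obtain ⟨j, hj, hjD, hjn⟩ := exists_first_hit B hrD ⟨f, B.end_mem_support, hf⟩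
    have hadj : T.Adj (B.getVert j) (B.getVert (j + 1)) := by
      simpa using B.adj_getVert_succ hj
    obtain ⟨g, hg, -, -, hgs⟩ := exists_between (w := I.w) B (Nat.zero_le j) hj.le
    refine ⟨B.getVert j, hQ _ hjD _ (hjn j le_rfl) ⟨i, hi1, hi2, r, hr, hadj.snd_mem,
      Or.inl ⟨hadj, (B.take (j + 1)).reverse, (hB.1.take (j + 1)).reverse, ?_⟩⟩,
      (A.reverse.mapLe hTle).append ((g.mapLe hTle).copy (by simp) rfl), ?_, ?_⟩
    · rw [SimpleGraph.Walk.support_reverse, List.mem_reverse,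
        SimpleGraph.Walk.mem_support_iff_exists_getVert]
      exact ⟨j, by simp, by simp; omega⟩
    · refine Inside.append ?_ ?_
      · intro x hx
        rw [SimpleGraph.Walk.support_mapLe_eq_support] at hx
        exact hhit x hx
      · intro x hx
        rw [SimpleGraph.Walk.support_copy, SimpleGraph.Walk.support_mapLe_eq_support] at hx
        obtain ⟨l, -, hl, rfl⟩ := hgs x hx
        exact hjn l hl
    · rw [wlen_append, wlen_copy, hmap, hmap, hg, pos_zero, sub_zero, hA']
      have := pos_le_wlen hwT B j
      linarith

/-- A walk from `q` that meets a failed vertex, and only failed vertices of level at most that of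
`q`, yields a query vertex close to `q`. -/
theorem exists_near (hI : I.Admissible) (O : Oracle I) (a : List ℕ) {D Q : Finset V}
    (hQ : ∀ f ∈ D, ∀ z ∉ D, O.IsNear a f z → z ∈ Q) {q f : V} (hq : q ∉ D) (hf : f ∈ D)
    (p : I.G.Walk q f)
    (hp : ∀ x ∈ p.support, x ∈ D → level (O.chain a) x ≤ level (O.chain a) q) :
    ∃ z ∈ Q, ∃ g : I.G.Walk q z, Inside {x | x ∉ D} g ∧
      wlen I.w g ≤ (2 * I.k - 1) * wlen I.w p := by
  classical
  have hw := hI.one_le_weight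
  obtain ⟨j, hj, hjD, hjn⟩ := exists_first_hit p hq ⟨f, p.end_mem_support, hf⟩
  -- Unfailed vertices on the walk may exceed the level of `q`. Restarting from one of highest level
  -- before the failure removes them, and the part walked until then costs a factor 1 only, which is
  -- below `2k - 1`.
  obtain ⟨l, hl, hmax⟩ := Finset.exists_max_image (Finset.range (j + 1))
    (fun l => level (O.chain a) (p.getVert l)) ⟨0, by simp⟩
  rw [Finset.mem_range] at hl
  obtain ⟨g₁, hg₁, -, -, hs₁⟩ := exists_between (w := I.w) p (Nat.zero_le l) (by omega)
  obtain ⟨g₂, hg₂, -, -, hs₂⟩ := exists_between (w := I.w) p (i := l) (j := j + 1) (by omega) hj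
  obtain ⟨z, hz, g, hg, hgw⟩ := exists_near_of_inside hI O a hQ (hjn l (by omega)) hjD g₂ (by
    intro x hx
    obtain ⟨l', h1, h2, rfl⟩ := hs₂ x hx
    rcases Nat.lt_or_ge l' (j + 1) with h3 | h3
    · exact hmax l' (by simpa using h3)
    · obtain rfl : l' = j + 1 := by omega
      have h0 := hmax 0 (by simp)
      simp only [SimpleGraph.Walk.getVert_zero] at h0
      exact (hp _ (p.getVert_mem_support _) hjD).trans h0)
  refine ⟨z, hz, (g₁.copy (by simp) rfl).append g, Inside.append ?_ hg, ?_⟩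
  · intro x hx
    rw [SimpleGraph.Walk.support_copy] at hx
    obtain ⟨l', -, h2, rfl⟩ := hs₁ x hx
    exact hjn l' (by omega)
  · rw [wlen_append, wlen_copy, hg₁, pos_zero, sub_zero]
    have h1 := pos_le_wlen hw p (j + 1)
    have h2 := pos_nonneg hw p l
    have hk := hI.one_lt_k
    rw [hg₂] at hgw
    nlinarith

end Near

end VSDO

namespace VSDO

/-! ### Paths far from the query vertices are bipaths -/

section Canonical

variable {V : Type u} [Fintype V] {I : Input V}

/-- No query vertex is close to an interior vertex of `p`. -/
def Free (I : Input V) (D Q : Finset V) {x y : V} (p : I.G.Walk x y) : Prop :=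
  ∀ j, 0 < j → j < p.length → ∀ z ∈ Q, ∀ g : I.G.Walk (p.getVert j) z, Inside {x | x ∉ D} g →
    I.ε₁ * min (pos I.w p j) (wlen I.w p - pos I.w p j) < wlen I.w g

theorem exists_shortBetween_self (hI : I.Admissible) (O : Oracle I) (a : List ℕ) {x y : V}
    (p : I.G.Walk x y) (i : ℕ) :
    ∃ e, (1 ≤ e ∧ e ≤ (O.chain a).length) ∧ ShortBetween I.w (upTo (O.chain a) e) p i i :=
  ⟨_, ⟨one_le_level O a _, level_le_length _ _⟩,
    ShortBetween.refl hI.one_le_weight (show level _ (p.getVert i) ≤ _ from le_rfl)⟩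

/-- Take `e` to be the highest level on the block, attained at position `l`. A shorter connection
inside `G_e` must meet a failed vertex, as the block is shortest in `G - D`. Going from position `l`
back to `s` and along the shortcut reaches that vertex within twice the length of the block, so a
query vertex lies within `(2k - 1) · 2ε₅ = ε₁` times the distance to the nearer end, against `Free`.
-/
theorem Free.exists_shortBetween (hI : I.Admissible) (O : Oracle I) (a : List ℕ)
    {D Q : Finset V} (hQ : ∀ f ∈ D, ∀ z ∉ D, O.IsNear a f z → z ∈ Q) {x y : V}
    {p : I.G.Walk x y} (hfree : Free I D Q p) {s t : ℕ} (hst : s ≤ t) (hs : 0 < s)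
    (ht : t < p.length) (hsh : ShortBetween I.w {x | x ∉ D} p s t)
    (hle : pos I.w p t - pos I.w p s ≤
      I.ε₅ * min (pos I.w p s) (wlen I.w p - pos I.w p t)) :
    ∃ e, (1 ≤ e ∧ e ≤ (O.chain a).length) ∧ ShortBetween I.w (upTo (O.chain a) e) p s t := by
  have hw := hI.one_le_weight
  obtain ⟨l, hl, hmax⟩ := Finset.exists_max_image (Finset.Icc s t)
    (fun l => level (O.chain a) (p.getVert l)) ⟨s, by simp [hst]⟩
  rw [Finset.mem_Icc] at hl
  refine ⟨_, ⟨one_le_level O a (p.getVert l), level_le_length _ _⟩,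
    fun l' h1 h2 => hmax l' (Finset.mem_Icc.2 ⟨h1, h2⟩), fun g hg => ?_⟩
  by_contra hlt
  push Not at hlt
  have hhit : ∃ f ∈ g.support, f ∈ D := by
    by_contra hc
    push Not at hc
    exact absurd (hsh.2 g hc) (not_le.2 hlt)
  obtain ⟨f, hf, hfD⟩ := hhit
  obtain ⟨j, hj, rfl⟩ := (mem_support_iff_getVert g).1 hf
  obtain ⟨g₁, hg₁, -, -, hs₁⟩ := exists_between (w := I.w) p hl.1 (by omega)
  obtain ⟨z, hz, g₂, hg₂, hw₂⟩ := exists_near_of_inside hI O a hQ (hsh.1 l hl.1 hl.2) hfD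
    (g₁.reverse.append (g.take j)) (by
      refine Inside.append (Inside.reverse ?_) ?_
      · intro v hv
        obtain ⟨l', h1, h2, rfl⟩ := hs₁ v hv
        exact hmax l' (Finset.mem_Icc.2 ⟨h1, by omega⟩)
      · intro v hv
        refine hg v ?_
        rw [mem_support_iff_getVert] at hv ⊢
        obtain ⟨l', h1, rfl⟩ := hv
        exact ⟨min j l', by simp at h1; omega, by simp⟩)
  have hfr := hfree l (by omega) (by omega) z hz g₂ hg₂
  rw [wlen_append, wlen_reverse, hg₁] at hw₂
  have h1 : wlen I.w (g.take j) ≤ wlen I.w g := pos_le_wlen hw g j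
  have h2 := pos_mono hw p hl.1
  have h3 := pos_mono hw p hl.2
  have h4 : min (pos I.w p s) (wlen I.w p - pos I.w p t) ≤
      min (pos I.w p l) (wlen I.w p - pos I.w p l) := min_le_min h2 (by linarith)
  have hk := hI.one_lt_k
  have h5 : wlen I.w g₂ ≤ (2 * I.k - 1) * (2 * (pos I.w p t - pos I.w p s)) :=
    hw₂.trans (mul_le_mul_of_nonneg_left (by linarith) (by linarith))
  have h6 : (2 * I.k - 1) * (2 * (pos I.w p t - pos I.w p s)) ≤
      (2 * I.k - 1) * (2 * (I.ε₅ * min (pos I.w p s) (wlen I.w p - pos I.w p t))) :=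
    mul_le_mul_of_nonneg_left (by linarith) (by linarith)
  have h7 := hI.ε₅_mul
  have h8 := mul_le_mul_of_nonneg_left h4 hI.ε₁_pos.le
  rw [← h7] at h8 hfr
  nlinarith

open scoped Classical in
/-- The last position in the first half of `p` at distance at most `(1 + ε₅)^k` from the start. -/
noncomputable def lastPos (I : Input V) {x y : V} (p : I.G.Walk x y) (k : ℕ) : ℕ :=
  Nat.findGreatest (fun j => pos I.w p j ≤ (1 + I.ε₅) ^ k ∧ pos I.w p j ≤ wlen I.w p / 2) p.length

/-- The first position of the `k`-th block of `p`. -/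
noncomputable def blockStart (I : Input V) {x y : V} (p : I.G.Walk x y) (k : ℕ) : ℕ :=
  if k = 0 then lastPos I p 0 else min (lastPos I p k) (lastPos I p (k - 1) + 1)

section

variable {x y : V} (p : I.G.Walk x y)

theorem lastPos_le (k : ℕ) : lastPos I p k ≤ p.length := Nat.findGreatest_le _

theorem le_lastPos {k j : ℕ} (hj : j ≤ p.length) (h1 : pos I.w p j ≤ (1 + I.ε₅) ^ k)
    (h2 : pos I.w p j ≤ wlen I.w p / 2) : j ≤ lastPos I p k :=
  Nat.le_findGreatest hj ⟨h1, h2⟩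

theorem pos_lastPos (hI : I.Admissible) (k : ℕ) :
    pos I.w p (lastPos I p k) ≤ (1 + I.ε₅) ^ k ∧ pos I.w p (lastPos I p k) ≤ wlen I.w p / 2 := by
  classical
  refine Nat.findGreatest_spec
    (P := fun j => pos I.w p j ≤ (1 + I.ε₅) ^ k ∧ pos I.w p j ≤ wlen I.w p / 2)
    (Nat.zero_le p.length) ?_
  rw [pos_zero]
  have := hI.ε₅_pos
  exact ⟨by positivity, div_nonneg (wlen_nonneg hI.one_le_weight p) (by norm_num)⟩

theorem lastPos_mono (hI : I.Admissible) {k l : ℕ} (hkl : k ≤ l) :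
    lastPos I p k ≤ lastPos I p l := by
  obtain ⟨h1, h2⟩ := pos_lastPos p hI k
  refine le_lastPos p (lastPos_le p k) (h1.trans ?_) h2
  exact pow_le_pow_right₀ (by linarith [hI.ε₅_pos]) hkl

theorem lastPos_zero_le (hI : I.Admissible) : lastPos I p 0 ≤ 1 := by
  have h1 := (pos_lastPos p hI 0).1
  have h2 := sub_le_pos_sub hI.one_le_weight p (Nat.zero_le _) (lastPos_le p 0)
  rw [pos_zero] at h2
  have : ((lastPos I p 0 : ℕ) : ℝ) ≤ 1 := by
    rw [pow_zero] at h1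
    push_cast at h2
    linarith
  exact_mod_cast this

theorem lastPos_lt (hI : I.Admissible) (hp : 0 < p.length) (k : ℕ) :
    lastPos I p k < p.length := by
  refine lt_of_le_of_ne (lastPos_le p k) fun h => ?_
  have h1 := (pos_lastPos p hI k).2
  rw [h, pos_length] at h1
  have h2 := length_le_wlen hI.one_le_weight p
  have : (1 : ℝ) ≤ p.length := by exact_mod_cast hp
  linarith

theorem blockStart_le (k : ℕ) : blockStart I p k ≤ lastPos I p k := by
  unfold blockStart
  split_ifs with h
  · rw [h]
  · exact min_le_left _ _

/-- A block with more than one vertex starts after the last position of the previous exponent, so at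
distance greater than `(1 + ε₅)^(k-1)` from the start, and ends at distance at most `(1 + ε₅)^k`.
The difference is at most `ε₅` times the former; since the block ends in the first half, the other
endpoint is no nearer. -/
theorem blockStart_spec (hI : I.Admissible) (hp : 0 < p.length) (k : ℕ) :
    blockStart I p k = lastPos I p k ∨
      (0 < blockStart I p k ∧ lastPos I p k < p.length ∧
        pos I.w p (lastPos I p k) - pos I.w p (blockStart I p k) ≤
        I.ε₅ * min (pos I.w p (blockStart I p k)) (wlen I.w p - pos I.w p (lastPos I p k))) := by
  rcases (blockStart_le p k).eq_or_lt with h | h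
  · exact Or.inl h
  · right
    have hk : k ≠ 0 := by
      rintro rfl
      simp [blockStart] at h
    obtain ⟨k, rfl⟩ := Nat.exists_eq_add_one_of_ne_zero hk
    have hb : blockStart I p (k + 1) = lastPos I p k + 1 := by
      simp only [blockStart] at h ⊢
      simp at h ⊢
      omega
    have hε := hI.ε₅_pos
    obtain ⟨h1, h2⟩ := pos_lastPos p hI (k + 1)
    have h3 := pos_mono hI.one_le_weight p h.le
    have h4 : (1 + I.ε₅) ^ k < pos I.w p (blockStart I p (k + 1)) := by
      by_contra hc
      push Not at hc
      have := le_lastPos p (h.le.trans (lastPos_le p _)) hc (h3.trans h2)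
      omega
    have h5 : pos I.w p (lastPos I p (k + 1)) - pos I.w p (blockStart I p (k + 1)) ≤
        I.ε₅ * (1 + I.ε₅) ^ k := by
      rw [pow_succ] at h1
      linarith
    refine ⟨by omega, lastPos_lt p hI hp _, h5.trans (mul_le_mul_of_nonneg_left ?_ hε.le)⟩
    exact le_min h4.le (by linarith)

end

/-- A bipath whose pieces are as long as the bounds on the first and on the second half allow. -/
structure CanonBip (I : Input V) (L : List (Finset V)) {x y : V} (p : I.G.Walk x y)
    (s m t : ℕ → ℕ) : Prop extends Bip I L p s m t where
  canon₁ : ∀ k ≤ I.B, ∀ j ≤ p.length, pos I.w p j ≤ (1 + I.ε₅) ^ k →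
    pos I.w p j ≤ wlen I.w p / 2 → j ≤ t k
  canon₂ : ∀ k ≤ 2 * I.B + 1, I.B + 1 ≤ k → ∀ j ≤ p.length,
    wlen I.w p - pos I.w p j ≤ (1 + I.ε₅) ^ (2 * I.B + 1 - k) →
    wlen I.w p - pos I.w p j ≤ wlen I.w p / 2 → s k ≤ j

theorem CanonBip.reverse {L : List (Finset V)} {x y : V} {p : I.G.Walk x y} {s m t : ℕ → ℕ}
    (h : CanonBip I L p s m t) : CanonBip I L p.reverse (fun k => p.length - t (2 * I.B + 1 - k))
      (fun k => p.length - m (2 * I.B + 1 - k)) (fun k => p.length - s (2 * I.B + 1 - k)) := by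
  refine ⟨h.toBip.reverse, fun k hk j hj h1 h2 => ?_, fun k hk hB j hj h1 h2 => ?_⟩
  · rw [SimpleGraph.Walk.length_reverse] at hj
    rw [pos_reverse p hj] at h1 h2
    rw [wlen_reverse] at h2
    have := h.canon₂ (2 * I.B + 1 - k) (by omega) (by omega) (p.length - j) (by omega)
      (by rwa [show 2 * I.B + 1 - (2 * I.B + 1 - k) = k by omega]) h2
    omega
  · rw [SimpleGraph.Walk.length_reverse] at hj
    rw [pos_reverse p hj, wlen_reverse, sub_sub_cancel] at h1 h2
    have := h.canon₁ (2 * I.B + 1 - k) (by omega) (p.length - j) (by omega) h1 h2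
    omega

/-- A path avoiding `D` that is far from the query vertices and consists of two shortest paths of
`G - D` is a bipath. -/
theorem Free.exists_canonBip (hI : I.Admissible) (O : Oracle I) (a : List ℕ)
    {D Q : Finset V} (hQ : ∀ f ∈ D, ∀ z ∉ D, O.IsNear a f z → z ∈ Q) {x y : V}
    {p : I.G.Walk x y} (hfree : Free I D Q p) (hp : p.IsPath) (hlen : 0 < p.length) {b : ℕ}
    (h1 : ShortBetween I.w {x | x ∉ D} p 0 b)
    (h2 : ShortBetween I.w {x | x ∉ D} p b p.length) (hb : b ≤ p.length) :
    ∃ s m t, CanonBip I (O.chain a) p s m t := by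
  have hw := hI.one_le_weight
  have hlr : 0 < p.reverse.length := by simpa
  have hrl := p.length_reverse
  -- Blocks `0, …, B` are measured from `x`; blocks `B+1, …, 2B+1` are the mirror images of the
  -- blocks of the reversed path.
  set s : ℕ → ℕ := fun k => if k ≤ I.B then blockStart I p k else
    p.length - lastPos I p.reverse (2 * I.B + 1 - k) with hs
  set t : ℕ → ℕ := fun k => if k ≤ I.B then lastPos I p k else
    p.length - blockStart I p.reverse (2 * I.B + 1 - k) with ht
  have hlast : ∀ k, lastPos I p.reverse k ≤ p.length := fun k => by
    simpa using lastPos_le p.reverse k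
  have hbs : ∀ k, blockStart I p.reverse k ≤ p.length := fun k =>
    (blockStart_le p.reverse k).trans (hlast k)
  have hst : ∀ k, s k ≤ t k := by
    intro k
    simp only [hs, ht]
    split_ifs
    · exact blockStart_le p k
    · have := blockStart_le p.reverse (2 * I.B + 1 - k)
      omega
  have htl : ∀ k, t k ≤ p.length := by
    intro k
    simp only [ht]
    split_ifs
    · exact lastPos_le p k
    · omega
  have hblock : ∀ k, s k = t k ∨ (0 < s k ∧ t k < p.length ∧
      pos I.w p (t k) - pos I.w p (s k) ≤
        I.ε₅ * min (pos I.w p (s k)) (wlen I.w p - pos I.w p (t k))) := by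
    intro k
    simp only [hs, ht]
    split_ifs
    · exact blockStart_spec p hI hlen k
    · rcases blockStart_spec p.reverse hI hlr (2 * I.B + 1 - k) with h | ⟨h3, h4, h5⟩
      · left; rw [h]
      · right
        have e1 := pos_reverse (w := I.w) p (hbs (2 * I.B + 1 - k))
        have e2 := pos_reverse (w := I.w) p (hlast (2 * I.B + 1 - k))
        rw [e1, e2, wlen_reverse, sub_sub_cancel, min_comm, sub_sub_sub_cancel_left] at h5
        exact ⟨by omega, by have := hbs (2 * I.B + 1 - k); omega, h5⟩
  have hpiece : ∀ k i j, s k ≤ i → i ≤ j → j ≤ t k →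
      (i = j ∨ ShortBetween I.w {x | x ∉ D} p i j) →
      ∃ e, (1 ≤ e ∧ e ≤ (O.chain a).length) ∧ ShortBetween I.w (upTo (O.chain a) e) p i j := by
    intro k i j hi hij hj h
    by_cases hij' : i = j
    · subst hij'
      exact exists_shortBetween_self hI O a p i
    · obtain ⟨h3, h4, h5⟩ := (hblock k).resolve_left (by omega)
      refine hfree.exists_shortBetween hI O a hQ hij (by omega) (by omega) (h.resolve_left hij') ?_
      have m1 := pos_mono hw p hi
      have m2 := pos_mono hw p hj
      have : I.ε₅ * min (pos I.w p (s k)) (wlen I.w p - pos I.w p (t k)) ≤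
        I.ε₅ * min (pos I.w p i) (wlen I.w p - pos I.w p j) :=
        mul_le_mul_of_nonneg_left (min_le_min m1 (by linarith)) hI.ε₅_pos.le
      linarith
  have hΛ := hI.wlen_le hp
  -- As `(1 + ε₅)^B` exceeds the length of `p`, block `B` ends at the last position of the first
  -- half and block `B+1` starts at the first position of the second half. These are neighbours, or
  -- equal if a vertex sits exactly in the middle.
  have hmid : lastPos I p I.B ≤ p.length - lastPos I p.reverse I.B ∧
      p.length - lastPos I p.reverse I.B ≤ lastPos I p I.B + 1 := by
    have hpow := hI.nW_le_pow
    obtain ⟨-, q1⟩ := pos_lastPos p hI I.B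
    obtain ⟨-, q2⟩ := pos_lastPos p.reverse hI I.B
    have hlt := lastPos_lt p hI hlen I.B
    have hll := hlast I.B
    rw [pos_reverse p hll, wlen_reverse] at q2
    constructor
    · by_contra hc
      have := pos_strictMono hw p (not_le.1 hc) (lastPos_le p _)
      linarith
    · have h0 := wlen_nonneg hw p
      have q3 : wlen I.w p / 2 < pos I.w p (lastPos I p I.B + 1) := by
        by_contra hc
        have := le_lastPos p (k := I.B) (j := lastPos I p I.B + 1) hlt (by linarith) (by linarith)
        omega
      have := le_lastPos p.reverse (k := I.B) (j := p.length - (lastPos I p I.B + 1))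
        (by omega) (by
          rw [pos_reverse p (by omega), show p.length - (p.length - (lastPos I p I.B + 1)) =
            lastPos I p I.B + 1 by omega]
          linarith) (by
          rw [pos_reverse p (by omega), show p.length - (p.length - (lastPos I p I.B + 1)) =
            lastPos I p I.B + 1 by omega, wlen_reverse]
          linarith)
      omega
  -- The breakpoint of each block is `b` clamped into the block, so that each of its two parts lies
  -- in one of the two shortest paths that make up `p` or is a single vertex.
  refine ⟨s, fun k => max (s k) (min b (t k)), t,
    ⟨hp, ?_, fun k hk => ?_, ?_, fun k hk => ?_, fun k hk => ?_, fun k hk => ?_, fun k hk => ?_,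
      fun k hk hB => ?_⟩, fun k hk j hj q1 q2 => ?_, fun k hk hB j hj q1 q2 => ?_⟩
  · simp only [hs, Nat.zero_le, if_true]
    exact (blockStart_le p 0).trans (lastPos_zero_le p hI)
  · simp only [hs, ht]
    rcases lt_trichotomy k I.B with h | h | h
    · have := lastPos_mono p hI (Nat.le_add_right k 1)
      rw [if_pos (by omega), if_pos (by omega)]
      simp only [blockStart, Nat.add_sub_cancel]
      rw [if_neg (by omega)]
      omega
    · rw [h, if_pos le_rfl, if_neg (by omega), show 2 * I.B + 1 - (I.B + 1) = I.B by omega]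
      exact hmid
    · have := lastPos_mono p.reverse hI (Nat.le_add_right (2 * I.B + 1 - (k + 1)) 1)
      have := hlast (2 * I.B + 1 - (k + 1))
      have := hlast (2 * I.B + 1 - (k + 1) + 1)
      rw [if_neg (by omega), if_neg (by omega),
        show 2 * I.B + 1 - k = (2 * I.B + 1 - (k + 1)) + 1 by omega]
      simp only [blockStart, Nat.add_sub_cancel]
      rw [if_neg (by omega)]
      omega
  · simp only [ht]
    have := (blockStart_le p.reverse 0).trans (lastPos_zero_le p.reverse hI)
    rw [if_neg (by omega), Nat.sub_self]
    omega
  · have := hst k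
    have := htl k
    omega
  · have := hst k
    refine hpiece k _ _ le_rfl (by omega) (by omega) ?_
    rcases Nat.lt_or_ge (s k) (min b (t k)) with h | h
    · right
      exact h1.mono (Nat.zero_le _) (by omega) (by omega) hb
    · left; omega
  · have := hst k
    have := htl k
    refine hpiece k _ _ (by omega) (by omega) le_rfl ?_
    rcases Nat.lt_or_ge (max (s k) (min b (t k))) (t k) with h | h
    · right
      exact h2.mono (by omega) (by omega) (htl k) le_rfl
    · left; omega
  · simp only [ht, if_pos hk]
    exact (pos_lastPos p hI k).1
  · simp only [hs, if_neg (show ¬ k ≤ I.B by omega)]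
    have := (pos_lastPos p.reverse hI (2 * I.B + 1 - k)).1
    rwa [pos_reverse p (hlast _)] at this
  · simp only [ht, if_pos hk]
    exact le_lastPos p hj q1 q2
  · simp only [hs, if_neg (show ¬ k ≤ I.B by omega)]
    have := le_lastPos p.reverse (k := 2 * I.B + 1 - k) (j := p.length - j) (by omega)
      (by rwa [pos_reverse p (by omega), show p.length - (p.length - j) = j by omega])
      (by rwa [pos_reverse p (by omega), show p.length - (p.length - j) = j by omega,
            wlen_reverse])
    omega

end Canonical

end VSDO

namespace VSDO

/-! ### Exchanging the beginnings of two bipaths -/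

section Exchange

theorem pos_splice {V : Type u} {G : SimpleGraph V} {w : Sym2 V → ℝ} {x y x₁ y₁ x₂ y₂ : V}
    {p : G.Walk x y} {q : G.Walk x₁ y₁} {N : G.Walk x₂ y₂} {i j : ℕ}
    (hi : i ≤ p.length) (hj : j ≤ N.length) (hlen : N.length = j + (p.length - i))
    (hq : j ≤ q.length) (h1 : ∀ l ≤ j, N.getVert l = q.getVert l)
    (h2 : ∀ l, N.getVert (j + l) = p.getVert (i + l)) {l : ℕ} (hl : i + l ≤ p.length) :
    pos w N (j + l) = pos w q j + pos w p (i + l) - pos w p i := by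
  have e1 := pos_congr (w := w) N q hj hq h1
  have e2 := pos_sub_congr (w := w) N p (i := j) (j := i) (m := l) (by omega) hl
    fun l _ => h2 l
  linarith

variable {V : Type u} [Fintype V] {I : Input V}

/-- Consecutive pieces are at most one edge apart. The condition `1 ≤ i` covers the initial edge
`e_0`, after which piece 0 may start at position 1. -/
theorem Bip.start_le {L : List (Finset V)} {x y : V} {p : I.G.Walk x y} {s m t : ℕ → ℕ}
    (h : Bip I L p s m t) {i k : ℕ} (hi : 1 ≤ i) (hk : k ≤ 2 * I.B + 1)
    (hmin : ∀ l < k, t l < i) : s k ≤ i := by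
  rcases Nat.eq_zero_or_pos k with rfl | hk0
  · exact h.first.trans hi
  · have h1 := h.step (k - 1) (by omega)
    have h2 := hmin (k - 1) (by omega)
    rw [show k - 1 + 1 = k by omega] at h1
    omega

/-- If two bipaths share a vertex at which the second has completed earlier pieces only, then
following the second one up to that vertex and then the first one is again a bipath. -/
theorem Bip.splice (hI : I.Admissible) (O : Oracle I) (a : List ℕ) {x y : V}
    {p q N : I.G.Walk x y} {s m t s' m' t' : ℕ → ℕ} (hq : Bip I (O.chain a) q s m t)
    (hp : Bip I (O.chain a) p s' m' t') {i j k₁ k₂ : ℕ} (hi : i ≤ p.length) (hj : j ≤ q.length)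
    (hi1 : 1 ≤ i) (hj1 : 1 ≤ j)
    (hlen : N.length = j + (p.length - i)) (hv1 : ∀ l ≤ j, N.getVert l = q.getVert l)
    (hv2 : ∀ l, N.getVert (j + l) = p.getVert (i + l)) (hN : N.IsPath)
    (hpos : pos I.w q j ≤ pos I.w p i) (hk₁ : k₁ ≤ I.B) (hk : k₁ < k₂) (hk₂ : k₂ ≤ 2 * I.B + 1)
    (ht : j ≤ t k₁) (hmin : ∀ l < k₁, t l < j) (hmin' : ∀ l < k₂, t' l < i) :
    IsBipath I (O.chain a) N := by
  have hw := hI.one_le_weight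
  have hsj := hq.start_le hj1 (by omega) hmin
  have hsi := hp.start_le hi1 hk₂ hmin'
  have hps : ∀ l, i + l ≤ p.length →
      pos I.w N (j + l) = pos I.w q j + pos I.w p (i + l) - pos I.w p i :=
    fun l hl => pos_splice hi (by omega) hlen hj hv1 hv2 hl
  have hpq : ∀ l ≤ j, pos I.w N l = pos I.w q l :=
    fun l hl => pos_congr N q (by omega) (by omega) fun l' hl' => hv1 l' (by omega)
  have hwN : wlen I.w N = pos I.w q j + wlen I.w p - pos I.w p i := by
    have := hps (p.length - i) (by omega)
    rwa [← hlen, pos_length, show i + (p.length - i) = p.length by omega, pos_length] at this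
  have hs_le : ∀ k ≤ k₁, s k ≤ j := by
    intro k hk'
    rcases hk'.eq_or_lt with rfl | hlt
    · exact hsj
    · have := hmin k hlt
      have := hq.le k (by omega)
      omega
  have hs'_le : ∀ k ≤ k₂, s' k ≤ i := by
    intro k hk'
    rcases hk'.eq_or_lt with rfl | hlt
    · exact hsi
    · have := hmin' k hlt
      have := hp.le k (by omega)
      omega
  have hlow : ∀ c d e, (1 ≤ e ∧ e ≤ (O.chain a).length) → c ≤ min d j → d ≤ q.length →
      ShortBetween I.w (upTo (O.chain a) e) q c d →
      ShortBetween I.w (upTo (O.chain a) e) N c (min d j) := by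
    intro c d e he hcd hd hsh
    exact (hsh.mono le_rfl hcd (by omega) hd).congr hcd (by omega) (by omega) rfl
      fun l hl => (hv1 _ (by omega)).symm
  have hhigh : ∀ c d, c ≤ d → d ≤ p.length →
      (∃ e, (1 ≤ e ∧ e ≤ (O.chain a).length) ∧ ShortBetween I.w (upTo (O.chain a) e) p c d) →
      ∃ e, (1 ≤ e ∧ e ≤ (O.chain a).length) ∧
        ShortBetween I.w (upTo (O.chain a) e) N (j + (c - i)) (j + (d - i)) := by
    rintro c d hcd hd ⟨e, he, hsh⟩
    rcases Nat.lt_or_ge d i with hdi | hdi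
    · rw [show d - i = 0 by omega, show c - i = 0 by omega]
      exact exists_shortBetween_self hI O a N _
    · refine ⟨e, he, (hsh.mono (i' := max c i) (by omega) (by omega) le_rfl hd).congr (by omega)
        (by omega) (by omega) (by omega) fun l hl => ?_⟩
      have := hv2 (c - i + l)
      rw [show max c i + l = i + (c - i + l) by omega, ← this, add_assoc]
  -- Pieces up to `k₁` come from `q`, clipped at `j`. Later ones come from `p`, clipped at `i` and
  -- shifted; by truncated subtraction those of index strictly between `k₁` and `k₂` collapse to the
  -- splice vertex.
  refine isBipath_iff.2 ⟨fun k => if k ≤ k₁ then s k else j + (s' k - i),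
    fun k => if k ≤ k₁ then min (m k) j else j + (m' k - i),
    fun k => if k ≤ k₁ then min (t k) j else j + (t' k - i),
    hN, ?_, fun k hk => ?_, ?_, fun k hk => ?_, fun k hk => ?_, fun k hk => ?_, fun k hk => ?_,
    fun k hk hB => ?_⟩
  · simpa using hq.first
  · have h1 := hq.step k hk
    have h2 := hp.step k hk
    rcases lt_trichotomy k k₁ with h | h | h
    · have := hmin k h
      have := hs_le (k + 1) (by omega)
      simp only [if_pos h.le, if_pos (Nat.succ_le_of_lt h)]
      omega
    · have := hs'_le (k + 1) (by omega)
      subst h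
      simp only [le_refl, if_true, if_neg (show ¬ k + 1 ≤ k by omega)]
      omega
    · simp only [if_neg (show ¬ k ≤ k₁ by omega), if_neg (show ¬ k + 1 ≤ k₁ by omega)]
      omega
  · have := hp.last
    rw [if_neg (by omega)]
    omega
  · have h1 := hq.le k hk
    have h2 := hp.le k hk
    by_cases h : k ≤ k₁
    · have := hs_le k h
      simp only [if_pos h]
      omega
    · simp only [if_neg h]
      omega
  · have h1 := hq.le k hk
    have h2 := hp.le k hk
    by_cases h : k ≤ k₁
    · have := hs_le k h
      simp only [if_pos h]
      obtain ⟨e, he, hsh⟩ := hq.short₁ k hk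
      exact ⟨e, he, hlow _ _ e he (by omega) (by omega) hsh⟩
    · simp only [if_neg h]
      exact hhigh _ _ h2.1 (by omega) (hp.short₁ k hk)
  · have h1 := hq.le k hk
    have h2 := hp.le k hk
    by_cases h : k ≤ k₁
    · have := hs_le k h
      simp only [if_pos h]
      rcases Nat.lt_or_ge (m k) j with hmj | hmj
      · obtain ⟨e, he, hsh⟩ := hq.short₂ k hk
        refine ⟨e, he, ?_⟩
        rw [min_eq_left hmj.le]
        exact hlow _ _ e he (by omega) (by omega) hsh
      · rw [min_eq_right hmj, min_eq_right (by omega)]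
        exact exists_shortBetween_self hI O a N _
    · simp only [if_neg h]
      exact hhigh _ _ h2.2.1 (by omega) (hp.short₂ k hk)
  · have h1 := hp.le k (by omega)
    by_cases h : k ≤ k₁
    · simp only [if_pos h]
      rw [hpq _ (min_le_right _ _)]
      exact (pos_mono hw q (min_le_left _ _)).trans (hq.bound₁ k hk)
    · simp only [if_neg h]
      rw [hps _ (by omega)]
      -- A collapsed piece sits at the splice vertex, which obeys even the bound of piece `k₁`. The
      -- others have only moved towards the start, since `q` reaches the splice vertex no later than
      -- `p`. In the second half the distances to the end are inherited from `p`.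
      rcases Nat.lt_or_ge (t' k) i with hti | hti
      · rw [show t' k - i = 0 by omega, add_zero, add_sub_cancel_right]
        refine ((pos_mono hw q ht).trans (hq.bound₁ k₁ hk₁)).trans ?_
        exact pow_le_pow_right₀ (by linarith [hI.ε₅_pos]) (by omega)
      · rw [show i + (t' k - i) = t' k by omega]
        linarith [hp.bound₁ k hk]
  · have h1 := hp.le k (by omega)
    simp only [if_neg (show ¬ k ≤ k₁ by omega)]
    rw [hps _ (by omega), hwN]
    have := pos_mono hw p (show s' k ≤ i + (s' k - i) by omega)
    linarith [hp.bound₂ k hk hB]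

/-- A shortest bipath inside `S` reaches none of its vertices more than twice as late as a canonical
bipath inside `S` does. -/
theorem CanonBip.pos_le (hI : I.Admissible) (O : Oracle I) (a : List ℕ) {x y : V} {S : Set V}
    {p q : I.G.Walk x y} {s m t s' m' t' : ℕ → ℕ} (hq : CanonBip I (O.chain a) q s m t)
    (hqS : Inside S q) (hp : Bip I (O.chain a) p s' m' t') (hpS : Inside S p)
    (hshort : ∀ r : I.G.Walk x y, Inside S r → IsBipath I (O.chain a) r →
      wlen I.w p ≤ wlen I.w r) {i j : ℕ} (hi : i ≤ p.length) (hj : j ≤ q.length)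
    (h : p.getVert i = q.getVert j) : pos I.w p i ≤ 2 * pos I.w q j := by
  classical
  have hw := hI.one_le_weight
  by_contra hc
  push Not at hc
  -- Take the last offending vertex along `p`. If the rest of `p` met the beginning of `q` again,
  -- that meeting point would be a later offender; hence the splice is a simple path.
  obtain ⟨i₀, hi₀, hmax⟩ := Finset.exists_max_image
    ((Finset.range (p.length + 1)).filter fun i => ∃ j ≤ q.length, p.getVert i = q.getVert j ∧
      2 * pos I.w q j < pos I.w p i) id
    ⟨i, Finset.mem_filter.2 ⟨Finset.mem_range.2 (by omega), j, hj, h, hc⟩⟩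
  clear hi hj h hc
  obtain ⟨hi, j, hj, h, hc⟩ := Finset.mem_filter.1 hi₀
  clear hi₀ i
  rename' i₀ => i
  rw [Finset.mem_range, Nat.lt_succ_iff] at hi
  have hpq : wlen I.w p ≤ wlen I.w q := hshort q hqS (isBipath_iff.2 ⟨s, m, t, hq.toBip⟩)
  have hqj := pos_nonneg hw q j
  have hi1 : 1 ≤ i := by
    rcases Nat.eq_zero_or_pos i with rfl | h0
    · rw [pos_zero] at hc; linarith
    · exact h0
  have hj1 : 1 ≤ j := by
    rcases Nat.eq_zero_or_pos j with rfl | h0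
    · rw [SimpleGraph.Walk.getVert_zero] at h
      exact absurd (by rw [SimpleGraph.Walk.getVert_zero, h])
        ((isPath_iff_getVert p).1 hp.isPath 0 i hi1 hi)
    · exact h0
  have hpi := pos_le_wlen hw p i
  have hil : i < p.length := by
    refine lt_of_le_of_ne hi fun he => ?_
    have hjl : j = q.length := by
      by_contra hne
      rw [he, SimpleGraph.Walk.getVert_length] at h
      exact absurd (h.symm.trans q.getVert_length.symm)
        ((isPath_iff_getVert q).1 hq.isPath j q.length (by omega) le_rfl)
    rw [hjl, pos_length] at hc
    have := wlen_nonneg hw q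
    linarith
  obtain ⟨N, hlen, hv1, hv2⟩ := exists_splice q p (i := j) (j := i) hj h.symm
  have hN : N.IsPath := by
    rw [isPath_iff_getVert]
    intro l₁ l₂ hl hl₂ he
    rcases Nat.lt_or_ge j l₂ with h2 | h2
    · obtain ⟨e₂, rfl⟩ := Nat.exists_eq_add_of_le h2.le
      rw [hv2] at he
      rcases Nat.lt_or_ge l₁ j with h1 | h1
      · rw [hv1 _ h1.le] at he
        have := hmax (i + e₂) (Finset.mem_filter.2 ⟨Finset.mem_range.2 (by omega), l₁, by omega,
          he.symm, by
            have e1 := pos_mono hw q h1.le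
            have e2 := pos_mono hw p (Nat.le_add_right i e₂)
            linarith⟩)
        simp only [id] at this
        omega
      · obtain ⟨e₁, rfl⟩ := Nat.exists_eq_add_of_le h1
        rw [hv2] at he
        exact (isPath_iff_getVert p).1 hp.isPath _ _ (by omega) (by omega) he
    · rw [hv1 _ h2, hv1 _ (by omega)] at he
      exact (isPath_iff_getVert q).1 hq.isPath _ _ hl (by omega) he
  have hNS : Inside S N := by
    rw [inside_iff_getVert] at hqS hpS ⊢
    intro l hl
    rcases le_total l j with h1 | h1
    · rw [hv1 l h1]
      exact hqS l (by omega)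
    · obtain ⟨e, rfl⟩ := Nat.exists_eq_add_of_le h1
      rw [hv2]
      exact hpS _ (by omega)
  have hwN : wlen I.w N = pos I.w q j + wlen I.w p - pos I.w p i := by
    have := pos_splice (w := I.w) hi (by omega) hlen hj hv1 hv2 (l := p.length - i) (by omega)
    rwa [← hlen, pos_length, show i + (p.length - i) = p.length by omega, pos_length] at this
  -- Here `2 · pos q j < pos p i ≤ |p| ≤ |q|`, which places the vertex in the half of `q` where
  -- canonicity controls the pieces.
  have hhalf : pos I.w q j ≤ wlen I.w q / 2 := by linarith
  have hex : ∃ k, j ≤ t k := ⟨I.B, hq.canon₁ I.B le_rfl j hj (by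
    have := hI.wlen_le hq.isPath
    have := hI.nW_le_pow
    have := pos_le_wlen hw q j
    linarith) hhalf⟩
  have hex' : ∃ k, i ≤ t' k := ⟨2 * I.B + 1, by have := hp.last; omega⟩
  have hk1B : Nat.find hex ≤ I.B := Nat.find_min' hex (hq.canon₁ I.B le_rfl j hj (by
    have := hI.wlen_le hq.isPath
    have := hI.nW_le_pow
    have := pos_le_wlen hw q j
    linarith) hhalf)
  have hk2B : Nat.find hex' ≤ 2 * I.B + 1 :=
    Nat.find_min' hex' (by have := hp.last; omega)
  have hj1' : (1 : ℝ) ≤ pos I.w q j := by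
    have := sub_le_pos_sub hw q (Nat.zero_le j) hj
    rw [pos_zero] at this
    have : (1 : ℝ) ≤ j := by exact_mod_cast hj1
    push_cast at *
    linarith
  -- This is where the factor 2 enters. The position on `q` is less than half of `(1 + ε₅)^k₂`,
  -- hence at most `(1 + ε₅)^(k₂-1)` because `ε₅ < 1`, and canonicity puts the vertex into a piece
  -- of smaller index. The spliced bipath is then strictly shorter than `p`.
  have hk12 : Nat.find hex < Nat.find hex' := by
    rcases Nat.lt_or_ge I.B (Nat.find hex') with hB | hB
    · omega
    · have e1 := hp.bound₁ _ hB
      have e2 := pos_mono hw p (Nat.find_spec hex')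
      rcases Nat.eq_zero_or_pos (Nat.find hex') with h0 | h0
      · rw [h0, pow_zero] at e1
        rw [h0] at e2
        linarith
      · have e3 : (1 + I.ε₅) ^ Nat.find hex' = (1 + I.ε₅) ^ (Nat.find hex' - 1) * (1 + I.ε₅) := by
          rw [← pow_succ]; congr 1; omega
        have e4 : (0 : ℝ) < (1 + I.ε₅) ^ (Nat.find hex' - 1) :=
          pow_pos (by linarith [hI.ε₅_pos]) _
        have e5 : pos I.w q j ≤ (1 + I.ε₅) ^ (Nat.find hex' - 1) := by
          have := hI.ε₅_lt_one
          nlinarith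
        have := Nat.find_min' hex (hq.canon₁ (Nat.find hex' - 1) (by omega) j hj e5 hhalf)
        omega
  have hbip := Bip.splice hI O a hq.toBip hp hi hj hi1 hj1 hlen hv1 hv2 hN (by linarith) hk1B hk12
    hk2B (Nat.find_spec hex) (fun l hl => not_le.1 (Nat.find_min hex hl))
    (fun l hl => not_le.1 (Nat.find_min hex' hl))
  have := hshort N hNS hbip
  linarith

theorem CanonBip.pos_le' (hI : I.Admissible) (O : Oracle I) (a : List ℕ) {x y : V} {S : Set V}
    {p q : I.G.Walk x y} {s m t s' m' t' : ℕ → ℕ} (hq : CanonBip I (O.chain a) q s m t)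
    (hqS : Inside S q) (hp : Bip I (O.chain a) p s' m' t') (hpS : Inside S p)
    (hshort : ∀ r : I.G.Walk x y, Inside S r → IsBipath I (O.chain a) r →
      wlen I.w p ≤ wlen I.w r) {i j : ℕ} (hi : i ≤ p.length) (hj : j ≤ q.length)
    (h : p.getVert i = q.getVert j) :
    wlen I.w p - pos I.w p i ≤ 2 * (wlen I.w q - pos I.w q j) := by
  have := CanonBip.pos_le hI O a hq.reverse hqS.reverse hp.reverse hpS.reverse (fun r hr hb => by
    have := hshort r.reverse hr.reverse hb.reverse
    simpa only [wlen_reverse] using this) (i := p.length - i) (j := q.length - j)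
    (by simp) (by simp) (by
      rw [SimpleGraph.Walk.getVert_reverse, SimpleGraph.Walk.getVert_reverse,
        show p.length - (p.length - i) = i by omega, show q.length - (q.length - j) = j by omega]
      exact h)
  rwa [pos_reverse p (by omega), pos_reverse q (by omega),
    show p.length - (p.length - i) = i by omega, show q.length - (q.length - j) = j by omega] at this

end Exchange

end VSDO

namespace VSDO

/-! ### Correctness of the decision trees -/

section DecisionTrees

theorem abs_sub_le_of_floor_logb_eq {δ x y : ℝ} (hδ : 0 < δ) (hx : 0 < x) (hy : 0 < y)
    (h : ⌊Real.logb (1 + δ) x⌋ = ⌊Real.logb (1 + δ) y⌋) : |x - y| ≤ δ * y := by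
  have h1 : 1 < 1 + δ := by linarith
  have key : ∀ {x y : ℝ}, 0 < x → 0 < y → ⌊Real.logb (1 + δ) x⌋ = ⌊Real.logb (1 + δ) y⌋ →
      x ≤ (1 + δ) * y := by
    intro x y hx hy h
    rw [← Real.logb_le_logb h1 hx (by positivity), Real.logb_mul (by positivity) hy.ne',
      Real.logb_self_eq_one h1]
    have e1 := Int.lt_floor_add_one (Real.logb (1 + δ) x)
    have e2 := Int.floor_le (Real.logb (1 + δ) y)
    rw [h] at e1
    linarith
  have e1 := key hx hy h
  have e2 := key hy hx h.symm
  rw [abs_le]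
  constructor
  · rcases le_total x y with hxy | hxy
    · nlinarith
    · nlinarith
  · linarith

/-- Equal floors mean a ratio of at most `1 + δ` between the distances to one end, and the case
distinction in the definition makes this the nearer end for both vertices. -/
theorem SameSegment.abs_sub_le {V : Type u} {G : SimpleGraph V} {w : Sym2 V → ℝ}
    (hw : ∀ e ∈ G.edgeSet, 1 ≤ w e) {δ : ℝ} (hδ : 0 < δ) {x y : V} {p : G.Walk x y} {i j : ℕ}
    (h : SameSegment w δ p i j) :
    |pos w p i - pos w p j| ≤ δ * min (pos w p j) (wlen w p - pos w p j) := by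
  obtain ⟨⟨hi0, hil⟩, ⟨hj0, hjl⟩, h⟩ := h
  have d1 := pos_add_wlen_drop (w := w) p i
  have d2 := pos_add_wlen_drop (w := w) p j
  have p1 := pos_strictMono hw p hi0 hil.le
  have p2 := pos_strictMono hw p hj0 hjl.le
  have p3 := pos_strictMono hw p hil le_rfl
  have p4 := pos_strictMono hw p hjl le_rfl
  rw [pos_zero] at p1 p2
  rw [pos_length] at p3 p4
  rcases h with ⟨h1, h2, h3⟩ | ⟨h1, h2, h3⟩
  · change pos w p i ≤ _ at h1
    change pos w p j ≤ _ at h2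
    rw [min_eq_left (by linarith)]
    exact abs_sub_le_of_floor_logb_eq hδ p1 p2 h3
  · have := abs_sub_le_of_floor_logb_eq hδ (by linarith) (by linarith) h3
    rw [min_eq_right (by linarith), abs_sub_comm]
    rwa [show wlen w (p.drop i) - wlen w (p.drop j) = pos w p j - pos w p i by linarith,
      show wlen w (p.drop j) = wlen w p - pos w p j by linarith] at this

variable {V : Type u} [Fintype V] {I : Input V}

theorem mem_seg_self {G : SimpleGraph V} {w : Sym2 V → ℝ} {δ : ℝ} {x y : V} {p : G.Walk x y}
    {f : V} (hf : f ∈ p.support) (hx : f ≠ x) (hy : f ≠ y) : f ∈ seg w δ p f := by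
  classical
  obtain ⟨i, hi, rfl⟩ := (mem_support_iff_getVert p).1 hf
  have h0 : 0 < i := by
    rcases Nat.eq_zero_or_pos i with rfl | h
    · simp at hx
    · exact h
  have hl : i < p.length := lt_of_le_of_ne hi fun h => hy (by rw [h]; simp)
  refine Finset.mem_filter.2 ⟨Finset.mem_univ _, i, i, ⟨⟨h0, hl⟩, ⟨h0, hl⟩, ?_⟩, rfl, rfl⟩
  have := pos_add_wlen_drop (w := w) p i
  rw [pos] at this
  rcases le_or_gt (wlen w (p.take i)) (wlen w p / 2) with h | h
  · exact Or.inl ⟨h, h, rfl⟩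
  · exact Or.inr ⟨by linarith, by linarith, rfl⟩

variable (O : Oracle I) (a : List ℕ)

theorem pick_ne {x y : V} {D A : Finset V} (hx : x ∉ D) (hy : y ∉ D) {p : I.G.Walk x y}
    {code : List (Piece V)} (hs : O.stored a x y A = some (p, code))
    (hhit : ∃ f ∈ D, f ∈ p.support) : O.pick a x y D A ≠ x ∧ O.pick a x y D A ≠ y := by
  have h := (O.pick_spec a x y D A p code hs hhit).1
  exact ⟨fun e => hx (e ▸ h), fun e => hy (e ▸ h)⟩

/-- The picked vertex lies on a path avoiding `A`, so it is new, and it lies in its own segment and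
in `U_i` for its level `i`, so the child avoids it. The failed vertices already avoided together
with the remaining depth keep outnumbering `D`; at depth zero all of `D` is avoided. -/
theorem descend_avoids {x y : V} {D : Finset V} (hx : x ∉ D) (hy : y ∉ D) (t : ℕ)
    (A : Finset V) (ht : D.card ≤ {f : V | f ∈ D ∧ f ∈ A}.ncard + t) (p : I.G.Walk x y)
    (code : List (Piece V)) (hp : O.stored a x y (O.descend a x y D t A) = some (p, code)) :
    ∀ f ∈ D, f ∉ p.support := by
  classical
  induction t generalizing A with
  | zero =>
    intro f hf hfp
    have hsub : {f : V | f ∈ D ∧ f ∈ A} = (D : Set V) := by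
      refine Set.eq_of_subset_of_ncard_le (fun f hf => hf.1) ?_ (Finset.finite_toSet D)
      rw [Set.ncard_coe_finset]
      simpa using ht
    have hfA : f ∈ A := by
      have : f ∈ {f : V | f ∈ D ∧ f ∈ A} := by rw [hsub]; exact hf
      exact this.2
    exact (O.stored_some _ _ _ _ _ _ hp).2.1 f hfp hfA
  | succ t ih =>
    rw [Oracle.descend] at hp
    rcases hs : O.stored a x y A with _ | ⟨q, code'⟩
    · simp only [hs] at hp
      cases hp
    · simp only [hs] at hp
      by_cases hhit : ∃ f ∈ D, f ∈ q.support
      · rw [if_pos hhit] at hp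
        refine ih _ ?_ hp
        have hpick := O.pick_spec a x y D A q code' hs hhit
        obtain ⟨hne, hne'⟩ := pick_ne O a hx hy hs hhit
        have hfA : O.pick a x y D A ∉ A := (O.stored_some _ _ _ _ _ _ hs).2.1 _ hpick.2.1
        have hfA' : O.pick a x y D A ∈ O.childAvoid a A (seg I.w I.ε₅ q (O.pick a x y D A))
            (level (O.chain a) (O.pick a x y D A)) :=
          Finset.mem_union_right _ (Finset.mem_inter.2
            ⟨mem_seg_self hpick.2.1 hne hne', mem_nth_level O a _⟩)
        have : {f : V | f ∈ D ∧ f ∈ A}.ncard < {f : V | f ∈ D ∧ f ∈ O.childAvoid a A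
            (seg I.w I.ε₅ q (O.pick a x y D A)) (level (O.chain a) (O.pick a x y D A))}.ncard := by
          refine Set.ncard_lt_ncard ?_ (Set.toFinite _)
          refine (Set.ssubset_iff_of_subset ?_).2 ⟨O.pick a x y D A, ⟨hpick.1, hfA'⟩,
            fun h => hfA h.2⟩
          exact fun f hf => ⟨hf.1, Finset.mem_union_left _ hf.2⟩
        omega
      · rw [if_neg hhit, hs] at hp
        obtain ⟨rfl, rfl⟩ : q = p ∧ code' = code := by simpa using hp
        push Not at hhit
        exact hhit

theorem finalNode_avoids {x y : V} {D : Finset V} (hx : x ∉ D) (hy : y ∉ D)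
    (hD : D.card ≤ I.d) (p : I.G.Walk x y)
    (code : List (Piece V)) (hp : O.stored a x y (O.finalNode a x y D) = some (p, code)) :
    ∀ f ∈ D, f ∉ p.support :=
  descend_avoids O a hx hy I.d ∅ (by omega) p code hp

theorem distIn_le_decTree {x y : V} {D : Finset V} (hx : x ∉ D) (hy : y ∉ D)
    (hD : D.card ≤ I.d) : distIn I.G I.w {z | z ∉ D} x y ≤ O.decTree a D x y := by
  rw [Oracle.decTree]
  rcases hs : O.stored a x y (O.finalNode a x y D) with _ | ⟨p, code⟩
  · exact le_top
  · have := finalNode_avoids O a hx hy hD p code hs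
    exact distIn_le p fun z hz hzD => this z hzD hz

/-- The child chosen by a query avoids no vertex of a canonical bipath far from the query
vertices. -/
theorem inside_childAvoid (hI : I.Admissible) {D Q : Finset V}
    (hQ : ∀ f ∈ D, ∀ z ∉ D, O.IsNear a f z → z ∈ Q) {x y : V}
    {q : I.G.Walk x y} (hfree : Free I D Q q) (hqD : Inside {z | z ∉ D} q) {s m t : ℕ → ℕ}
    (hq : CanonBip I (O.chain a) q s m t) {A : Finset V} (hqA : Inside {z | z ∉ A} q)
    {p : I.G.Walk x y} {code : List (Piece V)} (hs : O.stored a x y A = some (p, code))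
    (hhit : ∃ f ∈ D, f ∈ p.support) :
    Inside {z | z ∉ O.childAvoid a A (seg I.w I.ε₅ p (O.pick a x y D A))
      (level (O.chain a) (O.pick a x y D A))} q := by
  classical
  have hw := hI.one_le_weight
  intro v hv hvA
  rcases Finset.mem_union.1 hvA with h | h
  · exact hqA v hv h
  obtain ⟨hseg, hU⟩ := Finset.mem_inter.1 h
  obtain ⟨-, i, i', hss, hif, hiv⟩ := Finset.mem_filter.1 hseg
  obtain ⟨hfD, hfp, hfmax⟩ := O.pick_spec a x y D A p code hs hhit
  set f := O.pick a x y D A with hf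
  obtain ⟨hcode, hpA, hshort⟩ := O.stored_some a x y A p code hs
  obtain ⟨s', m', t', hbip⟩ := isBipath_iff.1 ⟨code, hcode⟩
  have hlev : level (O.chain a) f ≤ level (O.chain a) v := le_level (one_le_level O a f) hU
  have hclose := hss.abs_sub_le hw hI.ε₅_pos
  obtain ⟨⟨hi0, hil⟩, ⟨hi0', hil'⟩, -⟩ := hss
  have hvD : v ∉ D := hqD v hv
  obtain ⟨g, hgw, hgs⟩ : ∃ g : I.G.Walk v f, wlen I.w g = |pos I.w p i - pos I.w p i'| ∧
      ∀ z ∈ g.support, z ∈ p.support := by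
    rcases le_total i i' with hii | hii
    · obtain ⟨g, hg, -, -, hgs⟩ := exists_between (w := I.w) p hii hil'.le
      refine ⟨(g.copy hif hiv).reverse, ?_, ?_⟩
      · rw [wlen_reverse, wlen_copy, hg, abs_sub_comm,
          abs_of_nonneg (sub_nonneg.2 (pos_mono hw p hii))]
      · intro z hz
        obtain ⟨l, -, -, rfl⟩ := hgs z (by simpa using hz)
        exact p.getVert_mem_support l
    · obtain ⟨g, hg, -, -, hgs⟩ := exists_between (w := I.w) p hii hil.le
      refine ⟨g.copy hiv hif, ?_, ?_⟩
      · rw [wlen_copy, hg, abs_of_nonneg (sub_nonneg.2 (pos_mono hw p hii))]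
      · intro z hz
        obtain ⟨l, -, -, rfl⟩ := hgs z (by simpa using hz)
        exact p.getVert_mem_support l
  -- The failures on `g` lie on `p`, so their level is at most that of the picked `f`, while `v ∈
  -- U_{level f}` has at least that level. This is the reason for picking a failure of highest
  -- level.
  obtain ⟨z, hz, g', hg', hgw'⟩ := exists_near hI O a hQ hvD hfD g fun z hz hzD =>
    (hfmax z hzD (hgs z hz)).trans hlev
  obtain ⟨j, hj, rfl⟩ := (mem_support_iff_getVert q).1 hv
  have b1 := CanonBip.pos_le hI O a hq hqA hbip hpA hshort hil'.le hj hiv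
  have b2 := CanonBip.pos_le' hI O a hq hqA hbip hpA hshort hil'.le hj hiv
  -- Segments contain interior vertices only, and `p`, `q` share their endpoints, so `v` is interior
  -- on `q` too and `Free` applies.
  have hj0 : 0 < j := by
    rcases Nat.eq_zero_or_pos j with rfl | h0
    · exact absurd (by simpa using hiv.symm) ((isPath_iff_getVert p).1 hbip.isPath 0 i' hi0' hil'.le)
    · exact h0
  have hjl : j < q.length := by
    refine lt_of_le_of_ne hj fun he => ?_
    have : q.getVert j = y := by rw [he]; simp
    exact absurd (by rw [hiv, this]; simp)
      ((isPath_iff_getVert p).1 hbip.isPath i' p.length hil' le_rfl)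
  have hfr := hfree j hj0 hjl z hz g' hg'
  have hmin : min (pos I.w p i') (wlen I.w p - pos I.w p i') ≤
      2 * min (pos I.w q j) (wlen I.w q - pos I.w q j) := by
    rcases min_cases (pos I.w q j) (wlen I.w q - pos I.w q j) with ⟨h, -⟩ | ⟨h, -⟩ <;> rw [h]
    · exact (min_le_left _ _).trans b1
    · exact (min_le_right _ _).trans b2
  have hk := hI.one_lt_k
  have hε := hI.ε₅_pos
  rw [← hI.ε₅_mul] at hfr
  have c1 : wlen I.w g' ≤ (2 * I.k - 1) *
      (I.ε₅ * (2 * min (pos I.w q j) (wlen I.w q - pos I.w q j))) :=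
    hgw'.trans (mul_le_mul_of_nonneg_left
      ((hgw.le.trans hclose).trans (mul_le_mul_of_nonneg_left hmin hε.le)) (by linarith))
  nlinarith

theorem inside_descend (hI : I.Admissible) {D Q : Finset V}
    (hQ : ∀ f ∈ D, ∀ z ∉ D, O.IsNear a f z → z ∈ Q) {x y : V}
    {q : I.G.Walk x y} (hfree : Free I D Q q) (hqD : Inside {z | z ∉ D} q) {s m t : ℕ → ℕ}
    (hq : CanonBip I (O.chain a) q s m t) (n : ℕ) (A : Finset V) (hqA : Inside {z | z ∉ A} q) :
    Inside {z | z ∉ O.descend a x y D n A} q := by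
  classical
  induction n generalizing A with
  | zero => exact hqA
  | succ n ih =>
    rw [Oracle.descend]
    rcases hs : O.stored a x y A with _ | ⟨p, code⟩
    · exact hqA
    · dsimp only
      split_ifs with hhit
      · exact ih _ (inside_childAvoid O a hI hQ hfree hqD hq hqA hs hhit)
      · exact hqA

/-- `q` survives every descent, so at the final node it competes with the stored path, which exists
and is no longer. -/
theorem decTree_le (hI : I.Admissible) {D Q : Finset V}
    (hQ : ∀ f ∈ D, ∀ z ∉ D, O.IsNear a f z → z ∈ Q) {x y : V}
    {q : I.G.Walk x y} (hfree : Free I D Q q) (hqD : Inside {z | z ∉ D} q) {s m t : ℕ → ℕ}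
    (hq : CanonBip I (O.chain a) q s m t) :
    O.decTree a D x y ≤ ENNReal.ofReal (wlen I.w q) := by
  have hins := inside_descend O a hI hQ hfree hqD hq I.d ∅ (fun z _ => by simp)
  have hbip : IsBipath I (O.chain a) q := isBipath_iff.2 ⟨s, m, t, hq.toBip⟩
  rw [Oracle.decTree, Oracle.finalNode]
  rcases hs : O.stored a x y (O.descend a x y D I.d ∅) with _ | ⟨p, code⟩
  · exact absurd hbip (O.stored_none _ _ _ _ hs q hins)
  · exact ENNReal.ofReal_le_ofReal ((O.stored_some _ _ _ _ _ _ hs).2.2 q hins hbip)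

end DecisionTrees

/-! ### The auxiliary graph of a query -/

section Query

variable {V : Type u} [Fintype V] {I : Input V} (O : Oracle I) (a : List ℕ)

theorem IsShortestIn.shortBetween {V : Type u} {G : SimpleGraph V} {w : Sym2 V → ℝ} {S : Set V}
    {x y : V} {p : G.Walk x y} (h : IsShortestIn w S p) : ShortBetween w S p 0 p.length := by
  refine ⟨fun l _ hl => (inside_iff_getVert p).1 h.2.1 l hl, fun g hg => ?_⟩
  have := h.2.2 (g.copy (by simp) (by simp)) (fun z hz => hg z (by simpa using hz))
  rwa [wlen_copy, ← pos_length, ← sub_zero (pos w p p.length), ← pos_zero (w := w) p] at this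

/-- From `x`, the decision trees lead to a query vertex that is closer to `y`. -/
theorem exists_step (hI : I.Admissible) {D Q : Finset V}
    (hQ : ∀ f ∈ D, ∀ z ∉ D, O.IsNear a f z → z ∈ Q) (hQD : ∀ z ∈ Q, z ∉ D) {x y : V}
    (hx : x ∈ Q) (hy : y ∈ Q) (hxy : x ≠ y) {p : I.G.Walk x y}
    (hp : IsShortestIn I.w {z | z ∉ D} p) :
    ∃ z ∈ Q, z ≠ x ∧ ∃ c : ℝ, 0 ≤ c ∧ O.decTree a D x z ≤ ENNReal.ofReal c ∧
      ∃ h : I.G.Walk z y, Inside {z | z ∉ D} h ∧ wlen I.w h < wlen I.w p ∧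
        c + (1 + I.ε) * wlen I.w h ≤ (1 + I.ε) * wlen I.w p := by
  classical
  have hw := hI.one_le_weight
  have hlen : 0 < p.length := by
    rw [Nat.pos_iff_ne_zero]
    intro h0
    exact hxy (SimpleGraph.Walk.eq_of_length_eq_zero h0)
  have hps := hp.shortBetween
  -- The endpoint qualifies with `y` itself as query vertex, both sides being 0 there. The start is
  -- excluded so that the step makes progress.
  have hex : ∃ j, (1 ≤ j ∧ j ≤ p.length) ∧ ∃ z ∈ Q, ∃ g : I.G.Walk (p.getVert j) z,
      Inside {z | z ∉ D} g ∧
        wlen I.w g ≤ I.ε₁ * min (pos I.w p j) (wlen I.w p - pos I.w p j) := by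
    refine ⟨p.length, ⟨hlen, le_rfl⟩, y, hy,
      (SimpleGraph.Walk.nil : I.G.Walk y y).copy (by simp) rfl, ?_, ?_⟩
    · intro z hz
      rw [SimpleGraph.Walk.support_copy, SimpleGraph.Walk.support_nil, List.mem_singleton] at hz
      rw [hz]
      exact hQD y hy
    · rw [wlen_copy, wlen_nil, pos_length, sub_self, min_eq_right (wlen_nonneg hw p), mul_zero]
  have hspec := Nat.find_spec hex
  have hfirst := fun i hi => Nat.find_min hex (m := i) hi
  generalize Nat.find hex = j at hspec hfirst
  obtain ⟨⟨hj1, hjl⟩, z₀, hz₀, g₀, hg₀, hgw₀⟩ := hspec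
  -- The nearest query vertex, and not just one within range, is needed for the interior of `g` to
  -- be far from all other query vertices.
  obtain ⟨z, hz, hzmin⟩ := Finset.exists_min_image Q
    (fun z => distIn I.G I.w {z | z ∉ D} (p.getVert j) z) ⟨z₀, hz₀⟩
  obtain ⟨g, hg⟩ := exists_shortest_of_distIn_ne_top hw
    (((hzmin z₀ hz₀).trans (distIn_le g₀ hg₀)).trans_lt ENNReal.ofReal_lt_top).ne
  have hgmin : ∀ z' ∈ Q, ∀ g' : I.G.Walk (p.getVert j) z', Inside {z | z ∉ D} g' →
      wlen I.w g ≤ wlen I.w g' := by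
    intro z' hz' g' hg'
    have := (hzmin z' hz').trans (distIn_le g' hg')
    rwa [distIn_eq hg, ENNReal.ofReal_le_ofReal_iff (wlen_nonneg hw g')] at this
  have hgw := (hgmin z₀ hz₀ g₀ hg₀).trans hgw₀
  have hε₁ := hI.ε₁_pos
  have hε₁' := hI.ε₁_lt_one
  have hpj : 0 < pos I.w p j := by
    have := pos_strictMono hw p hj1 hjl
    rwa [pos_zero] at this
  have hpj' := pos_le_wlen hw p j
  have hgw1 : wlen I.w g ≤ I.ε₁ * pos I.w p j :=
    hgw.trans (mul_le_mul_of_nonneg_left (min_le_left _ _) hε₁.le)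
  have hgw2 : wlen I.w g ≤ I.ε₁ * (wlen I.w p - pos I.w p j) :=
    hgw.trans (mul_le_mul_of_nonneg_left (min_le_right _ _) hε₁.le)
  have hglt : wlen I.w g < pos I.w p j := by nlinarith
  have hgs := hg.shortBetween
  have hgtake : ∀ e, Inside {z | z ∉ D} (g.take e) := fun e v hv =>
    hg.2.1 v ((g.isSubwalk_take e).support_subset hv)
  have hgdrop : ∀ e, Inside {z | z ∉ D} (g.drop e) := fun e v hv =>
    hg.2.1 v ((g.isSubwalk_drop e).support_subset hv)
  -- distances between vertices of `p` and of `g`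
  have hcross : ∀ l ≤ j, ∀ e, p.getVert l = g.getVert e →
      pos I.w p j - pos I.w p l ≤ pos I.w g e := by
    intro l hl e he
    have := (hps.mono (Nat.zero_le l) hl hjl le_rfl).2 ((g.take e).reverse.copy he.symm rfl)
      (fun v hv => (hgtake e).reverse v (by simpa using hv))
    rwa [wlen_copy, wlen_reverse] at this
  obtain ⟨N, hNlen, hv1, hv2⟩ := exists_splice p g (i := j) (j := 0) hjl (by simp)
  simp only [zero_add, Nat.sub_zero] at hNlen hv2
  have hNp : ∀ l ≤ j, pos I.w N l = pos I.w p l := fun l hl =>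
    pos_congr N p (by omega) (by omega) fun l' hl' => hv1 l' (by omega)
  have hNg : ∀ l ≤ g.length, pos I.w N (j + l) = pos I.w p j + pos I.w g l := by
    intro l hl
    have := pos_splice (w := I.w) (p := g) (q := p) (N := N) (i := 0) (Nat.zero_le _)
      (by omega) (by simpa using hNlen) hjl
      hv1 (by simpa using hv2) (l := l) (by omega)
    simpa using this
  have hNw : wlen I.w N = pos I.w p j + wlen I.w g := by
    rw [← pos_length, hNlen, hNg _ le_rfl, pos_length]
  -- If `g` returned to `p` before position `j`, say after length e, it would have run at least the
  -- part of `p` skipped backwards. What remains of `g` would then be short enough to make the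
  -- earlier vertex qualify, against the choice of `j`; at the start `x` the part skipped is already
  -- longer than `g`.
  have hNpath : N.IsPath := by
    rw [isPath_iff_getVert]
    intro l₁ l₂ hl hl₂ he
    rcases Nat.lt_or_ge j l₂ with h2 | h2
    · obtain ⟨e, rfl⟩ := Nat.exists_eq_add_of_le h2.le
      rw [hv2] at he
      rcases Nat.lt_or_ge l₁ j with h1 | h1
      · rw [hv1 _ h1.le] at he
        have hc := hcross l₁ h1.le e he
        have hge := pos_le_wlen hw g e
        rcases Nat.eq_zero_or_pos l₁ with rfl | h0
        · rw [pos_zero] at hc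
          linarith
        · refine hfirst l₁ h1 ⟨⟨h0, by omega⟩, z, hz, (g.drop e).copy he.symm rfl,
            fun v hv => hgdrop e v (by simpa using hv), ?_⟩
          have hd := pos_add_wlen_drop (w := I.w) g e
          have hm := pos_mono hw p h1.le
          have hg0 := pos_nonneg hw g e
          rw [wlen_copy]
          rcases min_cases (pos I.w p l₁) (wlen I.w p - pos I.w p l₁) with ⟨h, -⟩ | ⟨h, -⟩ <;>
            rw [h] <;> nlinarith
      · obtain ⟨e₁, rfl⟩ := Nat.exists_eq_add_of_le h1
        rw [hv2] at he
        exact (isPath_iff_getVert g).1 hg.1 _ _ (by omega) (by omega) he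
    · rw [hv1 _ h2, hv1 _ (by omega)] at he
      exact (isPath_iff_getVert p).1 hp.1 _ _ hl (by omega) he
  have hND : Inside {z | z ∉ D} N := by
    rw [inside_iff_getVert]
    intro l hl
    rcases le_total l j with h1 | h1
    · rw [hv1 l h1]
      exact hp.2.1 _ (p.getVert_mem_support l)
    · obtain ⟨e, rfl⟩ := Nat.exists_eq_add_of_le h1
      rw [hv2]
      exact hg.2.1 _ (g.getVert_mem_support e)
  -- Before `j` a violation contradicts the minimality of `j`, because `g` is no longer than the
  -- part of `p` it replaces. From `j` on, a query vertex within `ε₁ < 1` times the rest of `g`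
  -- would be nearer to position `j` than `z`.
  have hfree : Free I D Q N := by
    intro i hi0 hil z' hz' g' hg'
    by_contra hc
    push Not at hc
    rcases Nat.lt_or_ge i j with h | h
    · have e := hv1 i h.le
      refine hfirst i h ⟨⟨hi0, by omega⟩, z', hz', g'.copy e rfl,
        fun v hv => hg' v (by simpa using hv), ?_⟩
      rw [wlen_copy]
      refine hc.trans (mul_le_mul_of_nonneg_left ?_ hε₁.le)
      rw [hNp i h.le, hNw]
      refine min_le_min le_rfl ?_
      nlinarith
    · obtain ⟨e, rfl⟩ := Nat.exists_eq_add_of_le h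
      have he : e < g.length := by omega
      have hge := pos_strictMono hw g he le_rfl
      rw [pos_length] at hge
      have h1 : wlen I.w g' ≤ I.ε₁ * (wlen I.w g - pos I.w g e) := by
        refine hc.trans (mul_le_mul_of_nonneg_left ((min_le_right _ _).trans ?_) hε₁.le)
        rw [hNw, hNg e he.le]
        linarith
      have h2 := hgmin z' hz' ((g.take e).append (g'.copy (hv2 e) rfl))
        ((hgtake e).append fun v hv => hg' v (by simpa using hv))
      rw [wlen_append, wlen_copy] at h2
      change wlen I.w g ≤ pos I.w g e + _ at h2
      nlinarith
  obtain ⟨s, m, t, hcan⟩ := hfree.exists_canonBip hI O a hQ hNpath (by omega) (b := j)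
    ((hps.mono le_rfl (Nat.zero_le j) hjl le_rfl).congr (Nat.zero_le j) hjl (by omega) rfl
      fun l hl => by
        rw [zero_add]
        exact (hv1 l (by omega)).symm)
    (hgs.congr (Nat.zero_le _) le_rfl le_rfl (by omega) fun l hl => by
        rw [zero_add]
        exact (hv2 l).symm) (by omega)
  obtain ⟨g₁, hg₁, -, -, hs₁⟩ := exists_between (w := I.w) p hjl le_rfl
  rw [pos_length] at hg₁
  refine ⟨z, hz, ?_, wlen I.w N, wlen_nonneg hw N,
    decTree_le O a hI hQ hfree hND hcan,
    (g.reverse.append g₁).copy rfl (by simp), ?_, ?_, ?_⟩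
  · rintro rfl
    have := hcross 0 (Nat.zero_le j) g.length (by simp)
    rw [pos_zero, pos_length] at this
    linarith
  · intro v hv
    rw [SimpleGraph.Walk.support_copy] at hv
    refine Inside.append hg.2.1.reverse (S := {z | z ∉ D}) ?_ v hv
    intro v hv
    obtain ⟨l, -, -, rfl⟩ := hs₁ v hv
    exact hp.2.1 _ (p.getVert_mem_support l)
  · rw [wlen_copy, wlen_append, wlen_reverse, hg₁]
    linarith
  -- The detour `g` is walked once at cost 1 and once back at cost `1 + ε`. The excess `(2 + ε)|g|`
  -- is at most `ε · pos p j` by the choice of `ε₁`.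
  · rw [wlen_copy, wlen_append, wlen_reverse, hg₁, hNw]
    have hε := hI.ε_pos
    have h1 : I.ε₁ * (2 + I.ε) = I.ε := by
      rw [Input.ε₁]
      field_simp
    have h2 := mul_le_mul_of_nonneg_right hgw1 (show (0 : ℝ) ≤ 2 + I.ε by linarith)
    rw [mul_right_comm, h1] at h2
    linarith

theorem distH_self (D Q : Finset V) (x : {z // z ∈ Q}) : O.distH a D Q x x = 0 := by
  rw [← nonpos_iff_eq_zero]
  exact (iInf_le _ SimpleGraph.Walk.nil).trans (by simp)

theorem distH_le_add (D Q : Finset V) {x z : {z // z ∈ Q}} (y : {z // z ∈ Q}) (hxz : x ≠ z) :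
    O.distH a D Q x y ≤ O.decTree a D x z + O.distH a D Q z y := by
  rw [Oracle.distH, Oracle.distH, ENNReal.add_iInf]
  refine le_iInf fun p => ?_
  exact (iInf_le _ (SimpleGraph.Walk.cons (show (⊤ : SimpleGraph _).Adj x z from hxz) p)).trans
    (by simp)

theorem distIn_le_distH (hI : I.Admissible) {D Q : Finset V} (hD : D.card ≤ I.d)
    (hQD : ∀ z ∈ Q, z ∉ D) (x y : {z // z ∈ Q}) :
    distIn I.G I.w {z | z ∉ D} x y ≤ O.distH a D Q x y := by
  refine le_iInf fun p => ?_
  induction p with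
  | nil =>
    refine (distIn_le SimpleGraph.Walk.nil ?_).trans (by simp)
    intro z hz
    rw [SimpleGraph.Walk.support_nil, List.mem_singleton] at hz
    rw [hz]
    exact hQD _ (Subtype.prop _)
  | @cons b c d h p ih =>
    refine (distIn_triangle hI.one_le_weight _ _ (c : V) _).trans ?_
    rw [SimpleGraph.Walk.darts_cons, List.map_cons, List.sum_cons]
    exact add_le_add (distIn_le_decTree O a (hQD _ b.2) (hQD _ c.2) hD) ih

/-- Each use of `exists_step` leads to a query vertex strictly closer to `y`, so the number of query
vertices closer to `y` than the current one decreases, and the costs telescope. -/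
theorem distH_le (hI : I.Admissible) {D Q : Finset V}
    (hQ : ∀ f ∈ D, ∀ z ∉ D, O.IsNear a f z → z ∈ Q) (hQD : ∀ z ∈ Q, z ∉ D)
    (x y : {z // z ∈ Q}) :
    O.distH a D Q x y ≤ ENNReal.ofReal (1 + I.ε) * distIn I.G I.w {z | z ∉ D} x y := by
  classical
  have hw := hI.one_le_weight
  have hε := hI.ε_pos
  induction hN : (Q.filter fun z => distIn I.G I.w {z | z ∉ D} z y <
      distIn I.G I.w {z | z ∉ D} x y).card using Nat.strong_induction_on generalizing x with
  | _ n ih =>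
    by_cases htop : distIn I.G I.w {z | z ∉ D} (x : V) (y : V) = ⊤
    · rw [htop, ENNReal.mul_top (by simp; linarith)]
      exact le_top
    by_cases hxy : x = y
    · subst hxy
      rw [distH_self]
      exact zero_le
    obtain ⟨p, hp⟩ := exists_shortest_of_distIn_ne_top hw htop
    obtain ⟨z, hz, hzx, c, hc0, hc, h, hh, hlt, hle⟩ := exists_step O a hI hQ hQD x.2 y.2
      (fun e => hxy (Subtype.ext e)) hp
    have hzy := distIn_le (w := I.w) h hh
    have hdlt : distIn I.G I.w {z | z ∉ D} z y < distIn I.G I.w {z | z ∉ D} (x : V) (y : V) := by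
      rw [distIn_eq hp]
      exact hzy.trans_lt ((ENNReal.ofReal_lt_ofReal_iff_of_nonneg (wlen_nonneg hw h)).2 hlt)
    have := ih _ (by
      rw [← hN]
      refine Finset.card_lt_card ((Finset.ssubset_iff_of_subset ?_).2
        ⟨z, Finset.mem_filter.2 ⟨hz, hdlt⟩, fun hm => lt_irrefl _ (Finset.mem_filter.1 hm).2⟩)
      intro z' hz'
      obtain ⟨h1, h2⟩ := Finset.mem_filter.1 hz'
      exact Finset.mem_filter.2 ⟨h1, h2.trans hdlt⟩) ⟨z, hz⟩ rfl
    refine (distH_le_add O a D Q (z := ⟨z, hz⟩) y fun e => hzx (congrArg Subtype.val e).symm).trans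
      ((add_le_add hc (this.trans (mul_le_mul_right hzy _))).trans ?_)
    rw [distIn_eq hp, ← ENNReal.ofReal_mul (by linarith), ← ENNReal.ofReal_mul (by linarith),
      ← ENNReal.ofReal_add hc0 (mul_nonneg (by linarith) (wlen_nonneg hw h))]
    exact ENNReal.ofReal_le_ofReal hle

end Query

end VSDO

namespace VSDO

/-! ### Vertices of high pseudo-degree -/

section Trunks

/-- A forest extends to a spanning tree of the complete graph, which has one edge less than
vertices. -/
theorem sum_degree_le_of_isAcyclic {X : Type u} [Fintype X] {F : SimpleGraph X}
    [DecidableRel F.Adj] (h : F.IsAcyclic) : ∑ x, F.degree x ≤ 2 * Fintype.card X := by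
  classical
  rw [F.sum_degrees_eq_twice_card_edges]
  rcases isEmpty_or_nonempty X with hX | hX
  · have : F.edgeFinset = ∅ := by
      rw [Finset.eq_empty_iff_forall_notMem]
      intro e
      induction e with | _ x y => exact hX.elim x
    simp [this]
  · obtain ⟨T, hFT, -, hT⟩ :=
      (SimpleGraph.connected_top (V := X)).exists_isTree_le_of_le_of_isAcyclic le_top h
    have h1 := hT.card_edgeFinset
    have h2 : F.edgeFinset.card ≤ T.edgeFinset.card :=
      Finset.card_le_card (SimpleGraph.edgeFinset_mono hFT)
    omega

variable {V : Type u} {G : SimpleGraph V}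

theorem trunk_subset_verts (S : Finset V) (T : G.Subgraph) : trunk S T ⊆ T.verts := by
  rintro x ⟨a, -, b, -, ha, -, q, -, hx⟩
  obtain ⟨l, hl, rfl⟩ := (mem_support_iff_getVert q).1 hx
  rcases Nat.eq_zero_or_pos l with rfl | h0
  · simpa using ha
  · obtain ⟨l, rfl⟩ := Nat.exists_eq_add_of_le' h0
    have : T.Adj (q.getVert l) (q.getVert (l + 1)) := by
      simpa using q.adj_getVert_succ (i := l) (by omega)
    exact this.snd_mem

theorem pdeg_eq_ncard {S : Finset V} {T : G.Subgraph} {x : V} (hx : x ∈ trunk S T) :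
    pdeg S T x = ({y | y ∈ trunk S T ∧ T.Adj x y} : Set V).ncard := by
  rw [pdeg, if_pos hx]

theorem pdeg_eq_zero {S : Finset V} {T : G.Subgraph} {x : V} (hx : x ∉ trunk S T) :
    pdeg S T x = 0 := by
  rw [pdeg, if_neg hx]

/-- A trunk vertex that is no source is interior on a path between sources, and its two neighbours
there are trunk vertices as well. -/
theorem two_le_pdeg [Finite V] {S : Finset V} {T : G.Subgraph} {x : V} (hx : x ∈ trunk S T)
    (hS : x ∉ S) : 2 ≤ pdeg S T x := by
  rw [pdeg_eq_ncard hx]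
  obtain ⟨a, haS, b, hbS, ha, hb, q, hq, hxq⟩ := hx
  obtain ⟨l, hl, rfl⟩ := (mem_support_iff_getVert q).1 hxq
  have h0 : l ≠ 0 := by rintro rfl; simp at hS; exact hS haS
  have hl' : l ≠ q.length := by rintro rfl; simp at hS; exact hS hbS
  obtain ⟨l, rfl⟩ := Nat.exists_eq_add_one_of_ne_zero h0
  have a1 : T.Adj (q.getVert l) (q.getVert (l + 1)) := by
    simpa using q.adj_getVert_succ (i := l) (by omega)
  have a2 : T.Adj (q.getVert (l + 1)) (q.getVert (l + 2)) := by
    simpa using q.adj_getVert_succ (i := l + 1) (by omega)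
  have hne : q.getVert l ≠ q.getVert (l + 2) :=
    (isPath_iff_getVert q).1 hq _ _ (by omega) (by omega)
  rw [← Set.ncard_pair hne]
  refine Set.ncard_le_ncard ?_ (Set.toFinite _)
  rintro y (rfl | rfl)
  · exact ⟨⟨a, haS, b, hbS, ha, hb, q, hq, q.getVert_mem_support _⟩, a1.symm⟩
  · exact ⟨⟨a, haS, b, hbS, ha, hb, q, hq, q.getVert_mem_support _⟩, a2⟩

theorem exists_path_spanningCoe {T : G.Subgraph} (hT : T.coe.Connected) {x y : V}
    (hx : x ∈ T.verts) (hy : y ∈ T.verts) : ∃ q : T.spanningCoe.Walk x y, q.IsPath := by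
  classical
  obtain ⟨p⟩ := hT.preconnected ⟨x, hx⟩ ⟨y, hy⟩
  let f : T.coe →g T.spanningCoe := ⟨Subtype.val, fun h => h⟩
  exact ⟨(p.map f).bypass, (p.map f).bypass_isPath⟩

theorem one_le_pdeg [Finite V] {S : Finset V} {T : G.Subgraph} (hT : T.coe.Connected) {x y : V}
    (hx : x ∈ S) (hxT : x ∈ T.verts) (hy : y ∈ S) (hyT : y ∈ T.verts) (hxy : x ≠ y) :
    1 ≤ pdeg S T x := by
  obtain ⟨q, hq⟩ := exists_path_spanningCoe hT hxT hyT
  have hq0 : 0 < q.length := Nat.pos_iff_ne_zero.2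
    fun h => hxy (SimpleGraph.Walk.eq_of_length_eq_zero h)
  have a1 : T.Adj x (q.getVert 1) := by
    simpa using q.adj_getVert_succ (i := 0) hq0
  rw [pdeg_eq_ncard ⟨x, hx, y, hy, hxT, hyT, q, hq, q.start_mem_support⟩, Nat.one_le_iff_ne_zero,
    ← Nat.pos_iff_ne_zero, Set.ncard_pos]
  exact ⟨q.getVert 1, ⟨x, hx, y, hy, hxT, hyT, q, hq, q.getVert_mem_support 1⟩, a1⟩

theorem pdeg_eq_zero_of_subsingleton {S : Finset V} {T : G.Subgraph}
    (h : ∀ a ∈ S, ∀ b ∈ S, a ∈ T.verts → b ∈ T.verts → a = b) (x : V) : pdeg S T x = 0 := by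
  have key : ∀ y ∈ trunk S T, y ∈ S ∧ y ∈ T.verts := by
    rintro y ⟨a, haS, b, hbS, ha, hb, q, hq, hy⟩
    obtain rfl := h a haS b hbS ha hb
    rw [(SimpleGraph.Walk.isPath_iff_nil.1 hq).eq_nil] at hy
    simp only [SimpleGraph.Walk.support_nil, List.mem_singleton] at hy
    rw [hy]
    exact ⟨haS, ha⟩
  by_cases hx : x ∈ trunk S T
  · rw [pdeg_eq_ncard hx]
    convert Set.ncard_empty V
    rw [Set.eq_empty_iff_forall_notMem]
    rintro y ⟨hy, hxy⟩
    obtain ⟨h1, h2⟩ := key x hx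
    obtain ⟨h3, h4⟩ := key y hy
    exact hxy.ne (h x h1 y h3 h2 h4)
  · exact pdeg_eq_zero hx

open scoped Classical in
/-- A tree with few sources has few vertices of high pseudo-degree. -/
theorem mul_card_lt_pdeg_le [Fintype V] {S : Finset V} {T : G.Subgraph} (hT : T.coe.IsTree)
    {σ : ℝ} (hσ : 2 ≤ σ) :
    (σ - 2) * (Finset.univ.filter fun x => σ < pdeg S T x).card ≤
      (S.filter fun a => a ∈ T.verts).card := by
  -- With at most one source the pseudo-degrees vanish. With two, every source in the tree has a
  -- trunk neighbour, which the count below needs.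
  by_cases hsub : ∀ a ∈ S, ∀ b ∈ S, a ∈ T.verts → b ∈ T.verts → a = b
  · have : (Finset.univ.filter fun x => σ < pdeg S T x) = ∅ := by
      rw [Finset.eq_empty_iff_forall_notMem]
      intro x hx
      have := (Finset.mem_filter.1 hx).2
      rw [pdeg_eq_zero_of_subsingleton hsub x] at this
      simp at this
      linarith
    rw [this]
    simp
  push Not at hsub
  obtain ⟨a, haS, b, hbS, haT, hbT, hab⟩ := hsub
  let F : SimpleGraph (trunk S T) :=
    ⟨fun x y => T.Adj x y, ⟨fun _ _ h => h.symm⟩, ⟨fun _ h => h.ne rfl⟩⟩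
  have hF : F.IsAcyclic := by
    let f : F →g T.coe := ⟨fun x => ⟨x, trunk_subset_verts S T x.2⟩, fun h => h⟩
    refine hT.isAcyclic.comap f fun x y h => ?_
    exact Subtype.ext (congrArg (fun z : T.verts => (z : V)) h)
  have hdeg : ∀ x, F.degree x = pdeg S T x := by
    intro x
    rw [pdeg_eq_ncard x.2, ← SimpleGraph.card_neighborFinset_eq_degree,
      ← Finset.card_image_of_injective _ Subtype.val_injective, ← Set.ncard_coe_finset]
    congr 1
    ext y
    simp [F, and_comm]
  have hsum := sum_degree_le_of_isAcyclic hF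
  have hsum' : ∑ x : trunk S T, ((pdeg S T x : ℝ) - 2) ≤ 0 := by
    rw [Finset.sum_sub_distrib]
    simp only [← hdeg, Finset.sum_const, Finset.card_univ, nsmul_eq_mul]
    have : ((∑ x, F.degree x : ℕ) : ℝ) ≤ ((2 * Fintype.card (trunk S T) : ℕ) : ℝ) :=
      Nat.cast_le.2 hsum
    push_cast at this
    linarith
  -- In a forest the terms `deg - 2` sum to at most 0. Only sources can contribute a negative term,
  -- at least -1 each, and they must pay for the more than `σ - 2` of every vertex of high degree.
  have hterm : ∀ x : trunk S T, (σ - 2) * (if σ < pdeg S T x then 1 else 0) -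
      (if (x : V) ∈ S then 1 else 0) ≤ (pdeg S T x : ℝ) - 2 := by
    intro x
    have h2 : (x : V) ∉ S → (2 : ℝ) ≤ pdeg S T x := fun h => by
      exact_mod_cast two_le_pdeg x.2 h
    have h1 : (x : V) ∈ S → (1 : ℝ) ≤ pdeg S T x := fun h => by
      have hx := trunk_subset_verts S T x.2
      by_cases hxa : (x : V) = a
      · exact_mod_cast one_le_pdeg hT.connected h hx hbS hbT (hxa ▸ hab)
      · exact_mod_cast one_le_pdeg hT.connected h hx haS haT hxa
    split_ifs with q1 q2 q2
    · linarith
    · linarith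
    · linarith [h1 q2]
    · linarith [h2 q2]
  have htot := (Finset.sum_le_sum fun x (_ : x ∈ Finset.univ) => hterm x).trans hsum'
  rw [Finset.sum_sub_distrib, ← Finset.mul_sum, Finset.sum_boole, Finset.sum_boole] at htot
  have c1 : (Finset.univ.filter fun x => σ < pdeg S T x).card ≤
      (Finset.univ.filter fun x : trunk S T => σ < pdeg S T x).card := by
    refine Finset.card_le_card_of_surjOn Subtype.val ?_
    intro x hx
    have hx' : σ < pdeg S T x := by simpa using hx
    have hxt : x ∈ trunk S T := by
      by_contra hc
      rw [pdeg_eq_zero hc] at hx'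
      simp at hx'
      linarith
    exact ⟨⟨x, hxt⟩, by simpa using hx', rfl⟩
  have c2 : (Finset.univ.filter fun x : trunk S T => (x : V) ∈ S).card ≤
      (S.filter fun a => a ∈ T.verts).card := by
    refine Finset.card_le_card_of_injOn Subtype.val ?_ Subtype.val_injective.injOn
    intro x hx
    have hx' : (x : V) ∈ S := by simpa using hx
    simpa using ⟨hx', trunk_subset_verts S T x.2⟩
  have c1' := mul_le_mul_of_nonneg_left ((Nat.cast_le (α := ℝ)).2 c1)
    (show (0 : ℝ) ≤ σ - 2 by linarith)
  have c2' := (Nat.cast_le (α := ℝ)).2 c2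
  linarith

end Trunks

/-! ### The size of the hierarchy -/

section Hierarchy

variable {V : Type u} [Fintype V] {I : Input V}

theorem Input.Admissible.n_rpow (hI : I.Admissible) : I.n ^ (1 / I.k) = Real.exp 1 := by
  have h := hI.three_le_n
  have hk := hI.one_lt_k
  rw [Real.rpow_def_of_pos (by linarith), ← Input.k, mul_one_div, div_self (by linarith)]

theorem Input.Admissible.two_le_d' (hI : I.Admissible) : (2 : ℝ) ≤ I.d := by
  exact_mod_cast hI.two_le_d

theorem Input.Admissible.one_le_d_rpow (hI : I.Admissible) {x : ℝ} (hx : 0 ≤ x) :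
    1 ≤ (I.d : ℝ) ^ x :=
  Real.one_le_rpow (by linarith [hI.two_le_d']) hx

/-- The threshold is chosen for this. Since `n^{1/k} = e`, a vertex lies in at most `k · e · (k +
1)` trees of a cover, and the 2 is lost in `mul_card_lt_pdeg_le`. -/
theorem Input.Admissible.s_spec (hI : I.Admissible) :
    I.k * Real.exp 1 * (I.k + 1) * (I.d : ℝ) ^ (I.c + 1) ≤ I.s - 2 := by
  have hk := hI.one_lt_k
  have hd := hI.one_le_d_rpow (x := I.c + 1) (by linarith [hI.one_le_c])
  have he := Real.add_one_le_exp (1 : ℝ)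
  rw [Input.s, ← Input.k]
  set D := (I.d : ℝ) ^ (I.c + 1)
  set e := Real.exp 1
  have h1 : 1 ≤ e * D := by nlinarith
  have h2 : 1 ≤ (e * D) * I.k ^ 2 := by nlinarith
  have h3 : (e * D) * I.k ≤ (e * D) * I.k ^ 2 := by
    refine mul_le_mul_of_nonneg_left ?_ (by linarith)
    nlinarith
  nlinarith

/-- Summed over the trees of the cover, `mul_card_lt_pdeg_le` bounds `(s - 2)|Hi|` by the number of
pairs of a source and a tree containing it, which the overlap bound controls after exchanging the
sums. -/
theorem card_Hi_mul_le (hI : I.Admissible) {cov : Finset V → Finset V → V → I.G.Subgraph}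
    (hcov : ∀ R S, Disjoint R S → IsTreeCover I R S (cov R S)) (U R : Finset V) :
    ((Hi I cov U R).card : ℝ) * (I.d : ℝ) ^ (I.c + 1) ≤ U.card := by
  classical
  have hdis : Disjoint R (U \ R) := Finset.disjoint_sdiff
  obtain ⟨hT, -, hover⟩ := hcov R (U \ R) hdis
  have hk := hI.one_lt_k
  have he := Real.exp_pos 1
  have hd := hI.one_le_d_rpow (x := I.c + 1) (by linarith [hI.one_le_c])
  have hs := hI.s_spec
  set K := I.k * Real.exp 1 * (I.k + 1) with hK
  have hK0 : 0 < K := by positivity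
  have hs2 : 0 < I.s - 2 := lt_of_lt_of_le (by positivity) hs
  have hsub : Hi I cov U R ⊆ (U \ R).biUnion fun r =>
      Finset.univ.filter fun x => I.s < pdeg (U \ R) (cov R (U \ R) r) x := by
    intro x hx
    obtain ⟨-, r, hr, h⟩ := Finset.mem_filter.1 hx
    refine Finset.mem_biUnion.2 ⟨r, ?_, Finset.mem_filter.2 ⟨Finset.mem_univ _, ?_⟩⟩
    · convert hr
    · convert h
  have h1 : (I.s - 2) * (Hi I cov U R).card ≤ K * U.card := by
    calc (I.s - 2) * (Hi I cov U R).card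
        ≤ (I.s - 2) * ∑ r ∈ U \ R,
          ((Finset.univ.filter fun x => I.s < pdeg (U \ R) (cov R (U \ R) r) x).card : ℝ) := by
          refine mul_le_mul_of_nonneg_left ?_ hs2.le
          exact_mod_cast (Finset.card_le_card hsub).trans Finset.card_biUnion_le
      _ = ∑ r ∈ U \ R, (I.s - 2) *
          ((Finset.univ.filter fun x => I.s < pdeg (U \ R) (cov R (U \ R) r) x).card : ℝ) := by
          rw [Finset.mul_sum]
      _ ≤ ∑ r ∈ U \ R, (((U \ R).filter fun a => a ∈ (cov R (U \ R) r).verts).card : ℝ) := by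
          refine Finset.sum_le_sum fun r hr => ?_
          convert mul_card_lt_pdeg_le (S := U \ R) (hT r hr).2.1 (by linarith : 2 ≤ I.s)
      _ = ∑ a ∈ U \ R, (((U \ R).filter fun r => a ∈ (cov R (U \ R) r).verts).card : ℝ) := by
          exact_mod_cast Finset.sum_card_bipartiteAbove_eq_sum_card_bipartiteBelow
            (fun r a => a ∈ (cov R (U \ R) r).verts)
      _ ≤ ∑ a ∈ U \ R, K := by
          refine Finset.sum_le_sum fun a _ => ?_
          have := hover a
          rw [hI.n_rpow, ← Input.k, ← hK] at this
          refine le_trans (le_of_eq ?_) this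
          rw [← Set.ncard_coe_finset]
          congr 2
          ext r
          simp
      _ ≤ K * U.card := by
          rw [Finset.sum_const, nsmul_eq_mul, mul_comm]
          refine mul_le_mul_of_nonneg_left ?_ hK0.le
          exact_mod_cast Finset.card_le_card Finset.sdiff_subset
  have h2 : K * (((Hi I cov U R).card : ℝ) * (I.d : ℝ) ^ (I.c + 1)) ≤ K * U.card := by
    refine le_trans ?_ h1
    have := mul_le_mul_of_nonneg_right hs (Nat.cast_nonneg (α := ℝ) (Hi I cov U R).card)
    linarith
  exact le_of_mul_le_mul_left h2 hK0

/-- Each of the at most `d` unions adds at most `|U| / d^(c+1)` vertices. -/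
theorem card_childSet_mul_le (hI : I.Admissible)
    {cov : Finset V → Finset V → V → I.G.Subgraph}
    (hcov : ∀ R S, Disjoint R S → IsTreeCover I R S (cov R S)) (U : Finset V) {j : ℕ}
    (hj : j ≤ I.d) : ((childSet I cov U j).card : ℝ) * (I.d : ℝ) ^ I.c ≤ U.card := by
  classical
  have hd := hI.two_le_d'
  have key : ∀ j, ((childSet I cov U j).card : ℝ) * (I.d : ℝ) ^ (I.c + 1) ≤ j * U.card := by
    intro j
    induction j with
    | zero => simp [childSet]
    | succ j ih =>
      have h1 : ((childSet I cov U (j + 1)).card : ℝ) ≤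
          (childSet I cov U j).card + (Hi I cov U (childSet I cov U j)).card := by
        exact_mod_cast Finset.card_union_le _ _
      have h2 := card_Hi_mul_le hI hcov U (childSet I cov U j)
      have h3 := mul_le_mul_of_nonneg_right h1
        (show (0 : ℝ) ≤ (I.d : ℝ) ^ (I.c + 1) by positivity)
      push_cast
      linarith
  have h1 := key j
  have h2 : (j : ℝ) * U.card ≤ I.d * U.card :=
    mul_le_mul_of_nonneg_right (Nat.cast_le.2 hj) (Nat.cast_nonneg _)
  rw [Real.rpow_add_one (by linarith)] at h1
  refine le_of_mul_le_mul_left ?_ (show (0 : ℝ) < I.d by linarith)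
  linarith

theorem d_rpow_le_card (hI : I.Admissible) {cov : Finset V → Finset V → V → I.G.Subgraph}
    (hcov : ∀ R S, Disjoint R S → IsTreeCover I R S (cov R S)) {U : Finset V}
    (hU : Hi I cov U ∅ ≠ ∅) : (I.d : ℝ) ^ (I.c + 1) ≤ U.card := by
  have h1 := card_Hi_mul_le hI hcov U ∅
  have h2 : (1 : ℝ) ≤ (Hi I cov U ∅).card := by
    exact_mod_cast Finset.card_pos.2 (Finset.nonempty_iff_ne_empty.2 hU)
  have h3 : (0 : ℝ) ≤ (I.d : ℝ) ^ (I.c + 1) := by positivity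
  nlinarith

theorem card_childSet_lt (hI : I.Admissible) {cov : Finset V → Finset V → V → I.G.Subgraph}
    (hcov : ∀ R S, Disjoint R S → IsTreeCover I R S (cov R S)) {U : Finset V}
    (hU : Hi I cov U ∅ ≠ ∅) {j : ℕ} (hj : j ≤ I.d) : (childSet I cov U j).card < U.card := by
  have h1 := card_childSet_mul_le hI hcov U hj
  have h2 := d_rpow_le_card hI hcov hU
  have h3 := hI.one_le_d_rpow (x := I.c + 1) (by linarith [hI.one_le_c])
  have h4 : (2 : ℝ) ≤ (I.d : ℝ) ^ I.c := by
    refine hI.two_le_d'.trans ?_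
    conv_lhs => rw [← Real.rpow_one (I.d : ℝ)]
    exact Real.rpow_le_rpow_of_exponent_le (by linarith [hI.two_le_d']) hI.one_le_c
  have h5 : (0 : ℝ) ≤ (childSet I cov U j).card := Nat.cast_nonneg _
  have : ((childSet I cov U j).card : ℝ) < U.card := by nlinarith
  exact_mod_cast this

/-- The path-finding algorithm reaches a node where it halts. -/
theorem exists_pathFinding (hI : I.Admissible) {cov : Finset V → Finset V → V → I.G.Subgraph}
    (hcov : ∀ R S, Disjoint R S → IsTreeCover I R S (cov R S)) (D U : Finset V) :
    ∃ a, AddressFrom I cov U a ∧ PathFinding I cov D U a := by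
  classical
  induction hN : U.card using Nat.strong_induction_on generalizing U with
  | _ n ih =>
    by_cases hleaf : Hi I cov U ∅ = ∅ ∨ Disjoint D (childSet I cov U 1)
    · exact ⟨[], trivial, hleaf⟩
    obtain ⟨hU, hD⟩ := not_or.1 hleaf
    -- The premise `j < d` encodes `W_{d+1} = W_d`: at `j = d` the condition is void, so the search
    -- always succeeds. The result is not 0, as `D` meets `W_1` at a node where the procedure goes
    -- on.
    have hex : ∃ j, j < I.d → Disjoint D (childSet I cov U (j + 1) \ childSet I cov U j) :=
      ⟨I.d, fun h => absurd h (lt_irrefl _)⟩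
    have hspec := Nat.find_spec hex
    have hmin := fun i hi => Nat.find_min hex (m := i) hi
    have hle : Nat.find hex ≤ I.d := Nat.find_min' hex fun h => absurd h (lt_irrefl _)
    generalize Nat.find hex = j at hspec hmin hle
    have hj1 : 1 ≤ j := by
      rcases Nat.eq_zero_or_pos j with rfl | h
      · refine absurd (hspec (by have := hI.two_le_d; omega)) ?_
        simpa [childSet] using hD
      · exact h
    obtain ⟨a, ha, hpf⟩ := ih _ (by rw [← hN]; exact card_childSet_lt hI hcov hU hle)
      (childSet I cov U j) rfl
    exact ⟨j :: a, ⟨hU, hj1, hle, ha⟩, hU, hj1, hle,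
      fun i hi => by have := hmin i hi; push Not at this; exact this.2, hspec, hpf⟩

/-- Going down one edge divides the size by `d^c`, and the last node that is left, not being a leaf,
has at least `d^(c+1)` elements, whence the extra factor `d`. -/
theorem pow_length_mul_le (hI : I.Admissible) {cov : Finset V → Finset V → V → I.G.Subgraph}
    (hcov : ∀ R S, Disjoint R S → IsTreeCover I R S (cov R S)) {a : List ℕ} {U : Finset V}
    (ha : AddressFrom I cov U a) (hne : a ≠ []) :
    ((I.d : ℝ) ^ I.c) ^ a.length * I.d ≤ U.card := by
  have hd := hI.two_le_d'
  induction a generalizing U with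
  | nil => exact absurd rfl hne
  | cons j a ih =>
    obtain ⟨hU, -, hj, ha⟩ := ha
    by_cases hn : a = []
    · subst hn
      have := d_rpow_le_card hI hcov hU
      rw [Real.rpow_add_one (by linarith)] at this
      simpa using this
    · have h1 := ih ha hn
      have h2 := card_childSet_mul_le hI hcov U hj
      have h3 : (0 : ℝ) ≤ (I.d : ℝ) ^ I.c := by positivity
      rw [List.length_cons, pow_succ]
      calc _ = ((I.d : ℝ) ^ I.c) ^ a.length * I.d * (I.d : ℝ) ^ I.c := by ring
        _ ≤ _ := (mul_le_mul_of_nonneg_right h1 h3).trans h2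

end Hierarchy

end VSDO

namespace VSDO

/-! ### Space -/

section Space

/-- A segment is given by a half of the path and a value of the floor. The distances lie between 1
and `M/2`, so each half has at most `log_{1+δ}(M/2) + 1` values, and `δ ≤ 1` absorbs the 1 by
restoring the factor 2. -/
theorem card_segs_le {V : Type u} [Fintype V] {G : SimpleGraph V} {w : Sym2 V → ℝ}
    (hw : ∀ e ∈ G.edgeSet, 1 ≤ w e) {δ M : ℝ} (hδ : 0 < δ) (hδ' : δ ≤ 1) (hM : 1 ≤ M) {x y : V}
    {p : G.Walk x y} (hp : p.IsPath) (hpM : wlen w p ≤ M) :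
    ((segs w δ p).card : ℝ) ≤ 2 * Real.logb (1 + δ) M := by
  classical
  have h1 : 1 < 1 + δ := by linarith
  let key : ℕ → Bool × ℤ := fun i => if wlen w (p.take i) ≤ wlen w p / 2 then
    (true, ⌊Real.logb (1 + δ) (wlen w (p.take i))⌋) else
    (false, ⌊Real.logb (1 + δ) (wlen w (p.drop i))⌋)
  let H : Bool × ℤ → Finset V := fun b => Finset.univ.filter fun v =>
    ∃ j, (0 < j ∧ j < p.length) ∧ key j = b ∧ p.getVert j = v
  have hdrop := fun i => pos_add_wlen_drop (w := w) p i
  have hsame : ∀ i j, SameSegment w δ p i j ↔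
      (0 < i ∧ i < p.length) ∧ (0 < j ∧ j < p.length) ∧ key j = key i := by
    intro i j
    have di := hdrop i
    have dj := hdrop j
    rw [pos] at di dj
    refine and_congr_right fun _ => and_congr_right fun _ => ?_
    simp only [key]
    constructor
    · rintro (⟨a1, a2, a3⟩ | ⟨a1, a2, a3⟩)
      · rw [if_pos a1, if_pos a2, a3]
      · rw [if_neg (by linarith), if_neg (by linarith), a3]
    · intro h
      split_ifs at h with b1 b2 b2
      · exact Or.inl ⟨b2, b1, (by simpa using h.symm)⟩
      · simp at h
      · simp at h
      · exact Or.inr ⟨by linarith, by linarith, (by simpa using h.symm)⟩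
  have hint : ∀ v, v ∈ p.support ∧ v ≠ x ∧ v ≠ y →
      ∃ i, (0 < i ∧ i < p.length) ∧ p.getVert i = v := by
    rintro v ⟨hv, hx, hy⟩
    obtain ⟨i, hi, rfl⟩ := (mem_support_iff_getVert p).1 hv
    refine ⟨i, ⟨?_, ?_⟩, rfl⟩
    · rcases Nat.eq_zero_or_pos i with rfl | h
      · simp at hx
      · exact h
    · exact lt_of_le_of_ne hi fun h => hy (by rw [h]; simp)
  have hseg : ∀ i, (0 < i ∧ i < p.length) → seg w δ p (p.getVert i) = H (key i) := by
    intro i hi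
    ext v
    simp only [seg, H, Finset.mem_filter, Finset.mem_univ, true_and]
    constructor
    · rintro ⟨i', j, hs, he, hv⟩
      obtain ⟨hi', hj, hk⟩ := (hsame i' j).1 hs
      obtain rfl : i' = i := by
        rcases lt_trichotomy i' i with h | h | h
        · exact absurd he ((isPath_iff_getVert p).1 hp _ _ h hi.2.le)
        · exact h
        · exact absurd he.symm ((isPath_iff_getVert p).1 hp _ _ h hi'.2.le)
      exact ⟨j, hj, hk, hv⟩
    · rintro ⟨j, hj, hk, hv⟩
      exact ⟨i, j, (hsame i j).2 ⟨hi, hj, hk⟩, rfl, hv⟩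
  have hbound : ∀ t : ℝ, 1 ≤ t → t ≤ M / 2 →
      ⌊Real.logb (1 + δ) t⌋ ∈ Finset.Icc (0 : ℤ) ⌊Real.logb (1 + δ) (M / 2)⌋ := by
    intro t ht htM
    rw [Finset.mem_Icc]
    exact ⟨Int.floor_nonneg.2 (Real.logb_nonneg h1 ht),
      Int.floor_le_floor ((Real.logb_le_logb h1 (by linarith) (by linarith)).2 htM)⟩
  have hsub : segs w δ p ⊆ (Finset.univ ×ˢ
      Finset.Icc (0 : ℤ) ⌊Real.logb (1 + δ) (M / 2)⌋).image H := by
    intro X hX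
    obtain ⟨v, hv, rfl⟩ := Finset.mem_image.1 hX
    obtain ⟨i, hi, rfl⟩ := hint v (Finset.mem_filter.1 hv).2
    refine Finset.mem_image.2 ⟨key i, ?_, (hseg i hi).symm⟩
    have p1 := sub_le_pos_sub hw p (Nat.zero_le i) hi.2.le
    have p2 := sub_le_pos_sub hw p hi.2.le le_rfl
    have c1 : (1 : ℝ) ≤ i := by exact_mod_cast hi.1
    have c2 : (i : ℝ) + 1 ≤ p.length := by exact_mod_cast hi.2
    rw [pos_zero] at p1
    rw [pos_length] at p2
    have d := hdrop i
    push_cast at p1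
    simp only [Finset.mem_product, Finset.mem_univ, true_and, key]
    split_ifs with h
    · refine hbound _ ?_ (by linarith)
      rw [pos] at p1
      linarith
    · change ¬ pos w p i ≤ _ at h
      exact hbound _ (by linarith) (by linarith)
  have hcard : (segs w δ p).card ≤ 2 * (⌊Real.logb (1 + δ) (M / 2)⌋ + 1).toNat := by
    refine (Finset.card_le_card hsub).trans (Finset.card_image_le.trans ?_)
    rw [Finset.card_product]
    simp
  have hl0 := Real.logb_nonneg h1 hM
  have hl2 : Real.logb (1 + δ) (M / 2) + 1 ≤ Real.logb (1 + δ) M := by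
    rw [Real.logb_div (by linarith) (by norm_num)]
    have : 1 ≤ Real.logb (1 + δ) 2 := by
      rw [Real.le_logb_iff_rpow_le h1 (by norm_num), Real.rpow_one]
      linarith
    linarith
  have hfl : (((⌊Real.logb (1 + δ) (M / 2)⌋ + 1).toNat : ℕ) : ℝ) ≤ Real.logb (1 + δ) M := by
    rcases le_total 0 (⌊Real.logb (1 + δ) (M / 2)⌋ + 1) with h | h
    · have e : (((⌊Real.logb (1 + δ) (M / 2)⌋ + 1).toNat : ℕ) : ℝ) =
          ((⌊Real.logb (1 + δ) (M / 2)⌋ + 1 : ℤ) : ℝ) := by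
        rw [← Int.cast_natCast, Int.toNat_of_nonneg h]
      rw [e]
      push_cast
      linarith [Int.floor_le (Real.logb (1 + δ) (M / 2))]
    · rw [Int.toNat_of_nonpos h]
      simpa using hl0
  calc ((segs w δ p).card : ℝ) ≤ ((2 * (⌊Real.logb (1 + δ) (M / 2)⌋ + 1).toNat : ℕ) : ℝ) :=
        Nat.cast_le.2 hcard
    _ ≤ _ := by push_cast; linarith

variable {V : Type u} [Fintype V] {I : Input V}

/-- The leading 1 is the link to the node, so that a node with its link and code takes at most `1 +
1 + 5(2B + 2) = 12 + 10B` words. The form `2b^t - 1` is stable under multiplication by the branching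
number `b` and adding one node, provided `b ≥ 2`. -/
theorem treeWords_le (hI : I.Admissible) (O : Oracle I) (a : List ℕ) {b : ℝ} (hb : 2 ≤ b)
    (hbr : 2 * Real.logb (1 + I.ε₅) (I.n * I.W) * (O.chain a).length ≤ b) (x y : V) (t : ℕ)
    (A : Finset V) :
    (1 : ℝ) + O.treeWords a x y t A ≤ (12 + 10 * I.B) * (2 * b ^ t - 1) := by
  have hB : (0 : ℝ) ≤ I.B := Nat.cast_nonneg _
  have hsegs : ∀ A p code, O.stored a x y A = some (p, code) →
      code.length = 2 * I.B + 2 ∧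
        ((segs I.w I.ε₅ p).card : ℝ) * (O.chain a).length ≤ b := by
    intro A p code hs
    have hc := (O.stored_some a x y A p code hs).1
    refine ⟨hc.2.1, le_trans (mul_le_mul_of_nonneg_right ?_ (Nat.cast_nonneg _)) hbr⟩
    exact card_segs_le hI.one_le_weight hI.ε₅_pos hI.ε₅_lt_one.le hI.one_le_nW hc.1
      (hI.wlen_le hc.1)
  induction t generalizing A with
  | zero =>
    rw [Oracle.treeWords]
    rcases hs : O.stored a x y A with _ | ⟨p, code⟩
    · simp only
      push_cast
      linarith
    · simp only [(hsegs A p code hs).1]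
      push_cast
      linarith
  | succ t ih =>
    have hbt : (1 : ℝ) ≤ b ^ t := one_le_pow₀ (by linarith)
    rw [Oracle.treeWords, pow_succ]
    rcases hs : O.stored a x y A with _ | ⟨p, code⟩
    · simp only
      push_cast
      have : 1 ≤ 2 * (b ^ t * b) - 1 := by nlinarith
      nlinarith
    · obtain ⟨h1, h2⟩ := hsegs A p code hs
      simp only [h1]
      push_cast
      have h3 : ∑ X ∈ segs I.w I.ε₅ p, ∑ i ∈ Finset.Icc 1 (O.chain a).length,
          ((1 : ℝ) + O.treeWords a x y t (O.childAvoid a A X i)) ≤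
          b * ((12 + 10 * I.B) * (2 * b ^ t - 1)) := by
        refine (Finset.sum_le_sum fun X _ => Finset.sum_le_sum fun i _ => ih _).trans ?_
        simp only [Finset.sum_const, Nat.card_Icc, nsmul_eq_mul, Nat.add_sub_cancel]
        rw [← mul_assoc]
        exact mul_le_mul_of_nonneg_right h2 (mul_nonneg (by linarith) (by linarith))
      have h4 : (0 : ℝ) ≤ (12 + 10 * I.B) * (b - 2) := mul_nonneg (by linarith) (by linarith)
      nlinarith

/-- From `ln(1 + ε₅) ≥ ε₅/2`, valid as `ε₅ < 1`, and `ε₅ ≥ ε/(12k)`; natural logarithms are then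
replaced by the larger binary ones. -/
theorem Input.Admissible.logb_le (hI : I.Admissible) : Real.logb (1 + I.ε₅) (I.n * I.W) ≤
    24 * I.ε⁻¹ * Real.logb 2 I.n * Real.logb 2 (I.n * I.W) := by
  have hε := hI.ε_pos
  have hε1 := hI.ε_lt_one
  have hε5 := hI.ε₅_pos
  have hε5' := hI.ε₅_lt_one
  have hk := hI.one_lt_k
  have hnW := hI.one_le_nW
  have hlog2 := Real.log_two_lt_d9
  have hlog2' := Real.log_pos (one_lt_two (α := ℝ))
  have hlog : ∀ x : ℝ, 1 ≤ x → Real.log x ≤ Real.logb 2 x := by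
    intro x hx
    rw [Real.logb, le_div_iff₀ hlog2']
    nlinarith [Real.log_nonneg hx]
  have h1 : I.ε₅ / 2 ≤ Real.log (1 + I.ε₅) := by
    refine le_trans ?_ (Real.one_sub_inv_le_log_of_pos (by linarith))
    rw [← sub_nonneg]
    have : 1 - (1 + I.ε₅)⁻¹ - I.ε₅ / 2 = I.ε₅ * (1 - I.ε₅) / (2 * (1 + I.ε₅)) := by
      field_simp
      ring
    rw [this]
    exact div_nonneg (mul_nonneg hε5.le (by linarith)) (by linarith)
  have h2 : I.ε / (12 * I.k) ≤ I.ε₅ := by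
    rw [Input.ε₅, Input.ε₁, div_div]
    refine div_le_div_of_nonneg_left hε.le (mul_pos (by linarith) (by linarith)) ?_
    nlinarith
  have h3 : Real.logb (1 + I.ε₅) (I.n * I.W) ≤ Real.log (I.n * I.W) * (24 * I.k * I.ε⁻¹) := by
    rw [Real.logb, div_eq_mul_inv]
    refine mul_le_mul_of_nonneg_left ?_ (Real.log_nonneg hnW)
    rw [inv_le_comm₀ (by linarith) (by positivity)]
    refine le_trans (le_of_eq ?_) ((div_le_div_of_nonneg_right h2 (by norm_num)).trans h1)
    field_simp
    norm_num
  refine h3.trans ?_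
  have h4 := hlog _ hnW
  have h5 : I.k ≤ Real.logb 2 I.n := hlog _ (by linarith [hI.three_le_n])
  have h6 := Real.log_nonneg hnW
  have h7 := h6.trans h4
  calc Real.log (I.n * I.W) * (24 * I.k * I.ε⁻¹)
      ≤ Real.logb 2 (I.n * I.W) * (24 * Real.logb 2 I.n * I.ε⁻¹) := by gcongr
    _ = _ := by ring

theorem chain_length (O : Oracle I) (a : List ℕ) : (O.chain a).length = a.length + 1 := by
  have : ∀ (cov : Finset V → Finset V → V → I.G.Subgraph) (a : List ℕ) (U : Finset V),
      (chainFrom I cov U a).length = a.length + 1 := by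
    intro cov a
    induction a with
    | nil => intro U; rfl
    | cons j a ih => intro U; simp [chainFrom, ih]
  exact this _ _ _

theorem chain_length_le (hI : I.Admissible) (hd : I.d ≤ Fintype.card V) (O : Oracle I)
    {a : List ℕ} (ha : O.IsNode a) :
    ((O.chain a).length : ℝ) ≤ 2 * Real.logb 2 I.n / Real.logb 2 I.d := by
  have hd2 := hI.two_le_d'
  have hdn : (I.d : ℝ) ≤ I.n := Nat.cast_le.2 hd
  have hD : 1 ≤ Real.logb 2 I.d := by
    rw [Real.le_logb_iff_rpow_le one_lt_two (by linarith), Real.rpow_one]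
    exact hd2
  have hDN : Real.logb 2 I.d ≤ Real.logb 2 I.n :=
    (Real.logb_le_logb one_lt_two (by linarith) (by linarith)).2 hdn
  rw [chain_length, le_div_iff₀ (by linarith)]
  by_cases hne : a = []
  · subst hne
    simp only [List.length_nil, Nat.cast_add, Nat.cast_zero, Nat.cast_one]
    linarith
  · have h := pow_length_mul_le hI O.cov_spec ha hne
    rw [Finset.card_univ, ← Real.rpow_natCast, ← Real.rpow_mul (by linarith),
      ← Real.rpow_add_one (by linarith)] at h
    have h2 := (Real.logb_le_logb one_lt_two (by positivity)
      (show (0 : ℝ) < I.n by linarith)).2 h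
    rw [Real.logb_rpow_eq_mul_logb_of_pos (by linarith)] at h2
    have hl : (0 : ℝ) ≤ a.length := Nat.cast_nonneg _
    have hc : (a.length : ℝ) ≤ I.c * a.length := by nlinarith [hI.one_le_c]
    have h3 : ((a.length : ℝ) + 1) * Real.logb 2 I.d ≤ (I.c * a.length + 1) * Real.logb 2 I.d :=
      mul_le_mul_of_nonneg_right (by linarith) (by linarith)
    change _ ≤ Real.logb 2 I.n at h2
    push_cast
    linarith

theorem pow_length_le (hI : I.Admissible) (O : Oracle I)
    {a : List ℕ} (ha : O.IsNode a) : (I.d : ℝ) ^ a.length ≤ I.n ^ (1 / I.c) := by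
  have hd2 := hI.two_le_d'
  have hc := hI.one_le_c
  have hn := hI.three_le_n
  by_cases hne : a = []
  · subst hne
    simpa using Real.one_le_rpow (by linarith : 1 ≤ I.n) (by positivity : 0 ≤ I.c⁻¹)
  · have h := pow_length_mul_le hI O.cov_spec ha hne
    rw [Finset.card_univ] at h
    have h1 : ((I.d : ℝ) ^ I.c) ^ a.length ≤ I.n := by
      refine le_trans ?_ h
      have : (0 : ℝ) ≤ ((I.d : ℝ) ^ I.c) ^ a.length := by positivity
      nlinarith
    have h2 := Real.rpow_le_rpow (by positivity) h1 (by positivity : 0 ≤ 1 / I.c)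
    rwa [← Real.rpow_natCast, ← Real.rpow_mul (by positivity), ← Real.rpow_mul (by positivity),
      show I.c * (a.length * (1 / I.c)) = a.length by field_simp, Real.rpow_natCast] at h2

/-- The lists of length `l` with entries between `1` and `d`. -/
def addresses (d : ℕ) : ℕ → Finset (List ℕ)
  | 0 => {[]}
  | l + 1 => (Finset.Icc 1 d ×ˢ addresses d l).image fun q => q.1 :: q.2

theorem card_addresses_le (d l : ℕ) : (addresses d l).card ≤ d ^ l := by
  induction l with
  | zero => simp [addresses]
  | succ l ih =>
    refine Finset.card_image_le.trans ?_
    rw [Finset.card_product, Nat.card_Icc, Nat.add_sub_cancel, pow_succ']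
    exact Nat.mul_le_mul_left d ih

theorem mem_addresses {cov : Finset V → Finset V → V → I.G.Subgraph} {U : Finset V}
    {a : List ℕ} (ha : AddressFrom I cov U a) : a ∈ addresses I.d a.length := by
  induction a generalizing U with
  | nil => simp [addresses]
  | cons j a ih =>
    obtain ⟨-, h1, h2, h3⟩ := ha
    exact Finset.mem_image.2 ⟨(j, a),
      Finset.mem_product.2 ⟨Finset.mem_Icc.2 ⟨h1, h2⟩, ih h3⟩, rfl⟩

/-- There are at most `d^l` addresses of length `l`, none with `d^l > n^{1/c}`, and the geometric
sum is at most twice its last term. -/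
theorem encard_nodes_le (hI : I.Admissible) (O : Oracle I) :
    ((ENat.card {a // O.IsNode a} : ℕ∞) : ℝ≥0∞) ≤ ENNReal.ofReal (2 * I.n ^ (1 / I.c)) := by
  classical
  have hd := hI.two_le_d
  have hn := hI.three_le_n
  have h1n : 1 ≤ I.n ^ (1 / I.c) :=
    Real.one_le_rpow (by linarith) (by have := hI.one_le_c; positivity)
  set m := Nat.findGreatest (fun l => (I.d : ℝ) ^ l ≤ I.n ^ (1 / I.c)) ⌊I.n ^ (1 / I.c)⌋₊ with hm
  have hmax : ∀ l, (I.d : ℝ) ^ l ≤ I.n ^ (1 / I.c) → l ≤ m := by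
    intro l hl
    refine Nat.le_findGreatest (Nat.le_floor (le_trans ?_ hl)) hl
    exact_mod_cast (Nat.lt_pow_self (by omega : 1 < I.d)).le
  have hmm : (I.d : ℝ) ^ m ≤ I.n ^ (1 / I.c) :=
    Nat.findGreatest_spec (P := fun l => (I.d : ℝ) ^ l ≤ I.n ^ (1 / I.c))
      (Nat.zero_le _) (by simpa using h1n)
  have hsub : {a | O.IsNode a} ⊆ ((Finset.range (m + 1)).biUnion (addresses I.d) : Set (List ℕ)) := by
    intro a ha
    exact Finset.mem_coe.2 (Finset.mem_biUnion.2 ⟨a.length, Finset.mem_range.2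
      (Nat.lt_succ_of_le (hmax _ (pow_length_le hI O ha))), mem_addresses ha⟩)
  have hgeom : ∀ m, ∑ l ∈ Finset.range (m + 1), I.d ^ l ≤ 2 * I.d ^ m := by
    intro m
    induction m with
    | zero => simp
    | succ m ih =>
      rw [Finset.sum_range_succ, pow_succ]
      nlinarith [Nat.zero_le (I.d ^ m)]
  have hcard : ((Finset.range (m + 1)).biUnion (addresses I.d)).card ≤ 2 * I.d ^ m :=
    (Finset.card_biUnion_le.trans (Finset.sum_le_sum fun l _ => card_addresses_le _ _)).trans
      (hgeom m)
  have hen : (ENat.card {a // O.IsNode a} : ℕ∞) ≤ ((2 * I.d ^ m : ℕ) : ℕ∞) := by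
    change {a | O.IsNode a}.encard ≤ _
    refine (Set.encard_le_encard hsub).trans ?_
    rw [Set.encard_coe_eq_coe_finsetCard]
    exact_mod_cast hcard
  calc ((ENat.card {a // O.IsNode a} : ℕ∞) : ℝ≥0∞) ≤ (((2 * I.d ^ m : ℕ) : ℕ∞) : ℝ≥0∞) :=
        ENat.toENNReal_le.2 hen
    _ = ENNReal.ofReal ((2 * I.d ^ m : ℕ) : ℝ) := by
        rw [ENNReal.ofReal_natCast, ENat.toENNReal_coe]
    _ ≤ _ := ENNReal.ofReal_le_ofReal (by push_cast; linarith)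

theorem sum_verts_le (hI : I.Admissible) (O : Oracle I) (a : List ℕ) (i : ℕ) :
    ((∑ r ∈ O.roots a i, (O.tree a i r).verts.ncard : ℕ) : ℝ) ≤
      I.n * (I.k * Real.exp 1 * (I.k + 1)) := by
  classical
  have hdis : Disjoint (nth (O.chain a) (i + 1)) (O.roots a i) := by
    rw [Oracle.roots]
    exact Finset.disjoint_sdiff
  obtain ⟨-, -, hover⟩ := O.cov_spec _ _ hdis
  have h1 : ∑ r ∈ O.roots a i, (O.tree a i r).verts.ncard =
      ∑ x : V, ((O.roots a i).filter fun r => x ∈ (O.tree a i r).verts).card := by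
    refine Eq.trans ?_ (Finset.sum_card_bipartiteAbove_eq_sum_card_bipartiteBelow
      (s := O.roots a i) (t := Finset.univ) (fun r x => x ∈ (O.tree a i r).verts))
    refine Finset.sum_congr rfl fun r _ => ?_
    rw [← Set.ncard_coe_finset]
    congr 1
    ext x
    simp [Finset.bipartiteAbove]
  rw [h1, Nat.cast_sum]
  calc _ ≤ ∑ x : V, I.k * Real.exp 1 * (I.k + 1) := by
        refine Finset.sum_le_sum fun x _ => ?_
        have := hover x
        rw [hI.n_rpow, ← Input.k] at this
        refine le_trans (le_of_eq ?_) this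
        rw [← Set.ncard_coe_finset]
        congr 2
        ext r
        rw [Finset.mem_coe, Finset.mem_filter]
        rfl
    _ = _ := by
        rw [Finset.sum_const, nsmul_eq_mul, Finset.card_univ, Input.n]

-- The decision trees account for 16 of the constant 42, the distance matrices, tables and covers
-- for 26. The latter are far smaller and are absorbed because `(PN)² ≤ b^(d+1)`; `96 = 2 · 24 · 2`
-- collects the constants in `b = 2ΛP`.
set_option maxHeartbeats 1000000 in
theorem nodeWords_le (hI : I.Admissible) (hd : I.d ≤ Fintype.card V) (O : Oracle I)
    {a : List ℕ} (ha : O.IsNode a) : (O.nodeWords a : ℝ) ≤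
      42 * I.n ^ 2 * (Real.logb 2 I.d / Real.logb 2 I.n) *
        (96 * I.ε⁻¹ * Real.logb 2 I.n ^ 2 * Real.logb 2 (I.n * I.W) / Real.logb 2 I.d) ^
          (I.d + 1) := by
  have hd2 := hI.two_le_d'
  have hn := hI.three_le_n
  have hε := hI.ε_pos
  have hk := hI.one_lt_k
  have hdn : (I.d : ℝ) ≤ I.n := Nat.cast_le.2 hd
  have hD : 1 ≤ Real.logb 2 I.d := by
    rw [Real.le_logb_iff_rpow_le one_lt_two (by linarith), Real.rpow_one]
    exact hd2
  have hDN : Real.logb 2 I.d ≤ Real.logb 2 I.n :=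
    (Real.logb_le_logb one_lt_two (by linarith) (by linarith)).2 hdn
  have hM : Real.logb 2 I.n ≤ Real.logb 2 (I.n * I.W) :=
    (Real.logb_le_logb one_lt_two (by linarith) (by linarith [hI.one_le_nW])).2
      (le_mul_of_one_le_right (by linarith) hI.one_le_W)
  have hP := chain_length_le hI hd O ha
  have hLg := hI.logb_le
  have hkN : I.k ≤ Real.logb 2 I.n := by
    rw [Real.logb, le_div_iff₀ (Real.log_pos one_lt_two), ← Input.k]
    nlinarith [Real.log_two_lt_d9]
  set N := Real.logb 2 I.n
  set D := Real.logb 2 I.d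
  set M := Real.logb 2 (I.n * I.W)
  set Λ := 24 * I.ε⁻¹ * N * M with hΛ
  set P := 2 * N / D with hPdef
  have hε' : 1 ≤ I.ε⁻¹ := (one_le_inv₀ hε).2 hI.ε_lt_one.le
  have hN1 : 1 ≤ N := hD.trans hDN
  have hM1 : 1 ≤ M := hN1.trans hM
  have hΛN : 24 * N ≤ Λ := by
    have : 1 ≤ I.ε⁻¹ * M := by nlinarith
    calc 24 * N = 24 * N * 1 := by ring
      _ ≤ 24 * N * (I.ε⁻¹ * M) := mul_le_mul_of_nonneg_left this (by linarith)
      _ = Λ := by rw [hΛ]; ring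
  have hP2 : 2 ≤ P := by
    rw [hPdef, le_div_iff₀ (by linarith)]
    linarith
  set b := 2 * Λ * P with hb
  have hbX : 96 * I.ε⁻¹ * N ^ 2 * M / D = b := by
    rw [hb, hΛ, hPdef]; ring
  have hb2 : 2 ≤ b := by nlinarith
  have hLg0 : 0 ≤ Real.logb (1 + I.ε₅) (I.n * I.W) :=
    Real.logb_nonneg (by linarith [hI.ε₅_pos]) hI.one_le_nW
  have hB : (I.B : ℝ) ≤ 2 * Λ := by
    have := (Nat.ceil_lt_add_one hLg0).le
    change (I.B : ℝ) ≤ _ at this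
    linarith
  have hbr : 2 * Real.logb (1 + I.ε₅) (I.n * I.W) * (O.chain a).length ≤ b := by
    rw [hb]
    exact mul_le_mul (by linarith) hP (Nat.cast_nonneg _) (by linarith)
  have hbd : 0 < b ^ I.d := by positivity
  have htw : ∀ x y, (O.treeWords a x y I.d ∅ : ℝ) ≤ 64 * Λ * b ^ I.d := by
    intro x y
    have h := treeWords_le hI O a hb2 hbr x y I.d ∅
    have h2 : (12 + 10 * (I.B : ℝ)) * (2 * b ^ I.d - 1) ≤ (32 * Λ) * (2 * b ^ I.d) := by
      refine mul_le_mul (by linarith) (by linarith) ?_ (by linarith)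
      have : 1 ≤ b ^ I.d := one_le_pow₀ (by linarith)
      linarith
    linarith
  have hcard : ((Fintype.card V : ℕ) : ℝ) = I.n := rfl
  have h1 : ((∑ x : V, ∑ y : V, O.treeWords a x y I.d ∅ : ℕ) : ℝ) ≤
      I.n ^ 2 * (64 * Λ * b ^ I.d) := by
    push_cast
    refine (Finset.sum_le_sum fun x _ => Finset.sum_le_sum fun y _ => htw x y).trans ?_
    simp only [Finset.sum_const, Finset.card_univ, nsmul_eq_mul, hcard]
    exact le_of_eq (by ring)
  have h2 : ((∑ i ∈ Finset.Icc 1 (O.chain a).length, ∑ r ∈ O.roots a i,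
      4 * (O.tree a i r).verts.ncard : ℕ) : ℝ) ≤ P * (24 * I.n * N ^ 2) := by
    have hi : ∀ i, ((∑ r ∈ O.roots a i, 4 * (O.tree a i r).verts.ncard : ℕ) : ℝ) ≤
        24 * I.n * N ^ 2 := by
      intro i
      have h := sum_verts_le hI O a i
      rw [← Finset.mul_sum, Nat.cast_mul]
      have he : I.k * Real.exp 1 * (I.k + 1) ≤ N * 3 * (2 * N) := by
        have := Real.exp_one_lt_three
        have := Real.exp_pos 1
        gcongr
        linarith
      have h' := h.trans (mul_le_mul_of_nonneg_left he (by linarith : 0 ≤ I.n))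
      push_cast at h' ⊢
      linarith
    rw [Nat.cast_sum]
    refine (Finset.sum_le_sum fun i _ => hi i).trans ?_
    rw [Finset.sum_const, Nat.card_Icc, nsmul_eq_mul, Nat.add_sub_cancel]
    exact mul_le_mul_of_nonneg_right hP (by positivity)
  have h3 : ((O.chain a).length : ℝ) * I.n ^ 2 ≤ P * I.n ^ 2 :=
    mul_le_mul_of_nonneg_right hP (by positivity)
  have hN2 : 1 ≤ N ^ 2 := one_le_pow₀ hN1
  have hrest : P * I.n ^ 2 + 2 * I.n + P * (24 * I.n * N ^ 2) ≤ 26 * I.n ^ 2 * (P * N ^ 2) := by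
    have e1 : P * I.n ^ 2 ≤ I.n ^ 2 * (P * N ^ 2) := by
      have := mul_le_mul_of_nonneg_left hN2 (show 0 ≤ P * I.n ^ 2 by positivity)
      linarith
    have e2 : I.n ≤ I.n ^ 2 := by nlinarith
    have e3 : 2 * I.n ≤ P * I.n ^ 2 := mul_le_mul hP2 e2 (by linarith) (by linarith)
    have e4 : P * (24 * I.n * N ^ 2) ≤ 24 * I.n ^ 2 * (P * N ^ 2) := by
      have := mul_le_mul_of_nonneg_left e2 (show 0 ≤ 24 * (P * N ^ 2) by positivity)
      linarith
    linarith
  have hkey : P * N ^ 2 ≤ b ^ (I.d + 1) * (D / N) := by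
    have hDNP : D / N = 2 / P := by
      rw [hPdef]
      field_simp
    have hbPN : P * N ≤ b := by
      rw [hb]
      nlinarith
    have e1 : (P * N) ^ 2 ≤ b ^ (I.d + 1) :=
      (pow_le_pow_left₀ (by positivity) hbPN 2).trans
        (pow_le_pow_right₀ (by linarith) (by have := hI.two_le_d; omega))
    rw [hDNP, mul_div_assoc', le_div_iff₀ (by linarith)]
    have : 0 ≤ b ^ (I.d + 1) := by positivity
    nlinarith
  have htree : 64 * Λ * b ^ I.d = 16 * (D / N) * b ^ (I.d + 1) := by
    rw [pow_succ, hb, hPdef]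
    field_simp
    ring
  rw [hbX, Oracle.nodeWords, Nat.cast_add, Nat.cast_add, Nat.cast_add, Nat.cast_mul, Nat.cast_mul,
    Nat.cast_pow, hcard]
  rw [htree] at h1
  have h4 := mul_le_mul_of_nonneg_left hkey (show 0 ≤ 26 * I.n ^ 2 by positivity)
  refine (add_le_add (add_le_add (add_le_add h1 h3) le_rfl) h2).trans ?_
  rw [Nat.cast_ofNat]
  linarith

/-- The space bound. -/
theorem space_le (hI : I.Admissible) (hd : I.d ≤ Fintype.card V) (O : Oracle I) :
    O.space ≤ ENNReal.ofReal (I.n ^ (2 + 1 / I.c) * (Real.logb 2 I.d / Real.logb 2 I.n) *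
      (8064 * I.ε⁻¹ * Real.logb 2 I.n ^ 2 * Real.logb 2 (I.n * I.W) / Real.logb 2 I.d) ^
        (I.d + 1)) := by
  have hn := hI.three_le_n
  have hε := hI.ε_pos
  have hD0 : 0 ≤ Real.logb 2 I.d := Real.logb_nonneg one_lt_two (by linarith [hI.two_le_d'])
  have hN0 : 0 ≤ Real.logb 2 I.n := Real.logb_nonneg one_lt_two (by linarith)
  have hM0 : 0 ≤ Real.logb 2 (I.n * I.W) := Real.logb_nonneg one_lt_two hI.one_le_nW
  set X := I.ε⁻¹ * Real.logb 2 I.n ^ 2 * Real.logb 2 (I.n * I.W) / Real.logb 2 I.d with hX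
  have hX0 : 0 ≤ X := by positivity
  have hX' : ∀ c : ℝ, c * I.ε⁻¹ * Real.logb 2 I.n ^ 2 * Real.logb 2 (I.n * I.W) /
      Real.logb 2 I.d = c * X := fun c => by rw [hX]; ring
  have h1 : O.space ≤ ∑' _ : {a // O.IsNode a}, ENNReal.ofReal
      (42 * I.n ^ 2 * (Real.logb 2 I.d / Real.logb 2 I.n) * (96 * X) ^ (I.d + 1)) := by
    refine ENNReal.tsum_le_tsum fun a => ?_
    rw [← ENNReal.ofReal_natCast]
    refine ENNReal.ofReal_le_ofReal ?_
    rw [← hX']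
    exact nodeWords_le hI hd O a.2
  refine h1.trans ?_
  rw [ENNReal.tsum_const]
  refine (mul_le_mul_left (encard_nodes_le hI O) _).trans ?_
  rw [← ENNReal.ofReal_mul (by positivity)]
  refine ENNReal.ofReal_le_ofReal ?_
  rw [hX', Real.rpow_add (by linarith), Real.rpow_two]
  have e : (8064 * X) ^ (I.d + 1) = 84 ^ (I.d + 1) * (96 * X) ^ (I.d + 1) := by
    rw [← mul_pow]; ring
  -- `84 = 2 · 42` is the factor from the number of nodes times that from one node. It moves into
  -- the base, and `8064 = 84 · 96`.
  have h84 : (84 : ℝ) ≤ 84 ^ (I.d + 1) := le_self_pow₀ (by norm_num) (by omega)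
  have h96 : 0 ≤ (96 * X) ^ (I.d + 1) := by positivity
  rw [e]
  have hpos : 0 ≤ I.n ^ 2 * I.n ^ (1 / I.c) * (Real.logb 2 I.d / Real.logb 2 I.n) *
      (96 * X) ^ (I.d + 1) := by positivity
  have := mul_le_mul_of_nonneg_left h84 hpos
  linarith

end Space

end VSDO

namespace VSDO

/-! ### Tree covers: sampling the sources -/

section Hitting

theorem exists_closest {α β : Type*} [LinearOrder β] (A : Finset α) (f : α → β) {m : ℕ}
    (hm : m ≤ A.card) :
    ∃ N ⊆ A, N.card = m ∧ ∀ a ∈ N, ∀ a' ∈ A, a' ∉ N → f a ≤ f a' := by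
  classical
  induction m with
  | zero => exact ⟨∅, by simp⟩
  | succ m ih =>
    obtain ⟨N, hNA, hN, hle⟩ := ih (by omega)
    have hne : (A \ N).Nonempty := by
      rw [← Finset.card_pos, Finset.card_sdiff_of_subset hNA]
      omega
    obtain ⟨x, hx, hmin⟩ := Finset.exists_min_image _ f hne
    rw [Finset.mem_sdiff] at hx
    refine ⟨insert x N, Finset.insert_subset hx.1 hNA, by rw [Finset.card_insert_of_notMem hx.2, hN],
      fun a ha a' ha' hn => ?_⟩
    rw [Finset.mem_insert, not_or] at hn
    rcases Finset.mem_insert.1 ha with rfl | ha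
    · exact hmin a' (Finset.mem_sdiff.2 ⟨ha', hn.2⟩)
    · exact hle a ha a' ha' hn.2

-- Averaging: some element of `A` belongs to at least the fraction `M/|A|` of the sets not yet hit.
-- Adding it leaves at most the fraction `1 - M/|A|` of them.
open scoped Classical in
theorem exists_partial_hitting {ι α : Type*} (s : Finset ι) (A : Finset α) (F : ι → Finset α)
    (hF : ∀ v ∈ s, F v ⊆ A) {M : ℝ} (hM : ∀ v ∈ s, M ≤ (F v).card) (hMA : M ≤ A.card)
    (hA : A.Nonempty) (t : ℕ) :
    ∃ B ⊆ A, B.card ≤ t ∧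
      ((s.filter fun v => Disjoint (F v) B).card : ℝ) ≤ s.card * (1 - M / A.card) ^ t := by
  have hA0 : (0 : ℝ) < A.card := by exact_mod_cast hA.card_pos
  induction t with
  | zero => exact ⟨∅, by simp⟩
  | succ t ih =>
    obtain ⟨B, hBA, hBt, hB⟩ := ih
    set U := s.filter fun v => Disjoint (F v) B with hU
    obtain ⟨b, hbA, hb⟩ : ∃ b ∈ A, M / A.card * U.card ≤ ((U.filter fun v => b ∈ F v).card : ℝ) := by
      refine Finset.exists_le_of_sum_le hA ?_
      have hcount := Finset.sum_card_bipartiteAbove_eq_sum_card_bipartiteBelow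
        (s := U) (t := A) fun v b => b ∈ F v
      have hbel : ∑ b ∈ A, ((U.filter fun v => b ∈ F v).card : ℝ) = ∑ v ∈ U, ((F v).card : ℝ) := by
        rw [← Nat.cast_sum, ← Nat.cast_sum]
        refine congrArg _ (Eq.trans hcount.symm (Finset.sum_congr rfl fun v hv => congrArg _ ?_))
        ext b
        simp only [Finset.mem_bipartiteAbove, and_iff_right_iff_imp]
        exact fun h => hF v (Finset.mem_filter.1 hv).1 h
      rw [hbel, Finset.sum_const, nsmul_eq_mul, ← mul_assoc, mul_div_cancel₀ _ hA0.ne', mul_comm,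
        ← nsmul_eq_mul]
      exact Finset.card_nsmul_le_sum _ _ _ fun v hv => hM v (Finset.mem_filter.1 hv).1
    refine ⟨insert b B, Finset.insert_subset hbA hBA,
      (Finset.card_insert_le _ _).trans (by omega), ?_⟩
    have hsub : (s.filter fun v => Disjoint (F v) (insert b B)) =
        U \ U.filter fun v => b ∈ F v := by
      ext v
      simp only [hU, Finset.mem_filter, Finset.mem_sdiff, Finset.disjoint_insert_right]
      tauto
    rw [hsub, Finset.card_sdiff_of_subset (Finset.filter_subset _ _),
      Nat.cast_sub (Finset.card_le_card (Finset.filter_subset _ _)), pow_succ, ← mul_assoc]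
    have h0 : 0 ≤ 1 - M / A.card := by
      rw [sub_nonneg, div_le_one hA0]
      exact hMA
    nlinarith [mul_le_mul_of_nonneg_right hB h0]

/-- The greedy hitting set. -/
theorem exists_hitting {ι α : Type*} (s : Finset ι) (A : Finset α) (F : ι → Finset α)
    (hF : ∀ v ∈ s, F v ⊆ A) {M n : ℝ} (hM0 : 0 < M) (hM : ∀ v ∈ s, M ≤ (F v).card)
    (hn : 1 < n) (hs : s.card ≤ n) :
    ∃ B ⊆ A, B.card * M ≤ A.card * (Real.log n + 1) ∧ ∀ v ∈ s, ∃ b ∈ B, b ∈ F v := by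
  classical
  have hlog : 0 < Real.log n := Real.log_pos hn
  rcases s.eq_empty_or_nonempty with rfl | ⟨v₀, hv₀⟩
  · refine ⟨∅, by simp, ?_, by simp⟩
    simp only [Finset.card_empty, Nat.cast_zero, zero_mul]
    positivity
  have hMA : M ≤ A.card :=
    (hM v₀ hv₀).trans (Nat.cast_le.2 (Finset.card_le_card (hF v₀ hv₀)))
  have hA0 : (0 : ℝ) < A.card := hM0.trans_le hMA
  set t := ⌈A.card / M * Real.log n⌉₊ with ht
  obtain ⟨B, hBA, hBt, hB⟩ := exists_partial_hitting s A F hF hM hMA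
    (Finset.card_pos.1 (by exact_mod_cast hA0)) t
  have ht1 : A.card / M * Real.log n ≤ t := Nat.le_ceil _
  have ht2 : (t : ℝ) < A.card / M * Real.log n + 1 := Nat.ceil_lt_add_one (by positivity)
  have ht0 : t ≠ 0 := by
    intro h
    rw [h, Nat.cast_zero] at ht1
    have : 0 < A.card / M * Real.log n := by positivity
    linarith
  refine ⟨B, hBA, ?_, ?_⟩
  · have h1 : (B.card : ℝ) ≤ A.card / M * Real.log n + 1 :=
      (Nat.cast_le.2 hBt).trans ht2.le
    calc (B.card : ℝ) * M ≤ (A.card / M * Real.log n + 1) * M := by gcongr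
      _ = A.card * Real.log n + M := by field_simp
      _ ≤ A.card * (Real.log n + 1) := by linarith
  -- The inequality must be strict, so that less than one set remains unhit. It comes from `1 - x <
  -- exp(-x)` for `x > 0` and from `t ≠ 0`.
  · have hr : (1 - M / A.card) ^ t < 1 / n := by
      have h0 : 0 ≤ 1 - M / A.card := by
        rw [sub_nonneg, div_le_one hA0]
        exact hMA
      have hx : 0 < M / A.card := by positivity
      have h1 : 1 - M / A.card < Real.exp (-(M / A.card)) := by
        have := Real.add_one_lt_exp (x := -(M / A.card)) (by linarith)
        linarith
      calc (1 - M / A.card) ^ t < Real.exp (-(M / A.card)) ^ t := pow_lt_pow_left₀ h1 h0 ht0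
        _ = Real.exp (-(M / A.card * t)) := by
          rw [← Real.exp_nat_mul]
          ring_nf
        _ ≤ Real.exp (-Real.log n) := by
          refine Real.exp_le_exp.2 (neg_le_neg ?_)
          calc Real.log n = M / A.card * (A.card / M * Real.log n) := by field_simp
            _ ≤ M / A.card * t := by gcongr
        _ = 1 / n := by rw [Real.exp_neg, Real.exp_log (by linarith), one_div]
    have hlt : ((s.filter fun v => Disjoint (F v) B).card : ℝ) < 1 := by
      have hs0 : (0 : ℝ) < s.card := by exact_mod_cast Finset.card_pos.2 ⟨v₀, hv₀⟩
      calc _ ≤ s.card * (1 - M / A.card) ^ t := hB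
        _ < s.card * (1 / n) := by gcongr
        _ ≤ n * (1 / n) := by gcongr
        _ = 1 := by field_simp
    have hemp : (s.filter fun v => Disjoint (F v) B) = ∅ := by
      rw [← Finset.card_eq_zero]
      have : (s.filter fun v => Disjoint (F v) B).card < 1 := by exact_mod_cast hlt
      omega
    intro v hv
    by_contra hc
    push Not at hc
    have : v ∈ s.filter fun v => Disjoint (F v) B :=
      Finset.mem_filter.2 ⟨hv, Finset.disjoint_right.2 fun b hb => hc b hb⟩
    simp [hemp] at this

open scoped Classical in
/-- A few elements `B` of `A` such that every point is closer than `B` to only a few others. -/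
theorem exists_sample {V : Type u} [Fintype V] (d : V → V → ℝ≥0∞) (A : Finset V) {M n : ℝ}
    (hM : 0 < M) (hn : 1 < n) (hV : Fintype.card V ≤ n) :
    ∃ B ⊆ A, B.card * M ≤ A.card * (Real.log n + 1) ∧
      ∀ v, ((A.filter fun a => d a v ≠ ⊤ ∧ ∀ b ∈ B, d a v < d b v).card : ℝ) ≤ M := by
  set m := ⌈M⌉₊ with hm
  have hmM : M ≤ m := Nat.le_ceil M
  have hmM' : (m : ℝ) < M + 1 := Nat.ceil_lt_add_one hM.le
  -- `F v` consists of the `m` closest elements of `A`, if that many are reachable from `v`; hitting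
  -- it leaves at most `m - 1 < M` elements closer than `B`. With fewer reachable elements the bound
  -- at `v` holds for any `B`.
  have hF : ∀ v, ∃ N : Finset V, m ≤ (A.filter fun a => d a v ≠ ⊤).card →
      N ⊆ A.filter (fun a => d a v ≠ ⊤) ∧ N.card = m ∧
        ∀ a ∈ N, ∀ a' ∈ A.filter (fun a => d a v ≠ ⊤), a' ∉ N → d a v ≤ d a' v := by
    intro v
    by_cases h : m ≤ (A.filter fun a => d a v ≠ ⊤).card
    · obtain ⟨N, hN⟩ := exists_closest _ (fun a => d a v) h
      exact ⟨N, fun _ => hN⟩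
    · exact ⟨∅, fun h' => absurd h' h⟩
  choose F hF using hF
  set s := Finset.univ.filter fun v => m ≤ (A.filter fun a => d a v ≠ ⊤).card with hs
  have hmem : ∀ v ∈ s, m ≤ (A.filter fun a => d a v ≠ ⊤).card := fun v hv =>
    (Finset.mem_filter.1 hv).2
  obtain ⟨B, hBA, hB, hhit⟩ := exists_hitting s A F
    (fun v hv => (hF v (hmem v hv)).1.trans (Finset.filter_subset _ _)) hM
    (fun v hv => by rw [(hF v (hmem v hv)).2.1]; exact hmM) hn
    ((Nat.cast_le.2 (Finset.card_le_univ s)).trans hV)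
  refine ⟨B, hBA, hB, fun v => ?_⟩
  by_cases hv : m ≤ (A.filter fun a => d a v ≠ ⊤).card
  · obtain ⟨b, hbB, hbF⟩ := hhit v (Finset.mem_filter.2 ⟨Finset.mem_univ v, hv⟩)
    obtain ⟨hFA, hFm, hFle⟩ := hF v hv
    have hsub : (A.filter fun a => d a v ≠ ⊤ ∧ ∀ b ∈ B, d a v < d b v) ⊆ (F v).erase b := by
      intro a ha
      obtain ⟨haA, hat, hab⟩ := Finset.mem_filter.1 ha
      refine Finset.mem_erase.2 ⟨fun h => ?_, ?_⟩
      · exact absurd (hab b hbB) (by rw [h]; exact lt_irrefl _)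
      · by_contra hc
        exact absurd (hab b hbB) (not_lt.2 (hFle b hbF a (Finset.mem_filter.2 ⟨haA, hat⟩) hc))
    have hcard := Finset.card_le_card hsub
    rw [Finset.card_erase_of_mem hbF, hFm] at hcard
    have hm0 : 0 < m := Nat.ceil_pos.2 hM
    have : ((A.filter fun a => d a v ≠ ⊤ ∧ ∀ b ∈ B, d a v < d b v).card : ℝ) + 1 ≤ m := by
      rw [← Nat.cast_add_one]
      exact Nat.cast_le.2 (by omega)
    linarith
  · have hsub : (A.filter fun a => d a v ≠ ⊤ ∧ ∀ b ∈ B, d a v < d b v) ⊆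
        A.filter fun a => d a v ≠ ⊤ :=
      Finset.monotone_filter_right _ fun a _ h => h.1
    have hcard := Finset.card_le_card hsub
    have : ((A.filter fun a => d a v ≠ ⊤ ∧ ∀ b ∈ B, d a v < d b v).card : ℝ) + 1 ≤ m := by
      rw [← Nat.cast_add_one]
      exact Nat.cast_le.2 (by omega)
    linarith

/-- The points that are strictly closer to `r` than to all sources of higher level. -/
def cluster {V : Type u} (d : V → V → ℝ≥0∞) (A : Finset V) (lev : V → ℕ) (r : V) : Set V :=
  {v | d r v ≠ ⊤ ∧ ∀ a ∈ A, lev r < lev a → d r v < d a v}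

open scoped Classical in
/-- The sources can be given levels in such a way that every point is in few clusters. -/
theorem exists_levels {V : Type u} [Fintype V] (d : V → V → ℝ≥0∞) {n : ℝ} (hn : 1 < n)
    (hV : Fintype.card V ≤ n) (j : ℕ) (A : Finset V)
    (hA : A.card ≤ Real.exp 1 * (Real.log n + 1) * Real.exp j) :
    ∃ lev : V → ℕ, (∀ a ∈ A, lev a ≤ j) ∧
      ∀ v, ((A.filter fun a => v ∈ cluster d A lev a).card : ℝ) ≤
        (j + 1) * (Real.exp 1 * (Real.log n + 1)) := by
  have hlog : 0 < Real.log n := Real.log_pos hn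
  induction j generalizing A with
  | zero =>
    refine ⟨fun _ => 0, by simp, fun v => ?_⟩
    refine (Nat.cast_le.2 (Finset.card_filter_le _ _)).trans (hA.trans (by simp))
  | succ j ih =>
    -- This value of `M` makes `|B| ≤ |A|/e`, so one level is spent on each factor `e`, and it is
    -- also the number of new clusters a point can fall into.
    obtain ⟨B, hBA, hB, hcount⟩ := exists_sample d A
      (M := Real.exp 1 * (Real.log n + 1)) (by positivity) hn hV
    obtain ⟨lev, hlev, hover⟩ := ih B (by
      have h1 : (B.card : ℝ) * Real.exp 1 ≤ A.card := by
        refine le_of_mul_le_mul_right (a := Real.log n + 1) ?_ (by positivity)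
        linarith
      refine le_of_mul_le_mul_right (a := Real.exp 1) ?_ (Real.exp_pos 1)
      refine h1.trans (hA.trans (le_of_eq ?_))
      rw [Nat.cast_add, Nat.cast_one, Real.exp_add]
      ring)
    set lev' : V → ℕ := fun a => if a ∈ B then lev a + 1 else 0 with hlev'
    have hin : ∀ a ∈ B, lev' a = lev a + 1 := fun a ha => if_pos ha
    have hout : ∀ a ∉ B, lev' a = 0 := fun a ha => if_neg ha
    refine ⟨lev', fun a _ => ?_, fun v => ?_⟩
    · by_cases ha : a ∈ B
      · rw [hin a ha]
        exact Nat.succ_le_succ (hlev a ha)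
      · rw [hout a ha]
        exact Nat.zero_le _
    -- All sources of positive new level are in `B`, so the cluster of an element of `B` is the one
    -- formed inside `B`. A source outside `B` competes with all of `B`.
    · have hsub : (A.filter fun a => v ∈ cluster d A lev' a) ⊆
          (B.filter fun a => v ∈ cluster d B lev a) ∪
            A.filter fun a => d a v ≠ ⊤ ∧ ∀ b ∈ B, d a v < d b v := by
        intro a ha
        obtain ⟨haA, hav, hlt⟩ := Finset.mem_filter.1 ha
        rw [Finset.mem_union, Finset.mem_filter, Finset.mem_filter]
        by_cases haB : a ∈ B
        · refine Or.inl ⟨haB, hav, fun b hb hl => hlt b (hBA hb) ?_⟩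
          rw [hin a haB, hin b hb]
          omega
        · refine Or.inr ⟨haA, hav, fun b hb => hlt b (hBA hb) ?_⟩
          rw [hout a haB, hin b hb]
          omega
      have hcard := (Finset.card_le_card hsub).trans (Finset.card_union_le _ _)
      have h1 := hover v
      have h2 := hcount v
      have h3 : ((A.filter fun a => v ∈ cluster d A lev' a).card : ℝ) ≤
          ((B.filter fun a => v ∈ cluster d B lev a).card : ℝ) +
            ((A.filter fun a => d a v ≠ ⊤ ∧ ∀ b ∈ B, d a v < d b v).card : ℝ) := by
        exact_mod_cast hcard
      rw [Nat.cast_add, Nat.cast_one]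
      linarith

/-- Two sources-to-point distances that add up to at most `2K + 1` times the distance, in a common
cluster. -/
theorem exists_common_cluster {V : Type u} {d : V → V → ℝ≥0∞} {A : Finset V} {lev : V → ℕ} {K : ℕ}
    (hlev : ∀ a ∈ A, lev a ≤ K) (htri : ∀ a b c, d a c ≤ d a b + d b c)
    (hcomm : ∀ a b, d a b = d b a) {j : ℕ} {r u v : V} (hr : r ∈ A) (hj : j ≤ lev r)
    (hu : u ∈ cluster d A lev r) (hru : d r u ≤ j * d u v) (huv : d u v ≠ ⊤) :
    ∃ r ∈ A, u ∈ cluster d A lev r ∧ v ∈ cluster d A lev r ∧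
      d r u + d r v ≤ (2 * K + 1 : ℕ) * d u v := by
  classical
  induction hN : K - lev r using Nat.strong_induction_on generalizing j r u v with
  | _ N ih =>
    have hrv : d r v ≤ (j + 1 : ℕ) * d u v := by
      refine (htri r u v).trans ?_
      rw [Nat.cast_add, Nat.cast_one, add_mul, one_mul]
      gcongr
    have hrv' : d r v ≠ ⊤ := fun h =>
      ENNReal.mul_ne_top (ENNReal.natCast_ne_top _) huv (top_le_iff.1 (h ▸ hrv))
    by_cases hv : v ∈ cluster d A lev r
    · refine ⟨r, hr, hu, hv, (add_le_add hru hrv).trans ?_⟩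
      rw [← add_mul, ← Nat.cast_add]
      have := hlev r hr
      exact mul_le_mul_left (Nat.cast_le.2 (by omega)) _
    · obtain ⟨a, ha, hla, hle⟩ : ∃ a ∈ A, lev r < lev a ∧ d a v ≤ d r v := by
        by_contra hc
        push Not at hc
        exact hv ⟨hrv', hc⟩
      -- Of the sources as close to `v` as `r`, one of highest level has `v` in its cluster. The
      -- roles of `u` and `v` are then exchanged; the distance bound grows by one multiple of `d u
      -- v` while the level grows by at least one, so there are at most `K` exchanges.
      obtain ⟨r', hr', hmax⟩ := Finset.exists_max_image (A.filter fun a => d a v ≤ d r v) lev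
        ⟨a, Finset.mem_filter.2 ⟨ha, hle⟩⟩
      obtain ⟨hr'A, hr'v⟩ := Finset.mem_filter.1 hr'
      have hl : lev r < lev r' := hla.trans_le (hmax a (Finset.mem_filter.2 ⟨ha, hle⟩))
      have hl' := hlev r' hr'A
      have hvr' : v ∈ cluster d A lev r' := by
        refine ⟨fun h => hrv' (top_le_iff.1 (h ▸ hr'v)), fun b hb hlb => ?_⟩
        by_contra hc
        exact absurd (hmax b (Finset.mem_filter.2 ⟨hb, (not_lt.1 hc).trans hr'v⟩)) (by omega)
      obtain ⟨r'', h1, h2, h3, h4⟩ := ih (K - lev r') (by omega) (j := j + 1) hr'A (by omega)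
        hvr' (v := u) (hcomm v u ▸ hr'v.trans hrv) (hcomm v u ▸ huv) rfl
      exact ⟨r'', h1, h3, h2, by rw [add_comm, hcomm u v]; exact h4⟩

end Hitting

end VSDO

namespace VSDO

/-! ### Tree covers: shortest path trees -/

section ShortestPathTrees

variable {V : Type u} {G : SimpleGraph V} {w : Sym2 V → ℝ}

/-- A vertex of a shortest path splits the distance. -/
theorem distIn_getVert {S : Set V} {a b : V} {p : G.Walk a b}
    (hp : IsShortestIn w S p) (i : ℕ) :
    distIn G w S a (p.getVert i) = ENNReal.ofReal (pos w p i) ∧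
      distIn G w S (p.getVert i) b ≤ ENNReal.ofReal (wlen w (p.drop i)) := by
  have htake : Inside S (p.take i) := fun x hx => hp.2.1 x
    ((p.isSubwalk_take i).support_subset hx)
  have hdrop : Inside S (p.drop i) := fun x hx => hp.2.1 x
    ((p.isSubwalk_drop i).support_subset hx)
  refine ⟨le_antisymm (distIn_le _ htake) (le_iInf₂ fun q hq => ENNReal.ofReal_le_ofReal ?_),
    distIn_le _ hdrop⟩
  have h1 := hp.2.2 (q.append (p.drop i)) (hq.append hdrop)
  have h2 := pos_add_wlen_drop (w := w) p i
  rw [wlen_append] at h1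
  linarith

theorem mem_of_distIn_ne_top {S : Set V} {a b : V} (h : distIn G w S a b ≠ ⊤) : b ∈ S := by
  by_contra hc
  refine h ?_
  simp only [distIn, iInf_eq_top]
  exact fun p hp => absurd (hp b p.end_mem_support) hc

theorem distIn_self {S : Set V} {a : V} (h : a ∈ S) : distIn G w S a a = 0 := by
  refine le_antisymm ((distIn_le SimpleGraph.Walk.nil ?_).trans (by simp)) zero_le
  intro x hx
  rw [SimpleGraph.Walk.support_nil, List.mem_singleton] at hx
  exact hx ▸ h

theorem distIn_pos [Finite V] (hw : ∀ e ∈ G.edgeSet, 1 ≤ w e) {S : Set V} {a b : V} (hab : a ≠ b) :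
    0 < distIn G w S a b := by
  by_cases h : distIn G w S a b = ⊤
  · rw [h]; exact ENNReal.zero_lt_top
  obtain ⟨p, hp⟩ := exists_shortest_of_distIn_ne_top hw h
  rw [distIn_eq hp, ENNReal.ofReal_pos]
  refine lt_of_lt_of_le ?_ (length_le_wlen hw p)
  rw [Nat.cast_pos, Nat.pos_iff_ne_zero]
  exact fun h0 => hab (SimpleGraph.Walk.eq_of_length_eq_zero h0)

/-- The last edge of the shortest path to `v` starts at the only neighbour of `v` that can. -/
theorem penultimate_eq [Finite V] (hw : ∀ e ∈ G.edgeSet, 1 ≤ w e) {S : Set V}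
    (huniq : ∀ (a b : V) (p q : G.Walk a b), IsShortestIn w S p → IsShortestIn w S q → p = q)
    {r a v : V} {p : G.Walk r v} (hp : IsShortestIn w S p) (hav : G.Adj a v)
    (hd : distIn G w S r v = distIn G w S r a + ENNReal.ofReal (w s(a, v))) :
    p.penultimate = a := by
  classical
  have hv : distIn G w S r v ≠ ⊤ := by rw [distIn_eq hp]; exact ENNReal.ofReal_ne_top
  have ha : distIn G w S r a ≠ ⊤ := fun h => hv (by rw [hd, h, top_add])
  have hwav : 1 ≤ w s(a, v) := hw _ (G.mem_edgeSet.2 hav)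
  obtain ⟨q, hq⟩ := exists_shortest_of_distIn_ne_top hw ha
  rw [distIn_eq hp, distIn_eq hq,
    ← ENNReal.ofReal_add (wlen_nonneg hw q) (by linarith),
    ENNReal.ofReal_eq_ofReal_iff (wlen_nonneg hw p) (by linarith [wlen_nonneg hw q])] at hd
  have hvq : v ∉ q.support := by
    intro hvq
    obtain ⟨i, hi, hiv⟩ := (mem_support_iff_getVert q).1 hvq
    have h1 := (distIn_getVert hq i).1
    rw [hiv, distIn_eq hp, ENNReal.ofReal_eq_ofReal_iff (wlen_nonneg hw p) (pos_nonneg hw q i)] at h1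
    linarith [pos_le_wlen hw q i]
  have hlen : wlen w (q.concat hav) = wlen w p := by
    rw [SimpleGraph.Walk.concat_eq_append, wlen_append, hd]
    simp
  have hqc : IsShortestIn w S (q.concat hav) := by
    refine ⟨hq.1.concat hvq hav, fun x hx => ?_, fun q' hq' => hlen ▸ hp.2.2 q' hq'⟩
    rw [SimpleGraph.Walk.support_concat, List.mem_append, List.mem_singleton] at hx
    rcases hx with hx | rfl
    exacts [hq.2.1 x hx, hp.2.1 _ p.end_mem_support]
  rw [huniq r v p _ hp hqc, SimpleGraph.Walk.penultimate_concat]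

/-- The edge `x y` is the last one of a shortest path from `r` to `y`. -/
def IsTight (w : Sym2 V → ℝ) (S : Set V) (r x y : V) : Prop :=
  distIn G w S r y = distIn G w S r x + ENNReal.ofReal (w s(x, y))

/-- The union of the shortest paths from `r` to the vertices of `X`. -/
def shortestPathTree (G : SimpleGraph V) (w : Sym2 V → ℝ) (S : Set V) (r : V) (X : Set V) :
    G.Subgraph where
  verts := X
  Adj x y := x ∈ X ∧ y ∈ X ∧ G.Adj x y ∧
    (IsTight (G := G) w S r x y ∨ IsTight (G := G) w S r y x)
  adj_sub h := h.2.2.1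
  edge_vert h := h.1
  symm := ⟨fun _ _ h => ⟨h.2.1, h.1, h.2.2.1.symm, h.2.2.2.symm⟩⟩

theorem adj_shortestPathTree (hw : ∀ e ∈ G.edgeSet, 1 ≤ w e) {S X : Set V} {r x : V}
    {p : G.Walk r x} (hp : IsShortestIn w S p) (hX : ∀ y ∈ p.support, y ∈ X) {i : ℕ}
    (hi : i < p.length) :
    (shortestPathTree G w S r X).Adj (p.getVert i) (p.getVert (i + 1)) := by
  have hadj := p.adj_getVert_succ hi
  refine ⟨hX _ (p.getVert_mem_support i), hX _ (p.getVert_mem_support _), hadj, Or.inl ?_⟩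
  have hw1 : 1 ≤ w s(p.getVert i, p.getVert (i + 1)) := hw _ (G.mem_edgeSet.2 hadj)
  rw [IsTight, (distIn_getVert hp i).1, (distIn_getVert hp (i + 1)).1, pos_succ p hi,
    ENNReal.ofReal_add (pos_nonneg hw p i) (by linarith)]

/-- Look at a vertex of a cycle farthest from `r`. Both cycle edges at it are tight towards it, so
by `penultimate_eq` both neighbours precede it on the unique shortest path from `r`; but they are
distinct. -/
theorem isTree_shortestPathTree [Finite V] (hw : ∀ e ∈ G.edgeSet, 1 ≤ w e) {S : Set V}
    (huniq : ∀ (a b : V) (p q : G.Walk a b), IsShortestIn w S p → IsShortestIn w S q → p = q)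
    {r : V} {X : Set V} (hr : r ∈ X) (hX : ∀ x ∈ X, distIn G w S r x ≠ ⊤)
    (hcl : ∀ x ∈ X, ∀ p : G.Walk r x, IsShortestIn w S p → ∀ y ∈ p.support, y ∈ X) :
    (shortestPathTree G w S r X).coe.IsTree := by
  classical
  have hpath : ∀ x ∈ X, ∃ p : G.Walk r x, p.toSubgraph ≤ shortestPathTree G w S r X := by
    intro x hx
    obtain ⟨p, hp⟩ := exists_shortest_of_distIn_ne_top hw (hX x hx)
    refine ⟨p, fun y hy => hcl x hx p hp y (p.mem_verts_toSubgraph.1 hy), fun u v huv => ?_⟩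
    obtain ⟨i, he, hi⟩ := (SimpleGraph.Walk.toSubgraph_adj_iff p).1 huv
    have := adj_shortestPathTree hw hp (hcl x hx p hp) hi
    rw [← SimpleGraph.Subgraph.mem_edgeSet, he] at this
    exact this
  refine ⟨?_, fun v c hc => ?_⟩
  · rw [← SimpleGraph.Subgraph.connected_iff',
      SimpleGraph.Subgraph.connected_iff_forall_exists_walk_subgraph]
    refine ⟨⟨r, hr⟩, fun {u v} hu hv => ?_⟩
    obtain ⟨p, hp⟩ := hpath u hu
    obtain ⟨q, hq⟩ := hpath v hv
    refine ⟨p.reverse.append q, ?_⟩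
    rw [SimpleGraph.Walk.toSubgraph_append, SimpleGraph.Walk.toSubgraph_reverse]
    exact sup_le hp hq
  · obtain ⟨z, hz, hmax⟩ := Finset.exists_max_image c.support.toFinset
      (fun z => distIn G w S r z.1) ⟨v, by simp⟩
    rw [List.mem_toFinset] at hz
    have hc' := hc.rotate hz
    have key : ∀ y : (shortestPathTree G w S r X).verts,
        (shortestPathTree G w S r X).coe.Adj y z → y ∈ c.support → ∀ p : G.Walk r z,
          IsShortestIn w S p → p.penultimate = y := by
      intro y hyz hy p hp
      obtain ⟨-, -, hadj, h | h⟩ := hyz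
      · exact penultimate_eq hw huniq hp hadj h
      · have hle := hmax y (List.mem_toFinset.2 hy)
        have hwe : 1 ≤ w s(z.1, y.1) := hw _ (G.mem_edgeSet.2 hadj.symm)
        have hlt : distIn G w S r z.1 < distIn G w S r y.1 := by
          rw [h]
          exact ENNReal.lt_add_right (hX _ z.2) (by simpa using by linarith)
        exact absurd hle (not_le.2 hlt)
    obtain ⟨p, hp⟩ := exists_shortest_of_distIn_ne_top hw (hX _ z.2)
    have hsupp : ∀ y ∈ (c.rotate z hz).support, y ∈ c.support := fun y hy =>
      (SimpleGraph.Walk.mem_support_rotate_iff c z hz).1 hy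
    refine hc'.snd_ne_penultimate (Subtype.ext ?_)
    rw [← key _ (SimpleGraph.Walk.adj_snd hc'.not_nil).symm
        (hsupp _ (SimpleGraph.Walk.getVert_mem_support _ _)) p hp,
      key _ (SimpleGraph.Walk.adj_penultimate hc'.not_nil)
        (hsupp _ (SimpleGraph.Walk.getVert_mem_support _ _)) p hp]

theorem distIn_shortestPathTree_le [Finite V] (hw : ∀ e ∈ G.edgeSet, 1 ≤ w e) {S : Set V}
    {r x : V} {X : Set V} (hx : x ∈ X) (hd : distIn G w S r x ≠ ⊤)
    (hcl : ∀ x ∈ X, ∀ p : G.Walk r x, IsShortestIn w S p → ∀ y ∈ p.support, y ∈ X) :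
    distIn (shortestPathTree G w S r X).spanningCoe w Set.univ r x ≤ distIn G w S r x := by
  obtain ⟨p, hp⟩ := exists_shortest_of_distIn_ne_top hw hd
  have hedge : ∀ e ∈ p.edges, e ∈ (shortestPathTree G w S r X).spanningCoe.edgeSet := by
    intro e he
    obtain ⟨i, hi, rfl⟩ := List.getElem_of_mem he
    rw [SimpleGraph.Walk.length_edges] at hi
    have := adj_shortestPathTree hw hp (hcl x hx p hp) hi
    rw [SimpleGraph.Walk.getElem_edges]
    exact this
  refine (distIn_le (p.transfer _ hedge) fun _ _ => Set.mem_univ _).trans ?_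
  rw [distIn_eq hp, wlen, wlen, SimpleGraph.Walk.edges_transfer]

end ShortestPathTrees

/-! ### Existence of source-restricted tree covers -/

section TreeCovers

variable {V : Type u} [Fintype V] {I : Input V}

/-- With top level `K = ⌊k⌋ - 1`, the clusters have stretch `2K + 1 ≤ 2k - 1` and overlap `(K + 1) ·
e · (ln n + 1)`, at most `k n^{1/k} (ln n + 1)`. Their shortest path trees realise the distances to
the roots. -/
theorem exists_isTreeCover (hI : I.Admissible) {R S : Finset V} (hRS : Disjoint R S) :
    ∃ T, IsTreeCover I R S T := by
  classical
  have hw := hI.one_le_weight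
  have hn := hI.three_le_n
  have hk := hI.one_lt_k
  set A : Set V := {x | x ∉ R} with hA
  have hSA : ∀ a ∈ S, a ∈ A := fun a ha => Finset.disjoint_right.1 hRS ha
  have huniq : ∀ (a b : V) (p q : I.G.Walk a b), IsShortestIn I.w A p → IsShortestIn I.w A q →
      p = q := hI.unique_shortest A
  set d := distIn I.G I.w A with hd
  have hfl : ⌊I.k⌋₊ ≠ 0 := (Nat.floor_pos.2 hk.le).ne'
  obtain ⟨K, hK⟩ := Nat.exists_eq_succ_of_ne_zero hfl
  have hKk : (K : ℝ) + 1 ≤ I.k := by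
    have := Nat.floor_le (show 0 ≤ I.k by linarith)
    rw [hK] at this
    push_cast at this
    exact this
  have hkK : I.k < K + 1 + 1 := by
    have := Nat.lt_floor_add_one I.k
    rw [hK] at this
    push_cast at this
    exact this
  have hsize : (S.card : ℝ) ≤ Real.exp 1 * (Real.log I.n + 1) * Real.exp K := by
    have h1 : (S.card : ℝ) ≤ I.n := Nat.cast_le.2 (Finset.card_le_univ S)
    -- Rounding `k` down costs the factor `exp(x)` with `0 ≤ x < 1`. It is absorbed by `ln n + 1`,
    -- since `exp(x) ≤ 1 + x + x² ≤ k + 1`.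
    have h2 : Real.exp (I.k - (K + 1)) ≤ I.k + 1 := by
      have h := abs_le.1 (Real.abs_exp_sub_one_sub_id_le (x := I.k - (K + 1))
        (abs_le.2 ⟨by linarith, by linarith⟩))
      have hK0 : (0 : ℝ) ≤ K := Nat.cast_nonneg K
      nlinarith [h.2]
    have h3 : I.n = Real.exp 1 * Real.exp (I.k - (K + 1)) * Real.exp K := by
      rw [← Real.exp_add, ← Real.exp_add, show 1 + (I.k - (K + 1)) + K = I.k by ring, Input.k,
        Real.exp_log (by linarith)]
    refine h1.trans (h3.le.trans ?_)
    rw [← Input.k]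
    gcongr
  obtain ⟨lev, hlev, hover⟩ := exists_levels d (n := I.n) (by linarith) le_rfl K S hsize
  have htop : ∀ r, ∀ x ∈ cluster d S lev r, d r x ≠ ⊤ := fun r x hx => hx.1
  -- A cluster contains the shortest paths from its centre: a competing source at least as close to
  -- a vertex on the way would be at least as close to `x`.
  have hcl : ∀ r, ∀ x ∈ cluster d S lev r, ∀ p : I.G.Walk r x, IsShortestIn I.w A p →
      ∀ y ∈ p.support, y ∈ cluster d S lev r := by
    intro r x hx p hp y hy
    obtain ⟨i, -, rfl⟩ := (mem_support_iff_getVert p).1 hy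
    obtain ⟨h1, h2⟩ := distIn_getVert hp i
    refine ⟨by rw [hd, h1]; exact ENNReal.ofReal_ne_top, fun a ha hla => ?_⟩
    by_contra hc
    refine absurd (hx.2 a ha hla) (not_lt.2 ?_)
    calc d a x ≤ d a (p.getVert i) + d (p.getVert i) x := distIn_triangle hw A _ _ _
      _ ≤ ENNReal.ofReal (pos I.w p i) + ENNReal.ofReal (wlen I.w (p.drop i)) :=
        add_le_add ((not_lt.1 hc).trans h1.le) h2
      _ = d r x := by
        rw [← ENNReal.ofReal_add (pos_nonneg hw p i) (wlen_nonneg hw _), pos_add_wlen_drop, hd,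
          distIn_eq hp]
  have hself : ∀ r ∈ S, r ∈ cluster d S lev r := by
    intro r hr
    have h0 : d r r = 0 := distIn_self (hSA r hr)
    refine ⟨by rw [h0]; exact ENNReal.zero_ne_top, fun a _ hla => ?_⟩
    rw [h0]
    exact distIn_pos hw fun h => by simp [h] at hla
  refine ⟨fun r => shortestPathTree I.G I.w A r (cluster d S lev r), fun r hr => ⟨hself r hr,
    isTree_shortestPathTree hw huniq (hself r hr) (htop r) (hcl r),
    fun x hx => mem_of_distIn_ne_top (htop r x hx)⟩, fun a ha b hb hab => ?_, fun x => ?_⟩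
  · obtain ⟨r, hr, hra, hrb, hle⟩ := exists_common_cluster hlev (distIn_triangle hw A)
      (distIn_comm A) (j := 0) ha (Nat.zero_le _) (hself a ha) (v := b)
      (by rw [distIn_self (hSA a ha)]; exact zero_le) hab
    refine ⟨r, hr, hra, hrb, (add_le_add (distIn_shortestPathTree_le hw hra (htop r a hra) (hcl r))
      (distIn_shortestPathTree_le hw hrb (htop r b hrb) (hcl r))).trans (hle.trans ?_)⟩
    refine mul_le_mul_left ?_ _
    rw [← ENNReal.ofReal_natCast]
    refine ENNReal.ofReal_le_ofReal ?_
    push_cast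
    linarith
  · have h := hover x
    have hset : ({r | r ∈ S ∧ x ∈ cluster d S lev r} : Set V) =
        (S.filter fun r => x ∈ cluster d S lev r : Finset V) := by
      ext r
      simp
    change ((({r | r ∈ S ∧ x ∈ cluster d S lev r} : Set V).ncard : ℕ) : ℝ) ≤ _
    rw [hset, Set.ncard_coe_finset, hI.n_rpow, mul_assoc]
    refine h.trans ?_
    have : 0 < Real.log I.n := by
      rw [← Input.k]
      linarith
    gcongr

end TreeCovers

end VSDO

namespace VSDO

/-! ### Existence of the oracle -/

section Existence

variable {V : Type u} [Fintype V] {I : Input V}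

/-- All tree covers, shortest bipaths and tie-breaking rules that an oracle needs exist. -/
theorem Input.Admissible.nonempty_oracle (hI : I.Admissible) : Nonempty (Oracle I) := by
  classical
  have hcov : ∀ R S : Finset V, ∃ T : V → I.G.Subgraph, Disjoint R S → IsTreeCover I R S T := by
    intro R S
    by_cases h : Disjoint R S
    · obtain ⟨T, hT⟩ := exists_isTreeCover hI h
      exact ⟨T, fun _ => hT⟩
    · exact ⟨fun _ => ⊥, fun h' => absurd h' h⟩
  choose cov hcov using hcov
  have hstored : ∀ (a : List ℕ) (x y : V) (A : Finset V),
      ∃ o : Option (I.G.Walk x y × List (Piece V)),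
        (o = none → ∀ q : I.G.Walk x y, Inside {z | z ∉ A} q →
          ¬ IsBipath I (chainFrom I cov Finset.univ a) q) ∧
        ∀ p code, o = some (p, code) →
          IsCodeOf I (chainFrom I cov Finset.univ a) code p ∧ Inside {z | z ∉ A} p ∧
          ∀ q : I.G.Walk x y, Inside {z | z ∉ A} q →
            IsBipath I (chainFrom I cov Finset.univ a) q → wlen I.w p ≤ wlen I.w q := by
    intro a x y A
    set s := {q : I.G.Walk x y | Inside {z | z ∉ A} q ∧
      IsBipath I (chainFrom I cov Finset.univ a) q} with hs
    have hfin : s.Finite := (finite_setOf_isPath x y).subset fun q hq => by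
      obtain ⟨code, hcode⟩ := hq.2
      exact hcode.1
    rcases s.eq_empty_or_nonempty with h | h
    · refine ⟨none, fun _ q hq hb => ?_, fun p code hp => by simp at hp⟩
      have : q ∈ s := ⟨hq, hb⟩
      simp [h] at this
    · obtain ⟨p, hp, hmin⟩ := Set.exists_min_image s (wlen I.w) hfin h
      obtain ⟨code, hcode⟩ := hp.2
      refine ⟨some (p, code), fun h => by simp at h, fun p' code' h => ?_⟩
      obtain ⟨rfl, rfl⟩ := Prod.mk.inj (Option.some.inj h)
      exact ⟨hcode, hp.1, fun q hq hb => hmin q ⟨hq, hb⟩⟩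
  choose stored hnone hsome using hstored
  have hpick : ∀ (a : List ℕ) (x y : V) (D A : Finset V), ∃ f : V, ∀ p code,
      stored a x y A = some (p, code) → (∃ f ∈ D, f ∈ p.support) →
        f ∈ D ∧ f ∈ p.support ∧ ∀ g ∈ D, g ∈ p.support →
          level (chainFrom I cov Finset.univ a) g ≤ level (chainFrom I cov Finset.univ a) f := by
    intro a x y D A
    rcases ho : stored a x y A with _ | ⟨p, code⟩
    · exact ⟨x, fun p code h => by simp at h⟩
    · by_cases hf : ∃ f ∈ D, f ∈ p.support
      · obtain ⟨f, hf, hmax⟩ := Finset.exists_max_image (D.filter (· ∈ p.support))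
          (level (chainFrom I cov Finset.univ a))
          (by simpa [Finset.Nonempty] using hf)
        rw [Finset.mem_filter] at hf
        refine ⟨f, fun p' code' h _ => ?_⟩
        obtain ⟨rfl, rfl⟩ := Prod.mk.inj (Option.some.inj h)
        exact ⟨hf.1, hf.2, fun g hg hgp => hmax g (Finset.mem_filter.2 ⟨hg, hgp⟩)⟩
      · refine ⟨x, fun p' code' h hf' => ?_⟩
        obtain ⟨rfl, rfl⟩ := Prod.mk.inj (Option.some.inj h)
        exact absurd hf' hf
  choose pick hpick using hpick
  exact ⟨⟨cov, hcov, stored, hnone, hsome, pick, hpick⟩⟩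

end Existence

end VSDO

namespace VSDO

/-! ### Few failures and polynomial weights -/

section Asymptotics

/-- For large `n` the base of the power in `space_le` is at most `N⁴`, where `N = log n`. The power
is at most `N^(4(d+1)) ≤ N^(6d)`, using `d ≥ 2`, and this is at most `n^η` because `d log N ≤ (η/6)
N`. -/
theorem eventually_space_le (c ε e : ℝ) (d : ℕ → ℕ)
    (hd : Filter.Tendsto
      (fun n : ℕ => (d n : ℝ) / (Real.logb 2 n / Real.logb 2 (Real.logb 2 n)))
      Filter.atTop (𝓝 0)) (η : ℝ) (hη : 0 < η) :
    ∀ᶠ n : ℕ in Filter.atTop, ∀ (V : Type u) [Fintype V] (I : Input V), I.Admissible →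
      Fintype.card V = n → I.c = c → I.ε = ε → I.d = d n → I.W ≤ (n : ℝ) ^ e →
      ∀ O : Oracle I, O.space ≤ ENNReal.ofReal ((n : ℝ) ^ (2 + 1 / c + η)) := by
  set K := 8064 * ε⁻¹ * (1 + |e|) with hK
  have hlog : Filter.Tendsto (fun n : ℕ => Real.logb 2 n) Filter.atTop Filter.atTop :=
    (Real.tendsto_logb_atTop one_lt_two).comp tendsto_natCast_atTop_atTop
  -- The bound `η/6` serves the exponent `6d`; the bound 1 guarantees `d ≤ n`, which `space_le`
  -- requires.
  filter_upwards [hd.eventually_lt_const (show 0 < min (η / 6) 1 by positivity),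
    hlog.eventually_ge_atTop (max K 2)] with n hdn hN V _ I hI hcard hc hε hId hW O
  have hIn : I.n = n := by rw [Input.n, hcard]
  have hn3 : (3 : ℝ) ≤ n := hIn ▸ hI.three_le_n
  have hεpos : 0 < ε := hε ▸ hI.ε_pos
  have hcpos : 1 ≤ c := hc ▸ hI.one_le_c
  set N := Real.logb 2 n with hNdef
  have hNK : K ≤ N := (le_max_left _ _).trans hN
  have hN2 : 2 ≤ N := (le_max_right _ _).trans hN
  have hLL : 1 ≤ Real.logb 2 N := by
    rw [Real.le_logb_iff_rpow_le one_lt_two (by linarith), Real.rpow_one]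
    exact hN2
  have hratio : 0 < N / Real.logb 2 N := div_pos (by linarith) (by linarith)
  obtain ⟨hd1, hd2⟩ := lt_min_iff.1 hdn
  rw [div_lt_iff₀ hratio] at hd1 hd2
  have hNn : N ≤ n := by
    rw [hNdef, Real.logb_le_iff_le_rpow one_lt_two (by linarith), Real.rpow_natCast]
    exact_mod_cast (Nat.lt_pow_self one_lt_two).le
  have hdle : I.d ≤ Fintype.card V := by
    have : (d n : ℝ) ≤ n := by
      have := div_le_self (show 0 ≤ N by linarith) hLL
      linarith
    rw [hcard, hId]
    exact_mod_cast this
  have hdLL : (d n : ℝ) * Real.logb 2 N ≤ η / 6 * N := by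
    have := mul_le_mul_of_nonneg_right hd1.le (show 0 ≤ Real.logb 2 N by linarith)
    rwa [mul_assoc, div_mul_cancel₀ _ (by linarith)] at this
  refine (space_le hI hdle O).trans (ENNReal.ofReal_le_ofReal ?_)
  have h2d := hI.two_le_d'
  have hD1 : 1 ≤ Real.logb 2 I.d := by
    rw [Real.le_logb_iff_rpow_le one_lt_two (by linarith), Real.rpow_one]
    exact h2d
  have hdn' : (I.d : ℝ) ≤ n := by rw [← hcard]; exact_mod_cast hdle
  have hDN : Real.logb 2 I.d ≤ N := (Real.logb_le_logb one_lt_two (by linarith) (by linarith)).2 hdn'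
  have hW1 := hI.one_le_W
  have hM : Real.logb 2 (n * I.W) ≤ (1 + |e|) * N := by
    rw [Real.logb_mul (by linarith) (by linarith)]
    have h1 : Real.logb 2 I.W ≤ Real.logb 2 ((n : ℝ) ^ e) :=
      (Real.logb_le_logb one_lt_two (by linarith) (by positivity)).2 hW
    rw [Real.logb_rpow_eq_mul_logb_of_pos (by linarith)] at h1
    have h2 : e * N ≤ |e| * N := mul_le_mul_of_nonneg_right (le_abs_self e) (by linarith)
    linarith
  have hM0 : 0 ≤ Real.logb 2 (n * I.W) :=
    Real.logb_nonneg one_lt_two (by nlinarith)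
  rw [hIn, hc, hε, ← hNdef]
  have hX : 8064 * ε⁻¹ * N ^ 2 * Real.logb 2 (n * I.W) / Real.logb 2 I.d ≤ N ^ 4 := by
    calc 8064 * ε⁻¹ * N ^ 2 * Real.logb 2 (n * I.W) / Real.logb 2 I.d
        ≤ 8064 * ε⁻¹ * N ^ 2 * Real.logb 2 (n * I.W) := div_le_self (by positivity) hD1
      _ ≤ 8064 * ε⁻¹ * N ^ 2 * ((1 + |e|) * N) := mul_le_mul_of_nonneg_left hM (by positivity)
      _ = K * N ^ 3 := by rw [hK]; ring
      _ ≤ N * N ^ 3 := mul_le_mul_of_nonneg_right hNK (by positivity)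
      _ = N ^ 4 := by ring
  have hpow : (8064 * ε⁻¹ * N ^ 2 * Real.logb 2 (n * I.W) / Real.logb 2 I.d) ^ (I.d + 1) ≤
      (n : ℝ) ^ η := by
    calc _ ≤ (N ^ 4) ^ (I.d + 1) := pow_le_pow_left₀ (by positivity) hX _
      _ = N ^ (4 * (I.d + 1)) := by rw [← pow_mul]
      _ ≤ N ^ (6 * I.d) := pow_le_pow_right₀ (by linarith) (by have := hI.two_le_d; omega)
      _ ≤ (n : ℝ) ^ η := by
        rw [← Real.logb_le_logb one_lt_two (by positivity) (by positivity),
          Real.logb_pow, Real.logb_rpow_eq_mul_logb_of_pos (by linarith), hId, ← hNdef]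
        push_cast
        linarith
  have hn0 : (0 : ℝ) < n := by linarith
  rw [Real.rpow_add hn0 (2 + 1 / c) η]
  have hp : (0 : ℝ) ≤ (n : ℝ) ^ (2 + 1 / c) := by positivity
  have hDN1 : Real.logb 2 I.d / N ≤ 1 := (div_le_one (by linarith)).2 hDN
  refine mul_le_mul ?_ hpow (by positivity) hp
  calc _ ≤ (n : ℝ) ^ (2 + 1 / c) * 1 := mul_le_mul_of_nonneg_left hDN1 hp
    _ = _ := mul_one _

end Asymptotics

end VSDO

/-! ### The main theorem -/

theorem mainTheorem4 :
    (∃ C : ℝ, 0 < C ∧ ∀ (V : Type u) [Fintype V] (I : VSDO.Input V), I.Admissible →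
      Nonempty (VSDO.Oracle I) ∧
      ∀ O : VSDO.Oracle I,
        -- the words stored for a path determine the path
        (∀ (a : List ℕ) (x y : V) (code : List (VSDO.Piece V)) (p q : I.G.Walk x y),
          VSDO.IsCodeOf I (O.chain a) code p → VSDO.IsCodeOf I (O.chain a) code q → p = q) ∧
        -- queries
        (∀ D : Finset V, D.card ≤ I.d →
          (∃ a, O.IsNode a ∧ VSDO.PathFinding I O.cov D Finset.univ a) ∧
          ∀ a, O.IsNode a → ∀ x y : V, x ∉ D → y ∉ D →
            ∀ u v : {z // z ∈ O.vertsH a D x y},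
              (∀ p code, O.stored a u v (O.finalNode a u v D) = some (p, code) →
                ∀ f ∈ D, f ∉ p.support) ∧
              VSDO.distIn I.G I.w {z | z ∉ D} u v ≤ O.distH a D (O.vertsH a D x y) u v ∧
              O.distH a D (O.vertsH a D x y) u v ≤
                ENNReal.ofReal (1 + I.ε) * VSDO.distIn I.G I.w {z | z ∉ D} u v) ∧
        -- space
        (I.d ≤ Fintype.card V →
          O.space ≤ ENNReal.ofReal (I.n ^ (2 + 1 / I.c) * (Real.logb 2 I.d / Real.logb 2 I.n) *
            (C * I.ε⁻¹ * Real.logb 2 I.n ^ 2 * Real.logb 2 (I.n * I.W) / Real.logb 2 I.d) ^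
              (I.d + 1)))) ∧
    -- space when `d = o(log n / log log n)` and `W = poly(n)`
    (∀ (c ε e : ℝ) (d : ℕ → ℕ),
      Filter.Tendsto (fun n : ℕ => (d n : ℝ) / (Real.logb 2 n / Real.logb 2 (Real.logb 2 n)))
        Filter.atTop (𝓝 0) →
      ∀ η : ℝ, 0 < η → ∀ᶠ n : ℕ in Filter.atTop,
        ∀ (V : Type u) [Fintype V] (I : VSDO.Input V), I.Admissible → Fintype.card V = n →
          I.c = c → I.ε = ε → I.d = d n → I.W ≤ (n : ℝ) ^ e →
          ∀ O : VSDO.Oracle I, O.space ≤ ENNReal.ofReal ((n : ℝ) ^ (2 + 1 / c + η))) := by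
  classical
  refine ⟨⟨8064, by norm_num, fun V _ I hI => ⟨hI.nonempty_oracle, fun O => ⟨?_, ?_, ?_⟩⟩⟩,
    VSDO.eventually_space_le⟩
  · exact fun a x y code p q hp hq => hp.unique hI hq
  · intro D hD
    refine ⟨VSDO.exists_pathFinding hI O.cov_spec D Finset.univ, fun a _ x y hx hy u v => ?_⟩
    have hQD : ∀ z ∈ O.vertsH a D x y, z ∉ D := by
      intro z hz
      rw [VSDO.Oracle.vertsH, Finset.mem_sdiff] at hz
      exact hz.2
    refine ⟨fun p code hp => VSDO.finalNode_avoids O a (hQD u u.2) (hQD v v.2) hD p code hp,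
      VSDO.distIn_le_distH O a hI hD hQD u v, VSDO.distH_le O a hI (fun f hf z hz hn => ?_) hQD u v⟩
    rw [VSDO.Oracle.vertsH, Finset.mem_sdiff, Finset.mem_union, Finset.mem_filter]
    exact ⟨Or.inr ⟨Finset.mem_univ z, f, hf, hn⟩, hz⟩
  · exact fun hd => VSDO.space_le hI hd O
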